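/- Let $m\ge 1$ and $n\ge 0$ be integers with $|m-n|>2$, and let $\mathfrak g=\mathfrak{sl}(m|n)$ be the complex Lie superalgebra of $(m+n)\times(m+n)$ matrices with vanishing supertrace, where indices $i\le m$ are even ($|i|=0$) and indices $i>m$ are odd ($|i|=1$). Write $\epsilon_1,\dots,\epsilon_m,\delta_1,\dots,\delta_n$ for the coordinate functions (diagonal entries) on the Cartan subalgebra of diagonal matrices, and take the upper triangular matrices as Borel subalgebra. Let $\langle X,Y\rangle=2(m-n)\sum_{i,j}(-1)^{|i|}X_{ij}Y_{ji}$ be the Killing form. Let the Cartan product $\mathfrak g\circledcirc\mathfrak g$ be the direct summand of the $\mathfrak g$-module $\mathfrak g\otimes\mathfrak g$ that is isomorphic to the simple module of highest weight $2\epsilon_1-\delta_{n-1}-\delta_n$ (to be read as $2\epsilon_1-\epsilon_m-\delta_1$ if $n=1$, and as $2\epsilon_1-2\epsilon_m$ if $n=0$), and let $X\circledcirc Y$ be the image of $X\otimes Y$ under the $\mathfrak g$-equivariant projection of $\mathfrak g\otimes\mathfrak g$ onto $\mathfrak g\circledcirc\mathfrak g$. For $\lambda\in\mathbb C$ let $\mathcal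 J_\lambda$ be the two-sided ideal of the tensor algebra $T(\mathfrak g)$ generated by the elements $$X\otimes Y-X\circledcirc Y-\tfrac12[X,Y]-\lambda\langle X,Y\rangle\qquad(X,Y\in\mathfrak g),$$ and let $J_\lambda$ be the two-sided ideal of the universal enveloping algebra $U(\mathfrak g)$ generated by the image of $\mathcal J_\lambda$ (so that $T(\mathfrak g)/\mathcal J_\lambda\cong U(\mathfrak g)/J_\lambda$). Put $\lambda^c=-\dfrac{1}{8(m-n+1)}$. (i) For $\lambda\ne\lambda^c$ the ideal $J_\lambda$ has finite codimension in $U(\mathfrak g)$; more precisely, $J_\lambda=U(\mathfrak g)$ for $\lambda\notin\{0,\lambda^c\}$, and $J_0=\mathfrak g\,U(\mathfrak g)$. (ii) If $m\ge 2$, then $J_{\lambda^c}$ (the Joseph ideal) has infinite codimension in $U(\mathfrak g)$. -/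

import Mathlib

open scoped TensorProduct

noncomputable section

namespace SuperJoseph

/-- Square matrices of size `m + n`, i.e. `𝔤𝔩(m|n)`: the first `m` indices are even, the last `n`
are odd. -/
abbrev Mat (m n : ℕ) : Type := Matrix (Fin (m + n)) (Fin (m + n)) ℂ

/-- The parity of an index. -/
def parity (m n : ℕ) (i : Fin (m + n)) : Fin 2 := if i.val < m then 0 else 1

/-- The supertrace `∑ᵢ (-1)^{|i|} Aᵢᵢ`. -/
def supertrace (m n : ℕ) : Mat m n →ₗ[ℂ] ℂ where
  toFun A := ∑ i, (-1 : ℂ) ^ (parity m n i).val * A i i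
  map_add' A B := by simp [mul_add, Finset.sum_add_distrib]
  map_smul' c A := by
    simp only [Matrix.smul_apply, smul_eq_mul, RingHom.id_apply, Finset.mul_sum]
    exact Finset.sum_congr rfl fun i _ => by ring

/-- The even component of a matrix (the two diagonal blocks). -/
def evenPart (m n : ℕ) : Mat m n →ₗ[ℂ] Mat m n where
  toFun A := Matrix.of fun i j => if parity m n i = parity m n j then A i j else 0
  map_add' A B := by ext i j; by_cases h : parity m n i = parity m n j <;> simp [h]
  map_smul' c A := by ext i j; by_cases h : parity m n i = parity m n j <;> simp [h]

/-- The odd component of a matrix (the two off-diagonal blocks). -/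
def oddPart (m n : ℕ) : Mat m n →ₗ[ℂ] Mat m n := LinearMap.id - evenPart m n

/-- The product `(-1)^{|A||B|} B A`, extended bilinearly from homogeneous matrices. -/
def signedSwapMul (m n : ℕ) (A B : Mat m n) : Mat m n :=
  evenPart m n B * evenPart m n A + evenPart m n B * oddPart m n A
    + oddPart m n B * evenPart m n A - oddPart m n B * oddPart m n A

/-- The superbracket of `𝔤𝔩(m|n)`: `[A, B] = A B - (-1)^{|A||B|} B A` on homogeneous matrices. -/
def matBracket (m n : ℕ) : Mat m n →ₗ[ℂ] Mat m n →ₗ[ℂ] Mat m n :=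
  LinearMap.mk₂ ℂ (fun A B => A * B - signedSwapMul m n A B)
    (fun A A' B => by simp only [signedSwapMul, map_add]; noncomm_ring)
    (fun c A B => by
      simp only [signedSwapMul, map_smul, Matrix.smul_mul, Matrix.mul_smul, smul_sub, smul_add])
    (fun A B B' => by simp only [signedSwapMul, map_add]; noncomm_ring)
    (fun c A B => by
      simp only [signedSwapMul, map_smul, Matrix.smul_mul, Matrix.mul_smul, smul_sub, smul_add])

theorem supertrace_evenPart (m n : ℕ) (A : Mat m n) :
    supertrace m n (evenPart m n A) = supertrace m n A := by
  simp [supertrace, evenPart]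

theorem supertrace_matBracket (m n : ℕ) (A B : Mat m n) :
    supertrace m n (matBracket m n A B) = 0 := by
  have key : ∀ i : Fin (m + n),
      (-1 : ℂ) ^ (parity m n i).val * signedSwapMul m n A B i i
        = ∑ k, (-1 : ℂ) ^ (parity m n k).val * (A k i * B i k) := by
    intro i
    simp only [signedSwapMul, oddPart, LinearMap.sub_apply, LinearMap.id_apply, evenPart,
      LinearMap.coe_mk, AddHom.coe_mk, Matrix.sub_apply, Matrix.add_apply, Matrix.mul_apply,
      Matrix.of_apply, ← Finset.sum_add_distrib, ← Finset.sum_sub_distrib, Finset.mul_sum]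
    refine Finset.sum_congr rfl fun k _ => ?_
    generalize parity m n i = a
    generalize parity m n k = b
    fin_cases a <;> fin_cases b <;> simp <;> ring
  have h1 : supertrace m n (A * B)
      = ∑ i, ∑ k, (-1 : ℂ) ^ (parity m n k).val * (A k i * B i k) := by
    rw [Finset.sum_comm]
    simp [supertrace, Matrix.mul_apply, Finset.mul_sum]
  have h2 : supertrace m n (signedSwapMul m n A B)
      = ∑ i, ∑ k, (-1 : ℂ) ^ (parity m n k).val * (A k i * B i k) := by
    simp only [supertrace, LinearMap.coe_mk, AddHom.coe_mk]
    exact Finset.sum_congr rfl fun i _ => key i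
  change supertrace m n (A * B - signedSwapMul m n A B) = 0
  rw [map_sub, h1, h2, sub_self]

/-- The Lie superalgebra `𝔰𝔩(m|n)` of matrices with vanishing supertrace. -/
abbrev sl (m n : ℕ) : Submodule ℂ (Mat m n) := LinearMap.ker (supertrace m n)

/-- The superbracket of `𝔰𝔩(m|n)`. -/
def bracket (m n : ℕ) : sl m n →ₗ[ℂ] sl m n →ₗ[ℂ] sl m n :=
  LinearMap.mk₂ ℂ
    (fun X Y => ⟨matBracket m n X Y, supertrace_matBracket m n X Y⟩)
    (fun X X' Y => by ext1; simp)
    (fun c X Y => by ext1; simp)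
    (fun X Y Y' => by ext1; simp)
    (fun c X Y => by ext1; simp)

/-- The even component of an element of `𝔰𝔩(m|n)`. -/
def slEven (m n : ℕ) : sl m n →ₗ[ℂ] sl m n :=
  (evenPart m n).restrict fun A hA => by
    rw [LinearMap.mem_ker] at hA ⊢
    rw [supertrace_evenPart, hA]

/-- The odd component of an element of `𝔰𝔩(m|n)`. -/
def slOdd (m n : ℕ) : sl m n →ₗ[ℂ] sl m n := LinearMap.id - slEven m n

/-- `X` is homogeneous of parity `a` (zero is homogeneous of both parities). -/
def IsHomogeneous (m n : ℕ) (a : Fin 2) (X : sl m n) : Prop :=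
  ∀ i j, X.val i j ≠ 0 → parity m n i + parity m n j = a

/-- The Killing form `⟨X, Y⟩ = 2 (m - n) ∑ᵢⱼ (-1)^{|i|} Xᵢⱼ Yⱼᵢ`. -/
def killing (m n : ℕ) (X Y : sl m n) : ℂ :=
  2 * ((m : ℂ) - (n : ℂ)) *
    ∑ i, ∑ j, (-1 : ℂ) ^ (parity m n i).val * (X.val i j * Y.val j i)

/-- The adjoint action on the second tensor power:
`X · (Y ⊗ Z) = [X, Y] ⊗ Z + (-1)^{|X||Y|} Y ⊗ [X, Z]` for homogeneous `X` and `Y`. -/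
def tensorAct (m n : ℕ) (X : sl m n) :
    (sl m n ⊗[ℂ] sl m n) →ₗ[ℂ] (sl m n ⊗[ℂ] sl m n) :=
  TensorProduct.map (bracket m n X) LinearMap.id
    + TensorProduct.map LinearMap.id (bracket m n (slEven m n X))
    + TensorProduct.map (slEven m n - slOdd m n) (bracket m n (slOdd m n X))

/-- `W` is a `𝔤`-submodule of `𝔤 ⊗ 𝔤`. -/
def IsInvariant (m n : ℕ) (W : Submodule ℂ (sl m n ⊗[ℂ] sl m n)) : Prop :=
  ∀ X : sl m n, ∀ t ∈ W, tensorAct m n X t ∈ W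

/-- The diagonal entry of a matrix in (zero-based) position `k`. -/
def diagEntry (m n : ℕ) (H : Mat m n) (k : ℕ) : ℂ :=
  if h : k < m + n then H ⟨k, h⟩ ⟨k, h⟩ else 0

/-- The weight `2ε₁ - δₙ₋₁ - δₙ` of the Cartan product, where `δₙ₋₁` is read as `ε_m` if `n = 1`;
if `n = 0` it is `2ε₁ - 2ε_m`. -/
def cartanWeight (m n : ℕ) (H : Mat m n) : ℂ :=
  2 * diagEntry m n H 0 - diagEntry m n H (m + n - 1)
    - (if n = 0 then diagEntry m n H (m + n - 1) else diagEntry m n H (m + n - 2))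

/-- `v` is a highest weight vector of weight `cartanWeight m n`, for the Borel subalgebra of upper
triangular matrices and the Cartan subalgebra of diagonal matrices. -/
structure IsCartanHighestWeightVector (m n : ℕ) (v : sl m n ⊗[ℂ] sl m n) : Prop where
  ne_zero : v ≠ 0
  upper : ∀ X : sl m n, (∀ i j, j ≤ i → X.val i j = 0) → tensorAct m n X v = 0
  weight : ∀ H : sl m n, H.val.IsDiag → tensorAct m n H v = cartanWeight m n H.val • v

/-- The `𝔤`-submodule `W` of `𝔤 ⊗ 𝔤` is simple, of highest weight `cartanWeight m n`. -/
structure IsCartanSimple (m n : ℕ) (W : Submodule ℂ (sl m n ⊗[ℂ] sl m n)) : Prop where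
  invariant : IsInvariant m n W
  highest : ∃ v ∈ W, IsCartanHighestWeightVector m n v
  simple : ∀ W' ≤ W, IsInvariant m n W' → W' = ⊥ ∨ W' = W

/-- `P` is a `𝔤`-equivariant projection of `𝔤 ⊗ 𝔤` onto a direct summand which is the simple module
of highest weight `cartanWeight m n`. -/
structure IsCartanProjection (m n : ℕ)
    (P : (sl m n ⊗[ℂ] sl m n) →ₗ[ℂ] (sl m n ⊗[ℂ] sl m n)) : Prop where
  equivariant : ∀ X : sl m n, P ∘ₗ tensorAct m n X = tensorAct m n X ∘ₗ P
  idempotent : P ∘ₗ P = P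
  range : IsCartanSimple m n (LinearMap.range P)

/-- The projection of `𝔤 ⊗ 𝔤` onto the Cartan product `𝔤 ⊚ 𝔤`. -/
def cartanProjection (m n : ℕ) : (sl m n ⊗[ℂ] sl m n) →ₗ[ℂ] (sl m n ⊗[ℂ] sl m n) :=
  Classical.epsilon (IsCartanProjection m n)

/-- `X ⊚ Y`, the component of `X ⊗ Y` in the Cartan product. -/
def cartanProduct (m n : ℕ) (X Y : sl m n) : sl m n ⊗[ℂ] sl m n :=
  cartanProjection m n (X ⊗ₜ[ℂ] Y)

/-- The tensor algebra `T(𝔤)`. -/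
abbrev T (m n : ℕ) : Type := TensorAlgebra ℂ (sl m n)

/-- The inclusion of `𝔤 ⊗ 𝔤` in `T(𝔤)`. -/
def incl₂ (m n : ℕ) : (sl m n ⊗[ℂ] sl m n) →ₗ[ℂ] T m n :=
  LinearMap.mul' ℂ (T m n) ∘ₗ
    TensorProduct.map (TensorAlgebra.ι ℂ) (TensorAlgebra.ι ℂ)

/-- The relations `X ⊗ Y - (-1)^{|X||Y|} Y ⊗ X = [X, Y]`, for homogeneous `X` and `Y`. -/
inductive EnvRel (m n : ℕ) : T m n → T m n → Prop
  | super_comm (a b : Fin 2) (X Y : sl m n) (hX : IsHomogeneous m n a X)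
      (hY : IsHomogeneous m n b Y) :
      EnvRel m n
        (TensorAlgebra.ι ℂ X * TensorAlgebra.ι ℂ Y
          - (-1 : ℂ) ^ (a.val * b.val) • (TensorAlgebra.ι ℂ Y * TensorAlgebra.ι ℂ X))
        (TensorAlgebra.ι ℂ (bracket m n X Y))

/-- The universal enveloping algebra `U(𝔤)`. -/
abbrev U (m n : ℕ) : Type := RingQuot (EnvRel m n)

/-- The quotient map `T(𝔤) → U(𝔤)`. -/
def toU (m n : ℕ) : T m n →ₐ[ℂ] U m n := RingQuot.mkAlgHom ℂ (EnvRel m n)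

/-- The canonical map `𝔤 → U(𝔤)`. -/
def ιU (m n : ℕ) : sl m n →ₗ[ℂ] U m n :=
  (toU m n).toLinearMap ∘ₗ TensorAlgebra.ι ℂ

/-- The two-sided ideal of `T(𝔤)` generated by the elements
`X ⊗ Y - X ⊚ Y - ½ [X, Y] - lam ⟨X, Y⟩`. -/
def tensorIdeal (m n : ℕ) (lam : ℂ) : TwoSidedIdeal (T m n) :=
  TwoSidedIdeal.span
    {t | ∃ X Y : sl m n,
      t = TensorAlgebra.ι ℂ X * TensorAlgebra.ι ℂ Y - incl₂ m n (cartanProduct m n X Y)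
        - (1 / 2 : ℂ) • TensorAlgebra.ι ℂ (bracket m n X Y)
        - algebraMap ℂ (T m n) (lam * killing m n X Y)}

/-- The two-sided ideal `J_lam` of `U(𝔤)`, generated by the image of `tensorIdeal m n lam`. -/
def J (m n : ℕ) (lam : ℂ) : TwoSidedIdeal (U m n) :=
  (tensorIdeal m n lam).map (toU m n)

/-- A two-sided ideal of `U(𝔤)` has finite codimension. -/
def FiniteCodim (m n : ℕ) (I : TwoSidedIdeal (U m n)) : Prop :=
  Module.Finite ℂ I.ringCon.Quotient

/-- The subspace `𝔤 U(𝔤)`, spanned by the products `X u` with `X ∈ 𝔤` and `u ∈ U(𝔤)`. -/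
def gU (m n : ℕ) : Submodule ℂ (U m n) :=
  LinearMap.range (ιU m n) * ⊤

/-- The critical value `-1 / (8 (m - n + 1))`. -/
def criticalValue (m n : ℕ) : ℂ := -1 / (8 * ((m : ℂ) - (n : ℂ) + 1))

end SuperJoseph

end

/-!
The proof works in coordinates: `𝔤 ⊗ 𝔤` is embedded in `𝔤𝔩 ⊗ 𝔤𝔩 = V ⊗ V* ⊗ V ⊗ V*`, and a tensor is
a function of four indices, on which the matrix units act by explicit signed formulas (`act`).

*The Cartan product.* It is the traceless part `tracelessSym` of `S²V ⊗ S²V*`. Its complement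
`antisymTrace` is spanned by the tensors that are antisymmetrized in the rows or in the columns and
by the tensors `A ⊗ 1`; the sum is direct because the partial supertrace of the symmetrization of
`A ⊗ 1` is `(d + 2) A + str(A) 1` with `d = m - n`, and `d + 1`, `d + 2` are not zero
(`isCompl_tracelessSym`). For a contravariant form the two spaces are orthogonal complements of each
other. A stable subspace that contains `antisymTrace` and one tensor `E z a ⊗ E z b`, with `z` even
and `z, a, b` distinct, is everything (`eq_top_of_unit_mem`). Applied to a submodule or to its
orthogonal complement, according to whether the submodule meets the weight space
of the highest weight, this shows that `tracelessSym` is simple (`eq_bot_or_eq_tracelessSym`). Any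
projection onto a simple summand of this highest weight has the same range as the explicit one. The
difference of the two is an equivariant map into this simple module which kills the whole weight
space of the highest weight; so it is not surjective, hence zero (`IsCartanProjection.eq_slProj`).

*The ideal.* The bracket and the Killing form vanish on the Cartan product, so `J` is generated by
the relations `X Y - ½ [X, Y] - lam ⟨X, Y⟩` summed along elements of `antisymTrace`.

*Values other than the critical one.* Since `|m - n| > 2`, there are three indices of the same
parity. Evaluating `E₂₁ E₁₂ E₂₃` in two ways with the relations antisymmetrized in the rows gives
`(8 lam (m - n + 1) + 1) E₂₃ = 0` in the quotient. If `lam` is not critical, `E₂₃` lies in `J`, hence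
so does all of `𝔤`. The constant term of the relations is then a multiple of `lam` which lies in `J`,
so that `J` is everything if `lam ≠ 0`; for `lam = 0` the augmentation kills `J`.

*The critical value.* If `a i`, `b i` generate a Weyl superalgebra, the elements `r i j = a i * b j`
represent `𝔤𝔩`, and their normally ordered products are supersymmetric in the rows and in the
columns. On the eigenspace of the Euler operator `∑ a i * b i` of eigenvalue `-(m - n) / 2`, all
relations of `J` at the critical value follow from this supersymmetry (`J_le_ker_oscillatorHom`). In
the action on formal sums of monomials with complex exponents (`raise`, `lower`), two even variables
`x`, `y` suffice to find monomials `x ^ (s - k) * y ^ k`, with `s = -(m - n) / 2`, in this eigenspace;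
on these `E₁₁ - E₂₂` has infinitely many eigenvalues. An element with this property is not algebraic modulo `J`.
-/

noncomputable section

set_option linter.unusedSectionVars false

namespace SuperJoseph

/-! ### Koszul signs and the action of `𝔤𝔩` on coordinates -/

/-- The Koszul sign `(-1)^{xy}` of two parities. -/
def sg (x y : Fin 2) : ℂ := (-1) ^ (x.val * y.val)

theorem sg_comm (x y : Fin 2) : sg x y = sg y x := by
  simp only [sg, mul_comm]

@[simp] theorem sg_zero_left (x : Fin 2) : sg 0 x = 1 := by simp [sg]

@[simp] theorem sg_zero_right (x : Fin 2) : sg x 0 = 1 := by simp [sg]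

theorem sg_add_left (x y z : Fin 2) : sg (x + y) z = sg x z * sg y z := by
  fin_cases x <;> fin_cases y <;> fin_cases z <;> simp [sg]

theorem sg_add_right (x y z : Fin 2) : sg z (x + y) = sg z x * sg z y := by
  fin_cases x <;> fin_cases y <;> fin_cases z <;> simp [sg]

theorem sg_eq_one_or (x y : Fin 2) : sg x y = 1 ∨ sg x y = -1 := by
  fin_cases x <;> fin_cases y <;> simp [sg]

@[simp] theorem sg_mul_self (x y : Fin 2) : sg x y * sg x y = 1 := by
  rcases sg_eq_one_or x y with h | h <;> simp [h]

@[simp] theorem sg_ne_zero (x y : Fin 2) : sg x y ≠ 0 := by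
  rcases sg_eq_one_or x y with h | h <;> simp [h]

theorem sg_self_eq (x : Fin 2) : sg x x = (-1) ^ x.val := by
  fin_cases x <;> simp [sg]

section Coordinates

variable {I : Type*} [Fintype I] [DecidableEq I] (p : I → Fin 2)

/-- Elements of `𝔤𝔩 ⊗ 𝔤𝔩` given by their coordinates: `t (i, j, k, l)` is the coefficient of
`E i j ⊗ E k l`. -/
abbrev Coord (I : Type*) : Type _ := I × I × I × I → ℂ

/-- The adjoint action of the matrix unit `E a b` on `𝔤𝔩 ⊗ 𝔤𝔩`, in coordinates. -/
def act (a b : I) : Coord I →ₗ[ℂ] Coord I where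
  toFun t x :=
    (if x.1 = a then t (b, x.2.1, x.2.2.1, x.2.2.2) else 0)
    - (if x.2.1 = b then
        sg (p a + p b) (p x.1 + p a) * t (x.1, a, x.2.2.1, x.2.2.2) else 0)
    + sg (p a + p b) (p x.1 + p x.2.1) *
      ((if x.2.2.1 = a then t (x.1, x.2.1, b, x.2.2.2) else 0)
      - (if x.2.2.2 = b then
          sg (p a + p b) (p x.2.2.1 + p a) * t (x.1, x.2.1, x.2.2.1, a) else 0))
  map_add' s t := by
    ext x
    simp only [Pi.add_apply]
    split_ifs <;> ring
  map_smul' c t := by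
    ext x
    simp only [Pi.smul_apply, smul_eq_mul, RingHom.id_apply]
    split_ifs <;> ring

theorem act_apply (a b i j k l : I) (t : Coord I) :
    act p a b t (i, j, k, l) =
    (if i = a then t (b, j, k, l) else 0)
    - (if j = b then sg (p a + p b) (p i + p a) * t (i, a, k, l) else 0)
    + sg (p a + p b) (p i + p j) *
      ((if k = a then t (i, j, b, l) else 0)
      - (if l = b then sg (p a + p b) (p k + p a) * t (i, j, k, a) else 0)) := rfl

/-- The coordinates of `E i j ⊗ E k l`. -/
def unit (i j k l : I) : Coord I := Pi.single (i, j, k, l) 1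

theorem unit_apply (i j k l i' j' k' l' : I) :
    unit i j k l (i', j', k', l') = if i = i' ∧ j = j' ∧ k = k' ∧ l = l' then 1 else 0 := by
  simp only [unit, Pi.single_apply, Prod.mk.injEq, eq_comm]

theorem act_unit (a b i j k l : I) :
    act p a b (unit i j k l) =
    (if b = i then unit a j k l else 0)
    - (if a = j then sg (p a + p b) (p i + p j) • unit i b k l else 0)
    + sg (p a + p b) (p i + p j) •
      ((if b = k then unit i j a l else 0)
      - (if a = l then sg (p a + p b) (p k + p l) • unit i j k b else 0)) := by
  ext ⟨i', j', k', l'⟩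
  have e1 : (if b = i then unit a j k l else 0 : Coord I) (i', j', k', l') =
      if i' = a then unit i j k l (b, j', k', l') else 0 := by
    simp only [ite_apply, unit_apply, Pi.zero_apply, eq_comm (a := b), eq_comm (a := a), ite_and]
    split_ifs <;> rfl
  have e2 : (if a = j then sg (p a + p b) (p i + p j) • unit i b k l else 0 : Coord I)
      (i', j', k', l') =
      if j' = b then sg (p a + p b) (p i' + p a) * unit i j k l (i', a, k', l') else 0 := by
    by_cases h : a = j
    · subst h
      by_cases hi : i = i'
      · subst hi
        simp only [if_true, Pi.smul_apply, unit_apply, smul_eq_mul, eq_comm (a := b), ite_and]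
        split_ifs <;> simp
      · simp [unit_apply, hi]
    · simp [h, unit_apply, Ne.symm h]
  have e3 : (if b = k then unit i j a l else 0 : Coord I) (i', j', k', l') =
      if k' = a then unit i j k l (i', j', b, l') else 0 := by
    simp only [ite_apply, unit_apply, Pi.zero_apply, eq_comm (a := b), eq_comm (a := a), ite_and]
    split_ifs <;> rfl
  have e4 : (if a = l then sg (p a + p b) (p k + p l) • unit i j k b else 0 : Coord I)
      (i', j', k', l') =
      if l' = b then sg (p a + p b) (p k' + p a) * unit i j k l (i', j', k', a) else 0 := by
    by_cases h : a = l
    · subst h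
      by_cases hi : k = k'
      · subst hi
        simp only [if_true, Pi.smul_apply, unit_apply, smul_eq_mul, eq_comm (a := b), ite_and]
        split_ifs <;> simp
      · simp [unit_apply, hi]
    · simp [h, unit_apply, Ne.symm h]
  rw [act_apply, Pi.add_apply, Pi.sub_apply, Pi.smul_apply, Pi.sub_apply, e1, e2, e3, e4,
    smul_eq_mul]
  by_cases hi : i = i'
  · by_cases hj : j = j'
    · subst hi hj; rfl
    · simp [unit_apply, hj]
  · simp [unit_apply, hi]

/-- A subspace of `𝔤𝔩 ⊗ 𝔤𝔩` that is stable under the adjoint action. -/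
def Stable (M : Submodule ℂ (Coord I)) : Prop := ∀ a b, ∀ t ∈ M, act p a b t ∈ M

/-- The sign by which the exchange of the two row indices acts on `E i j ⊗ E k l`. -/
def rowSign (i j k : I) : ℂ := sg (p j) (p k) * sg (p i) (p k) * sg (p i) (p j)

/-- The sign by which the exchange of the two column indices acts on `E i j ⊗ E k l`. -/
def colSign (j k l : I) : ℂ := sg (p j) (p k) * sg (p j) (p l) * sg (p k) (p l)

/-- The traceless part of `S²V ⊗ S²V*` inside `𝔤𝔩 ⊗ 𝔤𝔩 = V ⊗ V* ⊗ V ⊗ V*`. -/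
def tracelessSym : Submodule ℂ (Coord I) where
  carrier := {t | (∀ i j k l, t (i, j, k, l) = rowSign p i j k * t (k, j, i, l)) ∧
    (∀ i j k l, t (i, j, k, l) = colSign p j k l * t (i, l, k, j)) ∧
    ∀ i j, ∑ k, sg (p k) (p k) * t (i, j, k, k) = 0}
  add_mem' {s t} hs ht := by
    refine ⟨fun i j k l => ?_, fun i j k l => ?_, fun i j => ?_⟩
    · rw [Pi.add_apply, Pi.add_apply, hs.1, ht.1, mul_add]
    · rw [Pi.add_apply, Pi.add_apply, hs.2.1, ht.2.1, mul_add]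
    · simp [mul_add, Finset.sum_add_distrib, hs.2.2, ht.2.2]
  zero_mem' := by simp
  smul_mem' c t ht := by
    refine ⟨fun i j k l => ?_, fun i j k l => ?_, fun i j => ?_⟩
    · rw [Pi.smul_apply, Pi.smul_apply, ht.1, smul_eq_mul, smul_eq_mul]; ring
    · rw [Pi.smul_apply, Pi.smul_apply, ht.2.1, smul_eq_mul, smul_eq_mul]; ring
    · have : ∀ k, sg (p k) (p k) * (c • t) (i, j, k, k)
          = c * (sg (p k) (p k) * t (i, j, k, k)) := fun k => by
        rw [Pi.smul_apply, smul_eq_mul]; ring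
      simp only [this]
      rw [← Finset.mul_sum, ht.2.2, mul_zero]

/-- The coordinates of `A ⊗ 1`. -/
def tensorOne : (I × I → ℂ) →ₗ[ℂ] Coord I where
  toFun A x := if x.2.2.1 = x.2.2.2 then A (x.1, x.2.1) else 0
  map_add' A B := by ext x; by_cases h : x.2.2.1 = x.2.2.2 <;> simp [h]
  map_smul' c A := by ext x; by_cases h : x.2.2.1 = x.2.2.2 <;> simp [h]

theorem tensorOne_apply (A : I × I → ℂ) (i j k l : I) :
    tensorOne A (i, j, k, l) = if k = l then A (i, j) else 0 := rfl

/-- The complement of `tracelessSym`: it is spanned by the tensors that are antisymmetric in the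
row indices or in the column indices, and by the tensors `A ⊗ 1`. -/
def antisymTrace : Submodule ℂ (Coord I) :=
  Submodule.span ℂ
    ((Set.range fun x : I × I × I × I => unit x.1 x.2.1 x.2.2.1 x.2.2.2 -
        rowSign p x.1 x.2.1 x.2.2.1 • unit x.2.2.1 x.2.1 x.1 x.2.2.2) ∪
     (Set.range fun x : I × I × I × I => unit x.1 x.2.1 x.2.2.1 x.2.2.2 -
        colSign p x.2.1 x.2.2.1 x.2.2.2 • unit x.1 x.2.2.2 x.2.2.1 x.2.1) ∪
     Set.range (tensorOne (I := I)))

theorem row_mem_antisymTrace (i j k l : I) :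
    unit i j k l - rowSign p i j k • unit k j i l ∈ antisymTrace p :=
  Submodule.subset_span (Or.inl (Or.inl ⟨(i, j, k, l), rfl⟩))

theorem col_mem_antisymTrace (i j k l : I) :
    unit i j k l - colSign p j k l • unit i l k j ∈ antisymTrace p :=
  Submodule.subset_span (Or.inl (Or.inr ⟨(i, j, k, l), rfl⟩))

theorem tensorOne_mem_antisymTrace (A : I × I → ℂ) : tensorOne A ∈ antisymTrace p :=
  Submodule.subset_span (Or.inr ⟨A, rfl⟩)

/-! ### The contravariant form -/

/-- The symmetric form on `𝔤𝔩 ⊗ 𝔤𝔩` for which `E a b` and `E b a` act as adjoint operators. The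
weights `(-1)^{|j|}`, `(-1)^{|l|}` make this true for odd matrix units, without any sign that
depends on the parity of the arguments. -/
def form : LinearMap.BilinForm ℂ (Coord I) :=
  LinearMap.mk₂ ℂ (fun s t => ∑ i, ∑ j, ∑ k, ∑ l,
      sg (p j) (p j) * sg (p l) (p l) * (s (i, j, k, l) * t (i, j, k, l)))
    (fun s s' t => by simp only [Pi.add_apply, add_mul, mul_add, Finset.sum_add_distrib])
    (fun c s t => by
      simp only [Pi.smul_apply, smul_eq_mul, Finset.mul_sum]
      refine Finset.sum_congr rfl fun i _ => Finset.sum_congr rfl fun j _ =>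
        Finset.sum_congr rfl fun k _ => Finset.sum_congr rfl fun l _ => by ring)
    (fun s t t' => by simp only [Pi.add_apply, mul_add, Finset.sum_add_distrib])
    (fun c s t => by
      simp only [Pi.smul_apply, smul_eq_mul, Finset.mul_sum]
      refine Finset.sum_congr rfl fun i _ => Finset.sum_congr rfl fun j _ =>
        Finset.sum_congr rfl fun k _ => Finset.sum_congr rfl fun l _ => by ring)

theorem form_apply (s t : Coord I) : form p s t = ∑ i, ∑ j, ∑ k, ∑ l,
    sg (p j) (p j) * sg (p l) (p l) * (s (i, j, k, l) * t (i, j, k, l)) := rfl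

theorem form_comm (s t : Coord I) : form p s t = form p t s := by
  simp only [form_apply, mul_comm (s _) (t _)]

theorem form_unit (i j k l : I) (t : Coord I) :
    form p (unit i j k l) t = sg (p j) (p j) * sg (p l) (p l) * t (i, j, k, l) := by
  simp [form_apply, unit_apply, ite_and]

theorem ext_unit {M : Type*} [AddCommGroup M] [Module ℂ M] {f g : Coord I →ₗ[ℂ] M}
    (h : ∀ i j k l, f (unit i j k l) = g (unit i j k l)) : f = g := by
  refine LinearMap.pi_ext' fun x => LinearMap.ext_ring ?_
  obtain ⟨i, j, k, l⟩ := x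
  exact h i j k l

theorem form_act (a b : I) (s t : Coord I) :
    form p (act p a b s) t = form p s (act p b a t) := by
  suffices h : LinearMap.flip (form p) t ∘ₗ act p a b = LinearMap.flip (form p) (act p b a t) from
    LinearMap.congr_fun h s
  refine ext_unit fun i j k l => ?_
  simp only [LinearMap.comp_apply, LinearMap.flip_apply, act_unit, form_unit, act_apply, map_add,
    map_sub, map_smul, apply_ite (LinearMap.flip (form p) t), smul_eq_mul, map_zero]
  have h1 : (if b = i then sg (p j) (p j) * sg (p l) (p l) * t (a, j, k, l) else 0)
      = sg (p j) (p j) * sg (p l) (p l) * (if i = b then t (a, j, k, l) else 0) := by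
    simp only [eq_comm (a := b)]; split_ifs <;> simp
  have h2 : (if a = j then sg (p a + p b) (p i + p j) *
        (sg (p b) (p b) * sg (p l) (p l) * t (i, b, k, l)) else 0)
      = sg (p j) (p j) * sg (p l) (p l) *
        (if j = a then sg (p b + p a) (p i + p b) * t (i, b, k, l) else 0) := by
    by_cases h : j = a
    · subst h
      simp only [if_true]
      generalize p i = x; generalize p j = y; generalize p b = z; generalize p l = w
      generalize t _ = c
      fin_cases x <;> fin_cases y <;> fin_cases z <;> fin_cases w <;> simp [sg]
    · simp [h, Ne.symm h]
  have h3 : (if b = k then sg (p j) (p j) * sg (p l) (p l) * t (i, j, a, l) else 0)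
      = sg (p j) (p j) * sg (p l) (p l) * (if k = b then t (i, j, a, l) else 0) := by
    simp only [eq_comm (a := b)]; split_ifs <;> simp
  have h4 : (if a = l then sg (p a + p b) (p k + p l) *
        (sg (p j) (p j) * sg (p b) (p b) * t (i, j, k, b)) else 0)
      = sg (p j) (p j) * sg (p l) (p l) *
        (if l = a then sg (p b + p a) (p k + p b) * t (i, j, k, b) else 0) := by
    by_cases h : l = a
    · subst h
      simp only [if_true]
      generalize p k = x; generalize p j = y; generalize p b = z; generalize p l = w
      generalize t _ = c
      fin_cases x <;> fin_cases y <;> fin_cases z <;> fin_cases w <;> simp [sg]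
    · simp [h, Ne.symm h]
  rw [h1, h2, h3, h4, add_comm (p b) (p a)]
  ring

theorem form_nondegenerate {t : Coord I} (h : ∀ s, form p s t = 0) : t = 0 := by
  ext ⟨i, j, k, l⟩
  have := h (unit i j k l)
  rw [form_unit] at this
  simpa using this

/-- The orthogonal complement of a stable subspace is stable. -/
theorem Stable.orthogonal {N : Submodule ℂ (Coord I)} (hN : Stable p N) :
    Stable p ((form p).orthogonal N) := by
  intro a b s hs t ht
  change form p t (act p a b s) = 0
  rw [← form_act]
  exact hs _ (hN _ _ _ ht)

/-! ### The decomposition `𝔤𝔩 ⊗ 𝔤𝔩 = tracelessSym ⊕ antisymTrace` -/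

theorem smul_row_mem_antisymTrace {i j k : I} (l : I) {c e : ℂ} (h : e = c * rowSign p i j k) :
    c • unit i j k l - e • unit k j i l ∈ antisymTrace p := by
  have := (antisymTrace p).smul_mem c (row_mem_antisymTrace p i j k l)
  rwa [smul_sub, smul_smul, ← h] at this

theorem smul_col_mem_antisymTrace (i : I) {j k l : I} {c e : ℂ} (h : e = c * colSign p j k l) :
    c • unit i j k l - e • unit i l k j ∈ antisymTrace p := by
  have := (antisymTrace p).smul_mem c (col_mem_antisymTrace p i j k l)
  rwa [smul_sub, smul_smul, ← h] at this

theorem ite_smul_unit_sub_mem {P : Prop} [Decidable P] {N : Submodule ℂ (Coord I)} {u v : Coord I}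
    {c e : ℂ} (h : P → c • u - e • v ∈ N) :
    (if P then c • u else 0) - (if P then e • v else 0) ∈ N := by
  by_cases hP : P
  · simpa [hP] using h hP
  · simp [hP]

theorem smul_act_unit (a b i j k l : I) (c : ℂ) :
    c • act p a b (unit i j k l) =
    (if b = i then c • unit a j k l else 0)
    - (if a = j then (c * sg (p a + p b) (p i + p j)) • unit i b k l else 0)
    + (if b = k then (c * sg (p a + p b) (p i + p j)) • unit i j a l else 0)
    - (if a = l then (c * sg (p a + p b) (p i + p j) * sg (p a + p b) (p k + p l)) •
        unit i j k b else 0) := by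
  rw [act_unit]
  have e' : ∀ (P : Prop) [Decidable P] (x : ℂ) (u : Coord I),
      (if P then x • u else 0) = x • (if P then u else 0) := by
    intro P _ x u
    by_cases h : P <;> simp [h]
  simp only [e', mul_smul]
  module

theorem act_tensorOne (a b : I) (A : I × I → ℂ) : ∃ B, act p a b (tensorOne A) = tensorOne B := by
  refine ⟨fun x => (if x.1 = a then A (b, x.2) else 0)
    - (if x.2 = b then sg (p a + p b) (p x.1 + p a) * A (x.1, a) else 0), ?_⟩
  ext ⟨i, j, k, l⟩
  simp only [act_apply, tensorOne_apply]
  have h : (if k = a then (if b = l then A (i, j) else 0) else 0)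
      - (if l = b then sg (p a + p b) (p k + p a) * (if k = a then A (i, j) else 0) else 0) = 0 := by
    by_cases hk : k = a
    · subst hk
      by_cases hl : b = l
      · subst hl
        generalize p k = x
        fin_cases x <;> simp
      · simp [hl, Ne.symm hl]
    · simp [hk]
  rw [h]
  by_cases hkl : k = l <;> simp [hkl]

theorem antisymTrace_stable : Stable p (antisymTrace p) := by
  intro a b t ht
  induction ht using Submodule.span_induction with
  | zero => simp
  | add x y _ _ hx hy => rw [map_add]; exact add_mem hx hy
  | smul c x _ hx => rw [map_smul]; exact Submodule.smul_mem _ _ hx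
  | mem x hx =>
    rcases hx with (⟨⟨i, j, k, l⟩, rfl⟩ | ⟨⟨i, j, k, l⟩, rfl⟩) | ⟨A, rfl⟩
    · have A1 := ite_smul_unit_sub_mem (P := b = i) (N := antisymTrace p) (c := 1)
        (e := rowSign p i j k * sg (p a + p b) (p k + p j)) (u := unit a j k l)
        (v := unit k j a l) fun h => smul_row_mem_antisymTrace p l (by
          subst h
          simp only [rowSign, sg_add_left, sg_add_right]
          generalize p a = x; generalize p b = y; generalize p j = z; generalize p k = w
          fin_cases x <;> fin_cases y <;> fin_cases z <;> fin_cases w <;> simp [sg])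
      have A2 := ite_smul_unit_sub_mem (P := a = j) (N := antisymTrace p)
        (c := 1 * sg (p a + p b) (p i + p j))
        (e := rowSign p i j k * sg (p a + p b) (p k + p j)) (u := unit i b k l)
        (v := unit k b i l) fun h => smul_row_mem_antisymTrace p l (by
          subst h
          simp only [rowSign, sg_add_left, sg_add_right]
          generalize p a = x; generalize p b = y; generalize p i = z; generalize p k = w
          fin_cases x <;> fin_cases y <;> fin_cases z <;> fin_cases w <;> simp [sg])
      have A3 := ite_smul_unit_sub_mem (P := b = k) (N := antisymTrace p)
        (c := 1 * sg (p a + p b) (p i + p j))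
        (e := rowSign p i j k) (u := unit i j a l)
        (v := unit a j i l) fun h => smul_row_mem_antisymTrace p l (by
          subst h
          simp only [rowSign, sg_add_left, sg_add_right]
          generalize p a = x; generalize p b = y; generalize p i = z; generalize p j = w
          fin_cases x <;> fin_cases y <;> fin_cases z <;> fin_cases w <;> simp [sg])
      have A4 := ite_smul_unit_sub_mem (P := a = l) (N := antisymTrace p)
        (c := 1 * sg (p a + p b) (p i + p j) * sg (p a + p b) (p k + p l))
        (e := rowSign p i j k * sg (p a + p b) (p k + p j) * sg (p a + p b) (p i + p l))
        (u := unit i j k b)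
        (v := unit k j i b) fun h => smul_row_mem_antisymTrace p b (by
          simp only [sg_add_right]; ring)
      have := sub_mem (add_mem (sub_mem A1 A2) A3) A4
      convert this using 1
      have e1 := smul_act_unit p a b i j k l 1
      have e2 := smul_act_unit p a b k j i l (rowSign p i j k)
      rw [one_smul] at e1
      simp only [map_sub, map_smul]
      rw [e1, e2]
      abel
    · have A1 := ite_smul_unit_sub_mem (P := b = i) (N := antisymTrace p) (c := 1)
        (e := colSign p j k l) (u := unit a j k l)
        (v := unit a l k j) fun h => smul_col_mem_antisymTrace p a (by simp)
      have A2 := ite_smul_unit_sub_mem (P := a = j) (N := antisymTrace p)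
        (c := 1 * sg (p a + p b) (p i + p j))
        (e := colSign p j k l * sg (p a + p b) (p i + p l) * sg (p a + p b) (p k + p j))
        (u := unit i b k l)
        (v := unit i l k b) fun h => smul_col_mem_antisymTrace p i (by
          subst h
          simp only [colSign, sg_add_left, sg_add_right]
          generalize p a = x; generalize p b = y; generalize p i = z; generalize p k = w
          generalize p l = v
          fin_cases x <;> fin_cases y <;> fin_cases z <;> fin_cases w <;> fin_cases v <;>
            simp [sg])
      have A3 := ite_smul_unit_sub_mem (P := b = k) (N := antisymTrace p)
        (c := 1 * sg (p a + p b) (p i + p j))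
        (e := colSign p j k l * sg (p a + p b) (p i + p l)) (u := unit i j a l)
        (v := unit i l a j) fun h => smul_col_mem_antisymTrace p i (by
          subst h
          simp only [colSign, sg_add_left, sg_add_right]
          generalize p a = x; generalize p b = y; generalize p i = z; generalize p j = w
          generalize p l = v
          fin_cases x <;> fin_cases y <;> fin_cases z <;> fin_cases w <;> fin_cases v <;>
            simp [sg])
      have A4 := ite_smul_unit_sub_mem (P := a = l) (N := antisymTrace p)
        (c := 1 * sg (p a + p b) (p i + p j) * sg (p a + p b) (p k + p l))
        (e := colSign p j k l * sg (p a + p b) (p i + p l))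
        (u := unit i j k b)
        (v := unit i b k j) fun h => smul_col_mem_antisymTrace p i (by
          subst h
          simp only [colSign, sg_add_left, sg_add_right]
          generalize p a = x; generalize p b = y; generalize p i = z; generalize p j = w
          generalize p k = v
          fin_cases x <;> fin_cases y <;> fin_cases z <;> fin_cases w <;> fin_cases v <;>
            simp [sg])
      have := sub_mem (add_mem (sub_mem A1 A2) A3) A4
      convert this using 1
      have e1 := smul_act_unit p a b i j k l 1
      have e2 := smul_act_unit p a b i l k j (colSign p j k l)
      rw [one_smul] at e1
      simp only [map_sub, map_smul]
      rw [e1, e2]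
      abel
    · obtain ⟨B, hB⟩ := act_tensorOne p a b A
      rw [hB]
      exact tensorOne_mem_antisymTrace p B

theorem form_tensorOne (A : I × I → ℂ) (t : Coord I) :
    form p (tensorOne A) t =
      ∑ i, ∑ j, A (i, j) * sg (p j) (p j) * ∑ k, sg (p k) (p k) * t (i, j, k, k) := by
  simp only [form_apply, tensorOne_apply, ite_mul, zero_mul, mul_ite, mul_zero,
    Finset.sum_ite_eq, Finset.mem_univ, if_true, Finset.mul_sum]
  refine Finset.sum_congr rfl fun i _ => Finset.sum_congr rfl fun j _ =>
    Finset.sum_congr rfl fun k _ => by ring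

theorem orthogonal_antisymTrace : (form p).orthogonal (antisymTrace p) = tracelessSym p := by
  ext t
  rw [LinearMap.BilinForm.mem_orthogonal_iff]
  constructor
  · intro h
    refine ⟨fun i j k l => ?_, fun i j k l => ?_, fun i j => ?_⟩
    · have := h _ (row_mem_antisymTrace p i j k l)
      change form p _ t = 0 at this
      rw [map_sub, map_smul, LinearMap.sub_apply, LinearMap.smul_apply, form_unit, form_unit,
        smul_eq_mul] at this
      have h0 : sg (p j) (p j) * sg (p l) (p l) ≠ 0 := by simp
      apply mul_left_cancel₀ h0
      linear_combination this
    · have := h _ (col_mem_antisymTrace p i j k l)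
      change form p _ t = 0 at this
      rw [map_sub, map_smul, LinearMap.sub_apply, LinearMap.smul_apply, form_unit, form_unit,
        smul_eq_mul] at this
      have h0 : sg (p j) (p j) * sg (p l) (p l) ≠ 0 := by simp
      apply mul_left_cancel₀ h0
      linear_combination this
    · have := h _ (tensorOne_mem_antisymTrace p (Pi.single (i, j) 1))
      change form p _ t = 0 at this
      rw [form_tensorOne] at this
      simpa [Pi.single_apply, ite_and] using this
  · intro h s hs
    change form p s t = 0
    induction hs using Submodule.span_induction with
    | zero => simp
    | add x y _ _ hx hy => rw [map_add, LinearMap.add_apply, hx, hy, add_zero]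
    | smul c x _ hx => rw [map_smul, LinearMap.smul_apply, hx, smul_zero]
    | mem x hx =>
      rcases hx with (⟨⟨i, j, k, l⟩, rfl⟩ | ⟨⟨i, j, k, l⟩, rfl⟩) | ⟨A, rfl⟩
      · simp only [map_sub, map_smul, LinearMap.sub_apply, LinearMap.smul_apply, form_unit,
          smul_eq_mul]
        rw [h.1 i j k l]; ring
      · simp only [map_sub, map_smul, LinearMap.sub_apply, LinearMap.smul_apply, form_unit,
          smul_eq_mul]
        rw [h.2.1 i j k l]; ring
      · rw [form_tensorOne]
        simp [h.2.2]

theorem tracelessSym_stable : Stable p (tracelessSym p) := by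
  rw [← orthogonal_antisymTrace]
  exact (antisymTrace_stable p).orthogonal p

/-- The exchange of the row indices, with its Koszul sign. -/
def rowSwap : Coord I →ₗ[ℂ] Coord I where
  toFun t x := rowSign p x.1 x.2.1 x.2.2.1 * t (x.2.2.1, x.2.1, x.1, x.2.2.2)
  map_add' s t := by ext x; simp [mul_add]
  map_smul' c t := by ext x; simp only [Pi.smul_apply, smul_eq_mul, RingHom.id_apply]; ring

/-- The exchange of the column indices, with its Koszul sign. -/
def colSwap : Coord I →ₗ[ℂ] Coord I where
  toFun t x := colSign p x.2.1 x.2.2.1 x.2.2.2 * t (x.1, x.2.2.2, x.2.2.1, x.2.1)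
  map_add' s t := by ext x; simp [mul_add]
  map_smul' c t := by ext x; simp only [Pi.smul_apply, smul_eq_mul, RingHom.id_apply]; ring

theorem rowSwap_apply (t : Coord I) (i j k l : I) :
    rowSwap p t (i, j, k, l) = rowSign p i j k * t (k, j, i, l) := rfl

theorem colSwap_apply (t : Coord I) (i j k l : I) :
    colSwap p t (i, j, k, l) = colSign p j k l * t (i, l, k, j) := rfl

theorem rowSign_mul_rowSign (i j k : I) : rowSign p i j k * rowSign p k j i = 1 := by
  simp only [rowSign]
  generalize p i = x; generalize p j = y; generalize p k = z
  fin_cases x <;> fin_cases y <;> fin_cases z <;> simp [sg]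

theorem colSign_mul_colSign (j k l : I) : colSign p j k l * colSign p l k j = 1 := by
  simp only [colSign]
  generalize p l = x; generalize p j = y; generalize p k = z
  fin_cases x <;> fin_cases y <;> fin_cases z <;> simp [sg]

theorem rowSwap_rowSwap (t : Coord I) : rowSwap p (rowSwap p t) = t := by
  ext ⟨i, j, k, l⟩
  rw [rowSwap_apply, rowSwap_apply, ← mul_assoc, rowSign_mul_rowSign, one_mul]

theorem colSwap_colSwap (t : Coord I) : colSwap p (colSwap p t) = t := by
  ext ⟨i, j, k, l⟩
  rw [colSwap_apply, colSwap_apply, ← mul_assoc, colSign_mul_colSign, one_mul]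

theorem rowSwap_colSwap (t : Coord I) : rowSwap p (colSwap p t) = colSwap p (rowSwap p t) := by
  ext ⟨i, j, k, l⟩
  rw [rowSwap_apply, colSwap_apply, colSwap_apply, rowSwap_apply, ← mul_assoc, ← mul_assoc]
  congr 1
  simp only [rowSign, colSign]
  generalize p i = x; generalize p j = y; generalize p k = z; generalize p l = w
  fin_cases x <;> fin_cases y <;> fin_cases z <;> fin_cases w <;> simp [sg]

/-- Four times the symmetrization in the row indices and in the column indices. -/
def sym : Coord I →ₗ[ℂ] Coord I :=
  (LinearMap.id + rowSwap p) ∘ₗ (LinearMap.id + colSwap p)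

theorem sym_apply (t : Coord I) :
    sym p t = t + colSwap p t + rowSwap p t + rowSwap p (colSwap p t) := by
  simp only [sym, LinearMap.comp_apply, LinearMap.add_apply, LinearMap.id_apply, map_add]
  abel

theorem rowSwap_unit (i j k l : I) :
    rowSwap p (unit i j k l) = rowSign p i j k • unit k j i l := by
  ext ⟨i', j', k', l'⟩
  rw [rowSwap_apply, Pi.smul_apply, unit_apply, unit_apply, smul_eq_mul]
  by_cases h : i = k' ∧ j = j' ∧ k = i' ∧ l = l'
  · obtain ⟨rfl, rfl, rfl, rfl⟩ := h
    simp only [and_self, if_true, mul_one, rowSign]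
    generalize p i = x; generalize p j = y; generalize p k = z
    fin_cases x <;> fin_cases y <;> fin_cases z <;> simp [sg]
  · rw [if_neg h, if_neg (by tauto), mul_zero, mul_zero]

theorem colSwap_unit (i j k l : I) :
    colSwap p (unit i j k l) = colSign p j k l • unit i l k j := by
  ext ⟨i', j', k', l'⟩
  rw [colSwap_apply, Pi.smul_apply, unit_apply, unit_apply, smul_eq_mul]
  by_cases h : i = i' ∧ j = l' ∧ k = k' ∧ l = j'
  · obtain ⟨rfl, rfl, rfl, rfl⟩ := h
    simp only [and_self, if_true, mul_one, colSign]
    generalize p l = x; generalize p j = y; generalize p k = z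
    fin_cases x <;> fin_cases y <;> fin_cases z <;> simp [sg]
  · rw [if_neg h, if_neg (by tauto), mul_zero, mul_zero]

/-- The symmetrization kills the antisymmetrized generators of `antisymTrace`. -/
theorem exists_sym_eq_sym_tensorOne {t : Coord I} (ht : t ∈ antisymTrace p) :
    ∃ A, sym p t = sym p (tensorOne A) := by
  induction ht using Submodule.span_induction with
  | zero => exact ⟨0, by simp⟩
  | add x y _ _ hx hy =>
    obtain ⟨A, hA⟩ := hx
    obtain ⟨B, hB⟩ := hy
    exact ⟨A + B, by simp only [map_add, hA, hB]⟩
  | smul c x _ hx =>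
    obtain ⟨A, hA⟩ := hx
    exact ⟨c • A, by simp only [map_smul, hA]⟩
  | mem x hx =>
    rcases hx with (⟨⟨i, j, k, l⟩, rfl⟩ | ⟨⟨i, j, k, l⟩, rfl⟩) | ⟨A, rfl⟩
    · refine ⟨0, ?_⟩
      simp only [← rowSwap_unit, map_zero, sym_apply, map_sub]
      simp only [rowSwap_colSwap, rowSwap_rowSwap]
      abel
    · refine ⟨0, ?_⟩
      simp only [← colSwap_unit, map_zero, sym_apply, map_sub]
      simp only [colSwap_colSwap]
      abel
    · exact ⟨A, rfl⟩

theorem sym_of_mem_tracelessSym {t : Coord I} (ht : t ∈ tracelessSym p) :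
    sym p t = (4 : ℂ) • t := by
  have h1 : rowSwap p t = t := by ext ⟨i, j, k, l⟩; exact (ht.1 i j k l).symm
  have h2 : colSwap p t = t := by ext ⟨i, j, k, l⟩; exact (ht.2.1 i j k l).symm
  rw [sym_apply, h2, h1]
  module

/-- The superdimension of the natural module. -/
def sdim : ℂ := ∑ i, sg (p i) (p i)

/-- The partial supertrace of the symmetrization of `A ⊗ 1`. -/
theorem trace_sym_tensorOne (A : I × I → ℂ) (i j : I) :
    ∑ k, sg (p k) (p k) * sym p (tensorOne A) (i, j, k, k) =
      (sdim p + 2) * A (i, j) + if i = j then ∑ k, sg (p k) (p k) * A (k, k) else 0 := by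
  have h : ∀ k, sg (p k) (p k) * sym p (tensorOne A) (i, j, k, k) =
      sg (p k) (p k) * A (i, j) + (if j = k then A (i, j) else 0) + (if i = k then A (i, j) else 0)
      + (if i = j then sg (p k) (p k) * A (k, k) else 0) := by
    intro k
    simp only [sym_apply, Pi.add_apply, rowSwap_apply, colSwap_apply, tensorOne_apply, if_true]
    have h1 : sg (p k) (p k) * (colSign p j k k * if k = j then A (i, k) else 0) =
        if j = k then A (i, j) else 0 := by
      by_cases hk : j = k
      · subst hk
        simp only [if_true, colSign, ← mul_assoc, sg_mul_self, one_mul]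
      · simp [hk, Ne.symm hk]
    have h2 : sg (p k) (p k) * (rowSign p i j k * if i = k then A (k, j) else 0) =
        if i = k then A (i, j) else 0 := by
      by_cases hk : i = k
      · subst hk
        simp only [if_true, rowSign]
        generalize p i = x; generalize p j = y
        fin_cases x <;> fin_cases y <;> simp [sg]
      · simp [hk]
    have h3 : sg (p k) (p k) * (rowSign p i j k * (colSign p j i k *
        if i = j then A (k, k) else 0)) = if i = j then sg (p k) (p k) * A (k, k) else 0 := by
      by_cases hk : i = j
      · subst hk
        simp only [if_true, rowSign, colSign]
        generalize p i = x; generalize p k = y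
        fin_cases x <;> fin_cases y <;> simp [sg]
      · simp [hk]
    rw [mul_add, mul_add, mul_add, h1, h2, h3]
  rw [Finset.sum_congr rfl fun k _ => h k]
  simp only [Finset.sum_add_distrib, Finset.sum_ite_eq, Finset.mem_univ, if_true,
    ← Finset.sum_mul]
  by_cases hij : i = j
  · simp only [hij, if_true, sdim]; ring
  · simp only [hij, if_false, sdim, Finset.sum_const_zero, add_zero]; ring

/-- A tensor in both subspaces is, up to the factor `4`, the symmetrization of some `A ⊗ 1`; its
partial supertrace vanishes only if `A = 0`. -/
theorem tracelessSym_disjoint (h1 : sdim p + 1 ≠ 0) (h2 : sdim p + 2 ≠ 0) :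
    Disjoint (antisymTrace p) (tracelessSym p) := by
  rw [Submodule.disjoint_def]
  intro t hK hW
  obtain ⟨A, hA⟩ := exists_sym_eq_sym_tensorOne p hK
  rw [sym_of_mem_tracelessSym p hW] at hA
  have key : ∀ i j, (sdim p + 2) * A (i, j) +
      (if i = j then ∑ k, sg (p k) (p k) * A (k, k) else 0) = 0 := by
    intro i j
    rw [← trace_sym_tensorOne, ← hA]
    have := hW.2.2 i j
    calc _ = 4 * ∑ k, sg (p k) (p k) * t (i, j, k, k) := by
          rw [Finset.mul_sum]
          exact Finset.sum_congr rfl fun k _ => by rw [Pi.smul_apply, smul_eq_mul]; ring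
      _ = 0 := by rw [this, mul_zero]
  have hs : ∑ k, sg (p k) (p k) * A (k, k) = 0 := by
    set a := ∑ k, sg (p k) (p k) * A (k, k) with ha
    have : ∑ k, sg (p k) (p k) * ((sdim p + 2) * A (k, k) + a) = 0 :=
      Finset.sum_eq_zero fun k _ => by
        have := key k k
        rw [if_pos rfl] at this
        rw [this, mul_zero]
    have e : ∑ k, sg (p k) (p k) * ((sdim p + 2) * A (k, k) + a) =
        (sdim p + 2) * a + sdim p * a := by
      have e1 : ∀ k, sg (p k) (p k) * ((sdim p + 2) * A (k, k) + a) =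
          (sdim p + 2) * (sg (p k) (p k) * A (k, k)) + sg (p k) (p k) * a := fun k => by ring
      rw [Finset.sum_congr rfl fun k _ => e1 k, Finset.sum_add_distrib, ← Finset.mul_sum,
        ← Finset.sum_mul, ← ha, ← sdim]
    rw [e] at this
    have h3 : (2 * (sdim p + 1)) * a = 0 := by linear_combination this
    simpa [h1] using h3
  have hA0 : A = 0 := by
    ext ⟨i, j⟩
    have := key i j
    rw [hs] at this
    simpa [h2] using this
  rw [hA0, map_zero, map_zero] at hA
  simpa using hA

theorem isCompl_tracelessSym (h1 : sdim p + 1 ≠ 0) (h2 : sdim p + 2 ≠ 0) :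
    IsCompl (tracelessSym p) (antisymTrace p) := by
  have hr : (form p).IsRefl := fun s t h => by rwa [form_comm]
  rw [← orthogonal_antisymTrace]
  refine ((LinearMap.BilinForm.isCompl_orthogonal_iff_disjoint hr).2 ?_).symm
  rw [orthogonal_antisymTrace]
  exact tracelessSym_disjoint p h1 h2

end Coordinates

/-! ### Generation modulo antisymmetric tensors and traces -/

section Generation

variable {I : Type*} [Fintype I] [DecidableEq I] {p : I → Fin 2} {M : Submodule ℂ (Coord I)}

theorem unit_row_mem_iff (hK : antisymTrace p ≤ M) (i j k l : I) :
    unit i j k l ∈ M ↔ unit k j i l ∈ M := by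
  have key : ∀ i k, unit k j i l ∈ M → unit i j k l ∈ M := fun i k h => by
    have := add_mem (hK (row_mem_antisymTrace p i j k l)) (M.smul_mem (rowSign p i j k) h)
    rwa [sub_add_cancel] at this
  exact ⟨key _ _, key _ _⟩

theorem unit_col_mem_iff (hK : antisymTrace p ≤ M) (i j k l : I) :
    unit i j k l ∈ M ↔ unit i l k j ∈ M := by
  have key : ∀ j l, unit i l k j ∈ M → unit i j k l ∈ M := fun j l h => by
    have := add_mem (hK (col_mem_antisymTrace p i j k l)) (M.smul_mem (colSign p j k l) h)
    rwa [sub_add_cancel] at this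
  exact ⟨key _ _, key _ _⟩

/-- A row index can be changed to any index that is not a column index; an odd row index that
occurs twice is excluded, since `S²V` contains no square of an odd vector. -/
theorem unit_mem_of_row (hM : Stable p M) (hK : antisymTrace p ≤ M) {i j k l : I} (c : I)
    (h : unit i j k l ∈ M) (hj : c ≠ j) (hl : c ≠ l) (hi : i ≠ k ∨ p i = 0) :
    unit c j k l ∈ M := by
  have h1 := hM c i _ h
  rw [act_unit, if_pos rfl, if_neg hj, if_neg hl, sub_zero, sub_zero] at h1
  by_cases hik : i = k
  · subst hik
    have hi : p i = 0 := by simpa using hi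
    rw [if_pos rfl] at h1
    have h2 := hK (row_mem_antisymTrace p c j i l)
    have h3 := add_mem h1 h2
    have e : rowSign p c j i = sg (p c + p i) (p i + p j) := by
      rw [rowSign, hi]
      generalize p c = x; generalize p j = y
      fin_cases x <;> fin_cases y <;> simp [sg]
    rw [e] at h3
    have h4 := M.smul_mem (1 / 2 : ℂ) h3
    convert h4 using 1
    module
  · rwa [if_neg hik, smul_zero, add_zero] at h1

/-- The analogue of `unit_mem_of_row` for a column index. -/
theorem unit_mem_of_col (hM : Stable p M) (hK : antisymTrace p ≤ M) {i j k l : I} (c : I)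
    (h : unit i j k l ∈ M) (hi : c ≠ i) (hk : c ≠ k) (hj : j ≠ l ∨ p j = 0) :
    unit i c k l ∈ M := by
  have h1 := hM j c _ h
  rw [act_unit, if_neg hi, if_pos rfl, if_neg hk, zero_sub, zero_sub] at h1
  have hs : ∀ x : Coord I, sg (p j + p c) (p i + p j) • x ∈ M → x ∈ M := fun x hx =>
    (M.smul_mem_iff (sg_ne_zero _ _)).1 hx
  by_cases hjl : j = l
  · subst hjl
    have hj : p j = 0 := by simpa using hj
    rw [if_pos rfl, smul_neg, ← neg_add, neg_mem_iff, ← smul_add] at h1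
    have h2 := hK (col_mem_antisymTrace p i c k j)
    have h3 := add_mem (hs _ h1) h2
    have e : colSign p c k j = sg (p j + p c) (p k + p j) := by
      rw [colSign, hj]
      generalize p c = x; generalize p k = y
      fin_cases x <;> fin_cases y <;> simp [sg]
    rw [e] at h3
    have h4 := M.smul_mem (1 / 2 : ℂ) h3
    convert h4 using 1
    module
  · rw [if_neg hjl, neg_zero, smul_zero, add_zero, neg_mem_iff] at h1
    exact hs _ h1

/-- Starting from one tensor `E z a ⊗ E z b`, where `z` is even and `z, a, b` are distinct, the
action reaches all `E i j ⊗ E k l` whose row indices are different from the column indices. -/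
theorem unit_mem_of_disjoint (hM : Stable p M) (hK : antisymTrace p ≤ M) {z a b : I}
    (hz : p z = 0) (hza : z ≠ a) (hzb : z ≠ b) (hab : a ≠ b) (h : unit z a z b ∈ M)
    (hodd : ∀ i, p i ≠ 0 → 4 < Fintype.card I)
    {i j k l : I} (hij : i ≠ j) (hil : i ≠ l) (hkj : k ≠ j) (hkl : k ≠ l) :
    unit i j k l ∈ M := by
  have row2 : ∀ {i j k l : I} (c : I), unit i j k l ∈ M → c ≠ j → c ≠ l → (i ≠ k ∨ p k = 0) →
      unit i j c l ∈ M := fun c h hj hl hik =>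
    (unit_row_mem_iff hK _ _ _ _).1 (unit_mem_of_row hM hK c ((unit_row_mem_iff hK _ _ _ _).1 h)
      hj hl (hik.imp_left Ne.symm))
  have col2 : ∀ {i j k l : I} (c : I), unit i j k l ∈ M → c ≠ i → c ≠ k → (j ≠ l ∨ p l = 0) →
      unit i j k c ∈ M := fun c h hi hk hjl =>
    (unit_col_mem_iff hK _ _ _ _).1 (unit_mem_of_col hM hK c ((unit_col_mem_iff hK _ _ _ _).1 h)
      hi hk (hjl.imp_left Ne.symm))
  have exists_notMem : ∀ s : Finset I, s.card < Fintype.card I → ∃ c, c ∉ s := fun s hs =>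
    ((Finset.card_lt_iff_ne_univ s).1 hs |> fun h => by
      by_contra! hc
      exact h (Finset.eq_univ_iff_forall.2 hc))
  -- both row indices equal to `z`
  have h1 : ∀ j l, z ≠ j → z ≠ l → unit z j z l ∈ M := by
    have h0 : ∀ j, z ≠ j → unit z j z b ∈ M := fun j hj =>
      unit_mem_of_col hM hK j h hj.symm hj.symm (Or.inl hab)
    intro j l hj hl
    by_cases hjb : j = b
    · subst hjb
      exact (unit_col_mem_iff hK _ _ _ _).1 (h0 l hl)
    · exact col2 l (h0 j hj) hl.symm hl.symm (Or.inl hjb)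
  -- no column index equal to `z`
  have h2 : ∀ i j k l, z ≠ j → z ≠ l → i ≠ j → i ≠ l → k ≠ j → k ≠ l → unit i j k l ∈ M :=
    fun i j k l hj hl hij hil hkj hkl =>
      row2 k (unit_mem_of_row hM hK i (h1 j l hj hl) hij hil (Or.inr hz)) hkj hkl (Or.inr hz)
  -- one column index equal to `z`: it is reached from the column `c`; for odd `l`, `c = l` is
  -- impossible, as `S²V*` contains no square of an odd vector, and a fifth index is needed
  have h3 : ∀ i k l, z ≠ l → i ≠ z → i ≠ l → k ≠ z → k ≠ l → unit i z k l ∈ M := by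
    intro i k l hl hi hil hk hkl
    obtain ⟨c, hci, hck, hcz, hcl⟩ : ∃ c, c ≠ i ∧ c ≠ k ∧ c ≠ z ∧ (c ≠ l ∨ p c = 0) := by
      by_cases hpl : p l = 0
      · exact ⟨l, hil.symm, hkl.symm, hl.symm, Or.inr hpl⟩
      · obtain ⟨c, hc⟩ := exists_notMem {i, k, z, l} (Finset.card_le_four.trans_lt (hodd l hpl))
        simp only [Finset.mem_insert, Finset.mem_singleton, not_or] at hc
        exact ⟨c, hc.1, hc.2.1, hc.2.2.1, Or.inl hc.2.2.2⟩
    exact unit_mem_of_col hM hK z (h2 i c k l hcz.symm hl hci.symm hil hck.symm hkl) hi.symm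
      hk.symm hcl
  have h4 : ∀ i k, i ≠ z → k ≠ z → (∃ c, c ≠ i ∧ c ≠ k ∧ c ≠ z) → unit i z k z ∈ M := by
    rintro i k hi hk ⟨c, hci, hck, hcz⟩
    refine unit_mem_of_col hM hK z ?_ hi.symm hk.symm (Or.inl hcz)
    exact (unit_col_mem_iff hK _ _ _ _).1 (h3 i k c hcz.symm hi hci.symm hk hck.symm)
  by_cases hj : z = j
  · subst hj
    by_cases hl : z = l
    · subst hl
      by_cases hk : p k = 0
      · refine unit_mem_of_row hM hK i (h4 k k hkj hkj ?_) hij hij (Or.inr hk)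
        by_cases hka : k = a
        · exact ⟨b, fun h => hab (hka ▸ h.symm), fun h => hab (hka ▸ h.symm), hzb.symm⟩
        · exact ⟨a, Ne.symm hka, Ne.symm hka, hza.symm⟩
      · refine h4 i k hij hkj ?_
        obtain ⟨c, hc⟩ := exists_notMem {i, k, z}
          (Finset.card_le_three.trans_lt ((by norm_num : 3 < 4).trans (hodd k hk)))
        exact ⟨c, by simpa [not_or] using hc⟩
    · exact h3 i k l hl hij hil hkj hkl
  · by_cases hl : z = l
    · subst hl
      exact (unit_col_mem_iff hK _ _ _ _).1 (h3 i k j hj hil hij hkl hkj)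
    · exact h2 i j k l hj hl hij hil hkj hkl

theorem tensorOne_single (k l : I) :
    tensorOne (Pi.single (k, l) 1) = ∑ j, unit k l j j := by
  ext ⟨i', j', k', l'⟩
  rw [tensorOne_apply, Finset.sum_apply]
  simp only [unit_apply, Pi.single_apply, Prod.mk.injEq]
  by_cases h : k = i' ∧ l = j'
  · obtain ⟨rfl, rfl⟩ := h
    simp [ite_and]
  · have h' : ¬ (i' = k ∧ j' = l) := fun ⟨a, b⟩ => h ⟨a.symm, b.symm⟩
    rw [if_neg h', ite_self]
    exact (Finset.sum_eq_zero fun x _ => if_neg fun h'' => h ⟨h''.1, h''.2.1⟩).symm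

/-- The tensors `E k l ⊗ E j j` with `k ≠ l` are, modulo `M`, multiples of one element `x`, and
the trace relation reads `(d + 2) x = 0`. -/
theorem unit_mem_of_ne (hM : Stable p M) (hK : antisymTrace p ≤ M) (h2 : sdim p + 2 ≠ 0)
    (hcard : 2 < Fintype.card I)
    (hdisj : ∀ i j k l : I, i ≠ j → i ≠ l → k ≠ j → k ≠ l → unit i j k l ∈ M)
    {k l : I} (hkl : k ≠ l) (j : I) : unit k l j j ∈ M := by
  obtain ⟨c, hc⟩ : ∃ c, c ∉ ({k, l} : Finset I) := by
    by_contra! hc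
    have := (Finset.eq_univ_iff_forall.2 hc) ▸ (Finset.card_le_two (a := k) (b := l))
    rw [Finset.card_univ] at this
    omega
  simp only [Finset.mem_insert, Finset.mem_singleton, not_or] at hc
  obtain ⟨hck, hcl⟩ : c ≠ k ∧ c ≠ l := hc
  have hq : ∀ u, u ∈ M → M.mkQ u = 0 := fun u hu => (Submodule.Quotient.mk_eq_zero M).2 hu
  -- each `Y j` is compared with `Y c` by the action of a matrix unit on a tensor in `M`
  set Y : I → Coord I ⧸ M := fun j => M.mkQ (unit k l j j) with hY
  have hYj : ∀ j, j ≠ k → j ≠ l → j ≠ c → Y j = sg (p j + p c) (p c + p j) • Y c := by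
    intro j hjk hjl hjc
    have h := hq _ (hM j c _ (hdisj k l c j hkl hjk.symm hcl hjc.symm))
    rw [act_unit, if_neg hck, if_neg hjl, if_pos rfl, if_pos rfl, sub_zero, zero_add, map_smul,
      smul_eq_zero_iff_right (sg_ne_zero _ _), map_sub, map_smul, sub_eq_zero] at h
    exact h
  have hYk : Y k = (1 + sg (p k) (p k)) • sg (p k + p c) (p k + p c) • Y c := by
    have h := hq _ (hM c k _ (hdisj k l k c hkl hck.symm hkl hck.symm))
    have h' := hq _ (hK (row_mem_antisymTrace p c l k c))
    rw [act_unit, if_pos rfl, if_neg hcl, if_pos rfl, if_pos rfl, sub_zero, map_add, map_smul,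
      map_sub, map_smul] at h
    rw [map_sub, map_smul, sub_eq_zero] at h'
    rw [h'] at h
    change rowSign p c l k • Y c + sg (p c + p k) (p k + p l) •
      (Y c - sg (p c + p k) (p k + p c) • Y k) = 0 at h
    have e1 : rowSign p c l k = sg (p c + p k) (p k + p l) * sg (p k) (p k) := by
      simp only [rowSign, sg_add_left, sg_add_right]
      generalize p c = x; generalize p k = y; generalize p l = w
      fin_cases x <;> fin_cases y <;> fin_cases w <;> simp [sg]
    rw [e1, mul_smul, ← smul_add, smul_eq_zero_iff_right (sg_ne_zero _ _)] at h
    rw [add_comm (p c) (p k)] at h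
    have h3 : sg (p k + p c) (p k + p c) • Y k = (1 + sg (p k) (p k)) • Y c := by
      rw [← sub_eq_zero, ← neg_eq_zero, ← h]
      module
    rw [smul_comm, ← h3, smul_smul, sg_mul_self, one_smul]
  have hYl : Y l = (1 + sg (p l) (p l)) • sg (p l + p c) (p l + p c) • Y c := by
    have h := hq _ (hM l c _ (hdisj k l c l hkl hkl hcl hcl))
    have h' := hq _ (hK (col_mem_antisymTrace p k c c l))
    rw [act_unit, if_neg hck, if_pos rfl, if_pos rfl, if_pos rfl, zero_sub, map_add, map_neg,
      map_smul, map_smul, map_sub, map_smul] at h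
    rw [map_sub, map_smul, sub_eq_zero] at h'
    rw [h'] at h
    change -(sg (p l + p c) (p k + p l) • colSign p c c l • Y c) + sg (p l + p c) (p k + p l) •
      (Y l - sg (p l + p c) (p c + p l) • Y c) = 0 at h
    rw [← smul_neg, ← smul_add, smul_eq_zero_iff_right (sg_ne_zero _ _)] at h
    have e1 : colSign p c c l = (1 + sg (p l) (p l)) * sg (p l + p c) (p l + p c) -
        sg (p l + p c) (p c + p l) := by
      simp only [colSign, sg_add_left, sg_add_right]
      generalize p c = x; generalize p l = w
      fin_cases x <;> fin_cases w <;> simp [sg]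
    rw [smul_smul, ← sub_eq_zero, ← h, e1]
    module
  have hYall : ∀ j, Y j = (sg (p j) (p j) + (if k = j then 1 else 0) + if l = j then 1 else 0) •
      sg (p c) (p c) • Y c := by
    intro j
    by_cases hjk : k = j
    · subst hjk
      rw [hYk, if_pos rfl, if_neg hkl.symm, smul_smul, smul_smul]
      congr 1
      generalize p c = x; generalize p k = w
      fin_cases x <;> fin_cases w <;> simp [sg]
    by_cases hjl : l = j
    · subst hjl
      rw [hYl, if_neg hkl, if_pos rfl, smul_smul, smul_smul]
      congr 1
      generalize p c = x; generalize p l = w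
      fin_cases x <;> fin_cases w <;> simp [sg]
    rw [if_neg hjk, if_neg hjl, add_zero, add_zero, smul_smul]
    by_cases hjc : j = c
    · subst hjc
      rw [sg_mul_self, one_smul]
    · rw [hYj j (Ne.symm hjk) (Ne.symm hjl) hjc]
      congr 1
      generalize p c = x; generalize p j = w
      fin_cases x <;> fin_cases w <;> simp [sg]
  have hsum : ∑ j, Y j = 0 := by
    rw [hY, ← map_sum, ← tensorOne_single]
    exact hq _ (hK (tensorOne_mem_antisymTrace p _))
  have hX : (sdim p + 2) • sg (p c) (p c) • Y c = 0 := by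
    rw [← hsum, Finset.sum_congr rfl fun j _ => hYall j, ← Finset.sum_smul]
    congr 1
    simp only [Finset.sum_add_distrib, Finset.sum_ite_eq, Finset.mem_univ, if_true, sdim]
    ring
  rw [smul_eq_zero_iff_right h2] at hX
  have := hYall j
  rw [hX, smul_zero] at this
  exact (Submodule.Quotient.mk_eq_zero M).1 this

/-- The tensors `E k k ⊗ E j j` are, modulo `M` and for fixed `k`, multiples of one element `x`,
and the trace relation reads `(d + 1) x = 0`. -/
theorem unit_diag_mem (hM : Stable p M) (hK : antisymTrace p ≤ M) (h1 : sdim p + 1 ≠ 0)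
    (hcard : 2 < Fintype.card I)
    (hne : ∀ k l j : I, k ≠ l → unit k l j j ∈ M) (k j : I) : unit k k j j ∈ M := by
  obtain ⟨c, hck⟩ : ∃ c, c ≠ k := by
    have : Nontrivial I := Fintype.one_lt_card_iff_nontrivial.1 (by omega)
    exact exists_ne k
  have hq : ∀ u, u ∈ M → M.mkQ u = 0 := fun u hu => (Submodule.Quotient.mk_eq_zero M).2 hu
  set Y : I → Coord I ⧸ M := fun j => M.mkQ (unit k k j j) with hY
  have hYj : ∀ j, j ≠ k → j ≠ c → Y j = sg (p j + p c) (p c + p j) • Y c := by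
    intro j hjk hjc
    have hu : unit k k c j ∈ M := by
      rw [unit_row_mem_iff hK, unit_col_mem_iff hK]
      exact hne c j k hjc.symm
    have h := hq _ (hM j c _ hu)
    rw [act_unit, if_neg hck, if_neg hjk, if_pos rfl, if_pos rfl, sub_zero, zero_add, map_smul,
      smul_eq_zero_iff_right (sg_ne_zero _ _), map_sub, map_smul, sub_eq_zero] at h
    exact h
  have hYk : Y k = (1 + sg (p k) (p k)) • sg (p k + p c) (p k + p c) • Y c := by
    have hu : unit k k k c ∈ M := by
      rw [unit_col_mem_iff hK]
      exact hne k c k hck.symm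
    have h := hq _ (hM c k _ hu)
    have h' := hq _ (hK (row_mem_antisymTrace p c k k c))
    rw [act_unit, if_pos rfl, if_neg hck, if_pos rfl, if_pos rfl, sub_zero, map_add, map_smul,
      map_sub, map_smul] at h
    rw [map_sub, map_smul, sub_eq_zero] at h'
    rw [h'] at h
    change rowSign p c k k • Y c + sg (p c + p k) (p k + p k) •
      (Y c - sg (p c + p k) (p k + p c) • Y k) = 0 at h
    have e0 : sg (p c + p k) (p k + p k) = 1 := by rw [sg_add_right, sg_mul_self]
    have e1 : rowSign p c k k = sg (p k) (p k) := by
      rw [rowSign, mul_assoc, sg_mul_self, mul_one]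
    rw [e1, e0, one_smul, add_comm (p c) (p k)] at h
    have h3 : sg (p k + p c) (p k + p c) • Y k = (1 + sg (p k) (p k)) • Y c := by
      rw [← sub_eq_zero, ← neg_eq_zero, ← h]
      module
    rw [smul_comm, ← h3, smul_smul, sg_mul_self, one_smul]
  have hYall : ∀ j, Y j = (sg (p j) (p j) + (if k = j then 1 else 0)) •
      sg (p c) (p c) • Y c := by
    intro j
    by_cases hjk : k = j
    · subst hjk
      rw [hYk, if_pos rfl, smul_smul, smul_smul]
      congr 1
      generalize p c = x; generalize p k = w
      fin_cases x <;> fin_cases w <;> simp [sg]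
    rw [if_neg hjk, add_zero, smul_smul]
    by_cases hjc : j = c
    · subst hjc
      rw [sg_mul_self, one_smul]
    · rw [hYj j (Ne.symm hjk) hjc]
      congr 1
      generalize p c = x; generalize p j = w
      fin_cases x <;> fin_cases w <;> simp [sg]
  have hsum : ∑ j, Y j = 0 := by
    rw [hY, ← map_sum, ← tensorOne_single]
    exact hq _ (hK (tensorOne_mem_antisymTrace p _))
  have hX : (sdim p + 1) • sg (p c) (p c) • Y c = 0 := by
    rw [← hsum, Finset.sum_congr rfl fun j _ => hYall j, ← Finset.sum_smul]
    congr 1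
    simp only [Finset.sum_add_distrib, Finset.sum_ite_eq, Finset.mem_univ, if_true, sdim]
  rw [smul_eq_zero_iff_right h1] at hX
  have := hYall j
  rw [hX, smul_zero] at this
  exact (Submodule.Quotient.mk_eq_zero M).1 this

/-- A stable subspace that contains `antisymTrace` and one tensor `E z a ⊗ E z b`, where `z` is
even and `z, a, b` are distinct, is everything. -/
theorem eq_top_of_unit_mem (hM : Stable p M) (hK : antisymTrace p ≤ M)
    (h1 : sdim p + 1 ≠ 0) (h2 : sdim p + 2 ≠ 0)
    {z a b : I} (hz : p z = 0) (hza : z ≠ a) (hzb : z ≠ b) (hab : a ≠ b) (h : unit z a z b ∈ M)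
    (hodd : ∀ i, p i ≠ 0 → 4 < Fintype.card I) : M = ⊤ := by
  have hcard : 2 < Fintype.card I := Fintype.two_lt_card_iff.2 ⟨z, a, b, hza, hzb, hab⟩
  have hdisj : ∀ i j k l : I, i ≠ j → i ≠ l → k ≠ j → k ≠ l → unit i j k l ∈ M :=
    fun i j k l => unit_mem_of_disjoint hM hK hz hza hzb hab h hodd
  have hne : ∀ k l j : I, k ≠ l → unit k l j j ∈ M := fun k l j hkl =>
    unit_mem_of_ne hM hK h2 hcard hdisj hkl j
  have hall : ∀ k l j : I, unit k l j j ∈ M := fun k l j => by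
    by_cases hkl : k = l
    · subst hkl
      exact unit_diag_mem hM hK h1 hcard hne k j
    · exact hne k l j hkl
  have hunit : ∀ i j k l : I, unit i j k l ∈ M := by
    intro i j k l
    by_cases hkl : k = l
    · subst hkl; exact hall i j k
    by_cases hil : i = l
    · subst hil
      rw [unit_row_mem_iff hK]; exact hall k j i
    by_cases hkj : k = j
    · subst hkj
      rw [unit_col_mem_iff hK]; exact hall i l k
    by_cases hij : i = j
    · subst hij
      rw [unit_row_mem_iff hK, unit_col_mem_iff hK]; exact hall k l i
    exact hdisj i j k l hij hil hkj hkl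
  have hq : M.mkQ = 0 := ext_unit fun i j k l => by
    simpa using hunit i j k l
  rw [← M.ker_mkQ, hq, LinearMap.ker_zero]

end Generation

/-! ### Weights, and simplicity of `tracelessSym` -/

section Weights

variable {I : Type*} [Fintype I] [DecidableEq I]

/-- If the operators `D c` are the actions of the `E c c`, this is `24` times the projection to the
weight space of weight `2 ε_z - ε_a - ε_b`, for distinct `z, a, b`. -/
def weightOp {V : Type*} [AddCommMonoid V] [Module ℂ V] (D : I → Module.End ℂ V) (z a b : I) :
    Module.End ℂ V :=
  D b * (D b + (2 : ℂ) • 1) * (D a * (D a + (2 : ℂ) • 1)) *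
    ((D z + (2 : ℂ) • 1) * (D z + (1 : ℂ) • 1) * D z * (D z + (-1 : ℂ) • 1))

/-- If the operators `D c` are the actions of the `E c c`, this is `48` times the projection to the
weight space of weight `2 ε_z - 2 ε_b`, for `z ≠ b`. -/
def weightOp' {V : Type*} [AddCommMonoid V] [Module ℂ V] (D : I → Module.End ℂ V) (z b : I) :
    Module.End ℂ V :=
  D b * (D b + (1 : ℂ) • 1) *
    ((D z + (2 : ℂ) • 1) * (D z + (1 : ℂ) • 1) * D z * (D z + (-1 : ℂ) • 1))

section Map

variable {V V' : Type*} [AddCommMonoid V] [Module ℂ V] [AddCommMonoid V'] [Module ℂ V']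
  {D : I → Module.End ℂ V} {D' : I → Module.End ℂ V'} {f : V →ₗ[ℂ] V'}

theorem map_weightOp (h : ∀ c v, f (D c v) = D' c (f v)) (z a b : I) (v : V) :
    f (weightOp D z a b v) = weightOp D' z a b (f v) := by
  simp only [weightOp, Module.End.mul_apply, LinearMap.add_apply,
    LinearMap.smul_apply, Module.End.one_apply, map_add, map_smul, h]

theorem map_weightOp' (h : ∀ c v, f (D c v) = D' c (f v)) (z b : I) (v : V) :
    f (weightOp' D z b v) = weightOp' D' z b (f v) := by
  simp only [weightOp', Module.End.mul_apply, LinearMap.add_apply,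
    LinearMap.smul_apply, Module.End.one_apply, map_add, map_smul, h]

theorem weightOp_mem {N : Submodule ℂ V} (h : ∀ c, ∀ v ∈ N, D c v ∈ N) (z a b : I) {v : V}
    (hv : v ∈ N) : weightOp D z a b v ∈ N := by
  have hs : ∀ (c : I) (x : ℂ), ∀ v ∈ N, (D c + x • 1) v ∈ N := fun c x v hv =>
    add_mem (h c v hv) (N.smul_mem x hv)
  simp only [weightOp, Module.End.mul_apply]
  exact h _ _ <| hs _ _ _ <| h _ _ <| hs _ _ _ <| hs _ _ _ <| hs _ _ _ <| h _ _ <| hs _ _ _ hv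

theorem weightOp_of_eigen {v : V} {z a b : I} (hz : D z v = (2 : ℂ) • v)
    (ha : D a v = (-1 : ℂ) • v) (hb : D b v = (-1 : ℂ) • v) :
    weightOp D z a b v = (24 : ℂ) • v := by
  simp only [weightOp, Module.End.mul_apply, LinearMap.add_apply,
    LinearMap.smul_apply, Module.End.one_apply, map_add, map_smul, hz, ha, hb]
  module

theorem weightOp'_of_eigen {v : V} {z b : I} (hz : D z v = (2 : ℂ) • v)
    (hb : D b v = (-2 : ℂ) • v) : weightOp' D z b v = (48 : ℂ) • v := by
  simp only [weightOp', Module.End.mul_apply, LinearMap.add_apply,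
    LinearMap.smul_apply, Module.End.one_apply, map_add, map_smul, hz, hb]
  module

end Map

section Diagonal

variable {X : Type*} {D : I → Module.End ℂ (X → ℂ)} {w : I → X → ℂ}

theorem weightOp_eq_mul (hD : ∀ c x t, D c t x = w c x * t x) (z a b : I) (t : X → ℂ) (x : X) :
    weightOp D z a b t x = w b x * ((w b x + 2) * (w a x * ((w a x + 2) *
      ((w z x + 2) * ((w z x + 1) * (w z x * ((w z x - 1) * t x))))))) := by
  have h1 : ∀ c y t, (D c + y • (1 : Module.End ℂ (X → ℂ))) t x = (w c x + y) * t x :=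
    fun c y t => by rw [add_mul, ← hD]; rfl
  simp only [weightOp, Module.End.mul_apply, h1, hD, sub_eq_add_neg]

theorem weightOp'_eq_mul (hD : ∀ c x t, D c t x = w c x * t x) (z b : I) (t : X → ℂ) (x : X) :
    weightOp' D z b t x = w b x * ((w b x + 1) *
      ((w z x + 2) * ((w z x + 1) * (w z x * ((w z x - 1) * t x))))) := by
  have h1 : ∀ c y t, (D c + y • (1 : Module.End ℂ (X → ℂ))) t x = (w c x + y) * t x :=
    fun c y t => by rw [add_mul, ← hD]; rfl
  simp only [weightOp', Module.End.mul_apply, h1, hD, sub_eq_add_neg]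

end Diagonal

variable {p : I → Fin 2}

/-- The multiplicity of the index `a` in the weight of `E i j ⊗ E k l`. -/
def wt (i j k l a : I) : ℂ :=
  (if i = a then 1 else 0) - (if j = a then 1 else 0)
    + (if k = a then 1 else 0) - (if l = a then 1 else 0)

/-- Unless `i = k = z` and `j, l ≠ z`, the multiplicity of `z` is one of `-2, -1, 0, 1`. -/
theorem wt_prod_eq_zero {i j k l z : I} (h : ¬ (i = z ∧ k = z ∧ j ≠ z ∧ l ≠ z)) :
    (wt i j k l z + 2) * (wt i j k l z + 1) * wt i j k l z * (wt i j k l z - 1) = 0 := by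
  by_cases hi : i = z <;> by_cases hj : j = z <;> by_cases hk : k = z <;>
    by_cases hl : l = z <;>
    first
    | exact (h ⟨hi, hk, hj, hl⟩).elim
    | norm_num [wt, hi, hj, hk, hl]

variable (p) in
theorem act_self_apply (a i j k l : I) (t : Coord I) :
    act p a a t (i, j, k, l) = wt i j k l a * t (i, j, k, l) := by
  have h0 : ∀ x y, sg (p a + p a) (p x + p y) = 1 := fun x y => by rw [sg_add_left, sg_mul_self]
  have e : ∀ (x : I) (c d : ℂ), (x = a → c = d) → (if x = a then c else 0) =
      (if x = a then 1 else 0) * d := fun x c d h => by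
    by_cases hx : x = a <;> simp [hx, h]
  rw [act_apply, h0, h0, h0, one_mul, one_mul, one_mul,
    e i _ (t (i, j, k, l)) (fun h => by rw [h]), e j _ (t (i, j, k, l)) (fun h => by rw [h]),
    e k _ (t (i, j, k, l)) (fun h => by rw [h]), e l _ (t (i, j, k, l)) (fun h => by rw [h])]
  rw [wt]
  ring

theorem unit_apply' (i j k l i' j' k' l' : I) :
    unit i j k l (i', j', k', l') = if i' = i ∧ j' = j ∧ k' = k ∧ l' = l then 1 else 0 := by
  simp only [unit, Pi.single_apply, Prod.mk.injEq]

theorem weightOp_act {z a b : I} (hza : z ≠ a) (hzb : z ≠ b) (hab : a ≠ b) (t : Coord I) :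
    weightOp (fun c => act p c c) z a b t =
      (24 * t (z, a, z, b)) • unit z a z b + (24 * t (z, b, z, a)) • unit z b z a := by
  ext ⟨i, j, k, l⟩
  rw [weightOp_eq_mul (w := fun c x => wt x.1 x.2.1 x.2.2.1 x.2.2.2 c)
    (fun c x t => act_self_apply p c x.1 x.2.1 x.2.2.1 x.2.2.2 t), Pi.add_apply,
    Pi.smul_apply, Pi.smul_apply, unit_apply', unit_apply', smul_eq_mul, smul_eq_mul]
  by_cases hik : i = z ∧ k = z ∧ j ≠ z ∧ l ≠ z
  · obtain ⟨rfl, rfl, hj, hl⟩ := hik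
    by_cases hja : j = a
    · subst hja
      by_cases hlb : l = b
      · subst hlb
        simp [wt, hza, hzb, hab, hab.symm, hj, hl]; ring
      · by_cases hlj : l = j
        · subst hlj
          simp [wt, hza, hzb, hab, hj]
        · simp [wt, hza, hzb, hab, hj, hl, hlb, hlj]
    · by_cases hjb : j = b
      · subst hjb
        by_cases hla : l = a
        · subst hla
          simp [wt, hza, hzb, hab, hab.symm, hj, hl]; ring
        · simp [wt, hza, hzb, hj, hl, hja, hla]
      · by_cases hla : l = a
        · subst hla
          simp [wt, hza, hzb, hab, hj, hl, hjb]
        · simp [wt, hza, hj, hl, hja, hla]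
  · have h1 : ¬ (i = z ∧ j = a ∧ k = z ∧ l = b) := fun ⟨h1, h2, h3, h4⟩ =>
      hik ⟨h1, h3, h2 ▸ hza.symm, h4 ▸ hzb.symm⟩
    have h2 : ¬ (i = z ∧ j = b ∧ k = z ∧ l = a) := fun ⟨h1, h2, h3, h4⟩ =>
      hik ⟨h1, h3, h2 ▸ hzb.symm, h4 ▸ hza.symm⟩
    rw [if_neg h1, if_neg h2]
    have h3 := wt_prod_eq_zero hik
    generalize wt i j k l z = x at h3 ⊢
    generalize wt i j k l a = y
    generalize wt i j k l b = w
    generalize t (i, j, k, l) = v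
    linear_combination (w * (w + 2) * (y * (y + 2)) * v) * h3

theorem weightOp'_act {z b : I} (hzb : z ≠ b) (t : Coord I) :
    weightOp' (fun c => act p c c) z b t = (48 * t (z, b, z, b)) • unit z b z b := by
  ext ⟨i, j, k, l⟩
  rw [weightOp'_eq_mul (w := fun c x => wt x.1 x.2.1 x.2.2.1 x.2.2.2 c)
    (fun c x t => act_self_apply p c x.1 x.2.1 x.2.2.1 x.2.2.2 t),
    Pi.smul_apply, unit_apply', smul_eq_mul]
  by_cases hik : i = z ∧ k = z ∧ j ≠ z ∧ l ≠ z
  · obtain ⟨rfl, rfl, hj, hl⟩ := hik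
    by_cases hjb : j = b
    · subst hjb
      by_cases hlb : l = j
      · subst hlb
        simp [wt, hzb, hj]; ring
      · simp [wt, hzb, hj, hl, hlb]
    · by_cases hlb : l = b
      · subst hlb
        simp [wt, hzb, hj, hl, hjb]
      · simp [wt, hzb, hlb, hjb]
  · have h1 : ¬ (i = z ∧ j = b ∧ k = z ∧ l = b) := fun ⟨h1, h2, h3, h4⟩ =>
      hik ⟨h1, h3, h2 ▸ hzb.symm, h4 ▸ hzb.symm⟩
    rw [if_neg h1]
    linear_combination (wt i j k l b * (wt i j k l b + 1) * t (i, j, k, l)) * wt_prod_eq_zero hik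

variable (p) in
/-- The vector of weight `2 ε_z - ε_a - ε_b` in `tracelessSym`, for an even index `z`. -/
def symUnit (z a b : I) : Coord I := unit z a z b + sg (p a) (p b) • unit z b z a

theorem colSign_of_even {z : I} (hz : p z = 0) (a b : I) :
    colSign p a z b = sg (p a) (p b) := by simp [colSign, hz]

theorem rowSign_of_even {z : I} (hz : p z = 0) (a : I) : rowSign p z a z = 1 := by
  simp [rowSign, hz]

theorem symUnit_mem_tracelessSym {z a b : I} (hz : p z = 0) (hza : z ≠ a) (hzb : z ≠ b)
    (hab : a ≠ b) : symUnit p z a b ∈ tracelessSym p := by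
  refine ⟨fun i j k l => ?_, fun i j k l => ?_, fun i j => ?_⟩
  · simp only [symUnit, Pi.add_apply, Pi.smul_apply, unit_apply, smul_eq_mul]
    by_cases h : z = i ∧ z = k
    · obtain ⟨rfl, rfl⟩ := h
      rw [rowSign_of_even hz, one_mul]
    · have h1 : ∀ x y, ¬ (z = i ∧ x = j ∧ z = k ∧ y = l) := fun x y h' => h ⟨h'.1, h'.2.2.1⟩
      have h2 : ∀ x y, ¬ (z = k ∧ x = j ∧ z = i ∧ y = l) := fun x y h' => h ⟨h'.2.2.1, h'.1⟩
      simp [h1, h2]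
  · simp only [symUnit, Pi.add_apply, Pi.smul_apply, unit_apply, smul_eq_mul]
    by_cases h : z = i ∧ z = k
    · obtain ⟨rfl, rfl⟩ := h
      rw [colSign_of_even hz]
      by_cases h1 : a = j ∧ b = l
      · obtain ⟨rfl, rfl⟩ := h1
        simp [hab, hab.symm]
      · by_cases h2 : b = j ∧ a = l
        · obtain ⟨rfl, rfl⟩ := h2
          simp [hab, hab.symm, sg_comm]
        · have h3 : ¬ (a = l ∧ b = j) := fun h => h2 ⟨h.2, h.1⟩
          have h4 : ¬ (b = l ∧ a = j) := fun h => h1 ⟨h.2, h.1⟩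
          simp [h1, h2, h3, h4]
    · have h1 : ∀ x y u v : I, ¬ (z = i ∧ x = u ∧ z = k ∧ y = v) :=
        fun x y u v h' => h ⟨h'.1, h'.2.2.1⟩
      simp [h1]
  · refine Finset.sum_eq_zero fun k _ => ?_
    simp only [symUnit, Pi.add_apply, Pi.smul_apply, unit_apply, smul_eq_mul]
    have h1 : ¬ (z = i ∧ a = j ∧ z = k ∧ b = k) := fun h => hzb (h.2.2.1.trans h.2.2.2.symm)
    have h2 : ¬ (z = i ∧ b = j ∧ z = k ∧ a = k) := fun h => hza (h.2.2.1.trans h.2.2.2.symm)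
    simp [h1, h2]

theorem apply_col_of_mem {t : Coord I} (ht : t ∈ tracelessSym p) {z : I} (hz : p z = 0) (a b : I) :
    t (z, b, z, a) = sg (p a) (p b) * t (z, a, z, b) := by
  rw [ht.2.1 z b z a, colSign_of_even hz, sg_comm (p b) (p a)]

theorem weightOp_of_mem {t : Coord I} (ht : t ∈ tracelessSym p) {z a b : I} (hz : p z = 0)
    (hza : z ≠ a) (hzb : z ≠ b) (hab : a ≠ b) :
    weightOp (fun c => act p c c) z a b t = (24 * t (z, a, z, b)) • symUnit p z a b := by
  rw [weightOp_act hza hzb hab, apply_col_of_mem ht hz a b, symUnit]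
  module

/-- `tracelessSym` is simple: a stable subspace of it either contains the vector `symUnit p z a b`,
which generates everything modulo `antisymTrace`, or its orthogonal complement contains
`unit z a z b` and `antisymTrace`, so that it is everything. -/
theorem eq_bot_or_eq_tracelessSym (h1 : sdim p + 1 ≠ 0) (h2 : sdim p + 2 ≠ 0)
    {z a b : I} (hz : p z = 0) (hza : z ≠ a) (hzb : z ≠ b) (hab : a ≠ b)
    (hodd : ∀ i, p i ≠ 0 → 4 < Fintype.card I)
    {N : Submodule ℂ (Coord I)} (hN : Stable p N) (hNW : N ≤ tracelessSym p) :
    N = ⊥ ∨ N = tracelessSym p := by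
  by_cases h : ∃ t ∈ N, t (z, a, z, b) ≠ 0
  · right
    obtain ⟨t, ht, h0⟩ := h
    have hv : symUnit p z a b ∈ N := by
      have := weightOp_mem (fun c v hv => hN c c v hv) z a b ht
      rw [weightOp_of_mem (hNW ht) hz hza hzb hab] at this
      exact (N.smul_mem_iff (by simpa using h0)).1 this
    have hM : Stable p (N ⊔ antisymTrace p) := by
      intro a b t ht
      obtain ⟨x, hx, y, hy, rfl⟩ := Submodule.mem_sup.1 ht
      rw [map_add]
      exact Submodule.add_mem_sup (hN _ _ _ hx) (antisymTrace_stable p _ _ _ hy)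
    have hu : unit z a z b ∈ N ⊔ antisymTrace p := by
      have := Submodule.add_mem_sup hv (col_mem_antisymTrace p z a z b)
      rw [colSign_of_even hz, symUnit] at this
      have := Submodule.smul_mem _ (1 / 2 : ℂ) this
      convert this using 1
      module
    have htop := eq_top_of_unit_mem hM le_sup_right h1 h2 hz hza hzb hab hu hodd
    refine le_antisymm hNW fun w hw => ?_
    obtain ⟨x, hx, y, hy, rfl⟩ := Submodule.mem_sup.1 (htop ▸ Submodule.mem_top : w ∈ _)
    have : y ∈ tracelessSym p := by
      have := sub_mem hw (hNW hx)
      rwa [add_sub_cancel_left] at this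
    rw [Submodule.disjoint_def.1 (tracelessSym_disjoint p h1 h2) y hy this, add_zero]
    exact hx
  · left
    push Not at h
    have htop := eq_top_of_unit_mem (hN.orthogonal p) (fun k hk n hn => by
        have : n ∈ (form p).orthogonal (antisymTrace p) := by
          rw [orthogonal_antisymTrace]; exact hNW hn
        change form p n k = 0
        rw [form_comm]
        exact this k hk) h1 h2 hz hza hzb hab (fun n hn => by
        change form p n _ = 0
        rw [form_comm, form_unit, h n hn, mul_zero]) hodd
    refine (Submodule.eq_bot_iff _).2 fun n hn => form_nondegenerate p fun s => ?_
    have : s ∈ (form p).orthogonal N := htop ▸ Submodule.mem_top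
    rw [form_comm]
    exact this n hn

end Weights

/-! ### Passage from `𝔰𝔩 ⊗ 𝔰𝔩` to coordinates -/

section Transport

variable {m n : ℕ}

theorem sdim_parity : sdim (parity m n) = (m : ℂ) - n := by
  rw [sdim, Fin.sum_univ_add]
  have h1 : ∀ i : Fin m, sg (parity m n (Fin.castAdd n i)) (parity m n (Fin.castAdd n i)) = 1 :=
    fun i => by simp [parity]
  have h2 : ∀ i : Fin n, sg (parity m n (Fin.natAdd m i)) (parity m n (Fin.natAdd m i)) = -1 :=
    fun i => by simp [parity, sg]
  simp [h1, h2, sub_eq_add_neg]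

theorem supertrace_apply (A : Mat m n) :
    supertrace m n A = ∑ i, sg (parity m n i) (parity m n i) * A i i := by
  simp only [sg_self_eq]; rfl

theorem supertrace_one : supertrace m n 1 = (m : ℂ) - n := by
  rw [← sdim_parity, supertrace_apply, sdim]
  simp

theorem evenPart_apply (A : Mat m n) (i j : Fin (m + n)) :
    evenPart m n A i j = if parity m n i = parity m n j then A i j else 0 := rfl

theorem matBracket_apply (A B : Mat m n) (i j : Fin (m + n)) :
    matBracket m n A B i j = ∑ k, (A i k * B k j -
      sg (parity m n i + parity m n k) (parity m n k + parity m n j) * (B i k * A k j)) := by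
  change (A * B - signedSwapMul m n A B) i j = _
  simp only [signedSwapMul, oddPart, LinearMap.sub_apply, LinearMap.id_apply,
    Matrix.sub_apply, Matrix.add_apply, Matrix.mul_apply, evenPart_apply,
    ← Finset.sum_add_distrib, ← Finset.sum_sub_distrib]
  refine Finset.sum_congr rfl fun k _ => ?_
  generalize parity m n i = x
  generalize parity m n j = y
  generalize parity m n k = w
  fin_cases x <;> fin_cases y <;> fin_cases w <;> simp [sg]

/-- The coordinates of an element of `𝔰𝔩 ⊗ 𝔰𝔩`. -/
def coord (m n : ℕ) : sl m n ⊗[ℂ] sl m n →ₗ[ℂ] Coord (Fin (m + n)) :=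
  TensorProduct.lift <| LinearMap.mk₂ ℂ
    (fun X Y x => X.val x.1 x.2.1 * Y.val x.2.2.1 x.2.2.2)
    (fun X X' Y => by ext x; simp [add_mul])
    (fun c X Y => by ext x; simp [mul_assoc])
    (fun X Y Y' => by ext x; simp [mul_add])
    (fun c X Y => by ext x; simp [mul_left_comm])

theorem coord_tmul (X Y : sl m n) (i j k l : Fin (m + n)) :
    coord m n (X ⊗ₜ Y) (i, j, k, l) = X.val i j * Y.val k l := rfl

/-- The action of a matrix on `𝔤𝔩 ⊗ 𝔤𝔩` in coordinates. -/
def actMat (A : Mat m n) : Coord (Fin (m + n)) →ₗ[ℂ] Coord (Fin (m + n)) :=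
  ∑ a, ∑ b, A a b • act (parity m n) a b

theorem actMat_apply (A : Mat m n) (t : Coord (Fin (m + n))) :
    actMat A t = ∑ a, ∑ b, A a b • act (parity m n) a b t := by
  simp [actMat, LinearMap.sum_apply]

theorem Stable.actMat_mem {M : Submodule ℂ (Coord (Fin (m + n)))} (hM : Stable (parity m n) M)
    (A : Mat m n) {t : Coord (Fin (m + n))} (ht : t ∈ M) : actMat A t ∈ M := by
  rw [actMat_apply]
  exact Submodule.sum_mem _ fun a _ => Submodule.sum_mem _ fun b _ =>
    M.smul_mem _ (hM _ _ _ ht)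

theorem actMat_apply_coord (A : Mat m n) (t : Coord (Fin (m + n))) (i j k l : Fin (m + n)) :
    actMat A t (i, j, k, l) =
      ∑ c, (A i c * t (c, j, k, l) - sg (parity m n i + parity m n c)
          (parity m n c + parity m n j) * (t (i, c, k, l) * A c j)) +
      ∑ c, (sg (parity m n k + parity m n c) (parity m n i + parity m n j) *
          (A k c * t (i, j, c, l)) -
        sg (parity m n c + parity m n l) (parity m n i + parity m n j) *
          (sg (parity m n k + parity m n c) (parity m n c + parity m n l) *
            (t (i, j, k, c) * A c l))) := by
  have h1 : ∀ (i : Fin (m + n)) (f : Fin (m + n) → Fin (m + n) → ℂ),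
      ∑ a, ∑ b, (if i = a then f a b else 0) = ∑ b, f i b := fun i f => by
    rw [Finset.sum_comm]; simp
  have h2 : ∀ (j : Fin (m + n)) (f : Fin (m + n) → Fin (m + n) → ℂ),
      ∑ a, ∑ b, (if j = b then f a b else 0) = ∑ a, f a j := fun j f => by simp
  have e : ∀ a b, A a b * act (parity m n) a b t (i, j, k, l) =
      (if i = a then A a b * t (b, j, k, l) else 0)
      - (if j = b then sg (parity m n i + parity m n a) (parity m n a + parity m n b) *
          (t (i, a, k, l) * A a b) else 0)
      + ((if k = a then sg (parity m n a + parity m n b) (parity m n i + parity m n j) *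
          (A a b * t (i, j, b, l)) else 0)
      - (if l = b then sg (parity m n a + parity m n b) (parity m n i + parity m n j) *
          (sg (parity m n k + parity m n a) (parity m n a + parity m n b) *
            (t (i, j, k, a) * A a b)) else 0)) := by
    intro a b
    rw [act_apply, sg_comm (parity m n a + parity m n b) (parity m n i + parity m n a),
      sg_comm (parity m n a + parity m n b) (parity m n k + parity m n a)]
    split_ifs <;> ring
  rw [actMat_apply]
  simp only [Finset.sum_apply, Pi.smul_apply, smul_eq_mul, e, Finset.sum_add_distrib,
    Finset.sum_sub_distrib, h1, h2]

theorem coord_tensorAct (X : sl m n) (s : sl m n ⊗[ℂ] sl m n) :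
    coord m n (tensorAct m n X s) = actMat X.val (coord m n s) := by
  suffices h : coord m n ∘ₗ tensorAct m n X = actMat X.val ∘ₗ coord m n from LinearMap.congr_fun h s
  refine TensorProduct.ext' fun Y Z => ?_
  ext ⟨i, j, k, l⟩
  rw [LinearMap.comp_apply, LinearMap.comp_apply, actMat_apply_coord]
  simp only [tensorAct, LinearMap.add_apply, TensorProduct.map_tmul, LinearMap.id_apply, map_add,
    Pi.add_apply, coord_tmul]
  have e1 : ∀ B : sl m n, (bracket m n B Z).val k l = ∑ c, (B.val k c * Z.val c l -
      sg (parity m n k + parity m n c) (parity m n c + parity m n l) * (Z.val k c * B.val c l)) :=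
    fun B => matBracket_apply _ _ _ _
  have e2 : (bracket m n X Y).val i j = ∑ c, (X.val i c * Y.val c j -
      sg (parity m n i + parity m n c) (parity m n c + parity m n j) * (Y.val i c * X.val c j)) :=
    matBracket_apply _ _ _ _
  have e3 : ∀ c d, (slEven m n X).val c d =
      if parity m n c = parity m n d then X.val c d else 0 := fun c d => rfl
  have e4 : ∀ c d, (slOdd m n X).val c d = X.val c d -
      if parity m n c = parity m n d then X.val c d else 0 := fun c d => rfl
  have e5 : ((slEven m n - slOdd m n) Y).val i j =
      (if parity m n i = parity m n j then Y.val i j else 0) - (Y.val i j -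
      if parity m n i = parity m n j then Y.val i j else 0) := rfl
  rw [e1, e1, e2, e5, add_assoc, Finset.sum_mul, Finset.mul_sum, Finset.mul_sum,
    ← Finset.sum_add_distrib]
  congr 1
  · exact Finset.sum_congr rfl fun c _ => by ring
  · refine Finset.sum_congr rfl fun c _ => ?_
    rw [e3, e3, e4, e4]
    generalize parity m n i = x
    generalize parity m n j = y
    generalize parity m n k = w
    generalize parity m n l = v
    generalize parity m n c = u
    generalize Y.val i j = A1
    generalize X.val k c = A2
    generalize X.val c l = A3
    generalize Z.val c l = A4
    generalize Z.val k c = A5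
    fin_cases x <;> fin_cases y <;> fin_cases w <;> fin_cases v <;> fin_cases u <;>
      simp [sg] <;> ring

theorem sum_act_self (t : Coord (Fin (m + n))) : ∑ a, act (parity m n) a a t = 0 := by
  ext ⟨i, j, k, l⟩
  simp [Finset.sum_apply, act_self_apply, ← Finset.sum_mul, wt, Finset.sum_add_distrib]

theorem actMat_one : actMat (1 : Mat m n) = 0 := by
  refine LinearMap.ext fun t => ?_
  rw [actMat_apply, LinearMap.zero_apply, ← sum_act_self t]
  refine Finset.sum_congr rfl fun a _ => ?_
  rw [Finset.sum_eq_single a]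
  · simp
  · intro b _ hb; simp [Matrix.one_apply_ne hb.symm]
  · simp

theorem actMat_single (a b : Fin (m + n)) :
    actMat (Matrix.single a b 1 : Mat m n) = act (parity m n) a b := by
  refine LinearMap.ext fun t => ?_
  rw [actMat_apply]
  simp [Matrix.single_apply, ite_and]

theorem actMat_sub (A B : Mat m n) : actMat (A - B) = actMat A - actMat B := by
  refine LinearMap.ext fun t => ?_
  simp only [LinearMap.sub_apply, actMat_apply, Matrix.sub_apply, sub_smul, Finset.sum_sub_distrib]

theorem actMat_smul (c : ℂ) (A : Mat m n) : actMat (c • A) = c • actMat A := by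
  simp [actMat, mul_smul, Finset.smul_sum]

/-- The projection of `𝔤𝔩` to `𝔰𝔩` along the identity matrix, for `m ≠ n`. (For `m = n` it is not
a projection; all results about it assume `m ≠ n`.) -/
def toSl (h : (m : ℂ) - n ≠ 0) : Mat m n →ₗ[ℂ] sl m n where
  toFun A := ⟨A - (supertrace m n A / ((m : ℂ) - n)) • (1 : Mat m n), by
    rw [LinearMap.mem_ker, map_sub, map_smul, supertrace_one, smul_eq_mul, div_mul_cancel₀ _ h,
      sub_self]⟩
  map_add' A B := by
    ext1
    simp only [map_add, Submodule.coe_add, add_div, add_smul]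
    abel
  map_smul' c A := by
    ext1
    simp only [map_smul, smul_eq_mul, RingHom.id_apply, Submodule.coe_smul, smul_sub, smul_smul,
      mul_div_assoc]

variable (h : (m : ℂ) - n ≠ 0)

theorem toSl_val (A : Mat m n) :
    (toSl h A).val = A - (supertrace m n A / ((m : ℂ) - n)) • (1 : Mat m n) := rfl

theorem toSl_coe (X : sl m n) : toSl h X.val = X := by
  ext1
  rw [toSl_val, LinearMap.mem_ker.1 X.2, zero_div, zero_smul, sub_zero]

theorem toSl_one : toSl h 1 = 0 := by
  ext1
  rw [toSl_val, supertrace_one, div_self h, one_smul, sub_self]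
  rfl

/-- The traceless part of the matrix unit `E a b`. -/
def slUnit (a b : Fin (m + n)) : sl m n := toSl h (Matrix.single a b 1)

theorem sum_smul_slUnit (A : Mat m n) : ∑ a, ∑ b, A a b • slUnit h a b = toSl h A := by
  conv_rhs => rw [Matrix.matrix_eq_sum_single A]
  simp only [map_sum, slUnit, ← map_smul, Matrix.smul_single, smul_eq_mul, mul_one]

theorem actMat_toSl (A : Mat m n) : actMat (toSl h A).val = actMat A := by
  rw [toSl_val, actMat_sub, actMat_smul, actMat_one, smul_zero, sub_zero]

theorem coord_tensorAct_slUnit (a b : Fin (m + n)) (s : sl m n ⊗[ℂ] sl m n) :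
    coord m n (tensorAct m n (slUnit h a b) s) = act (parity m n) a b (coord m n s) := by
  rw [coord_tensorAct, slUnit, actMat_toSl, actMat_single]

/-- The element of `𝔰𝔩 ⊗ 𝔰𝔩` obtained from coordinates by projecting both factors to `𝔰𝔩`. -/
def ofCoord : Coord (Fin (m + n)) →ₗ[ℂ] sl m n ⊗[ℂ] sl m n where
  toFun t := ∑ i, ∑ j, ∑ k, ∑ l, t (i, j, k, l) • (slUnit h i j ⊗ₜ slUnit h k l)
  map_add' s t := by simp only [Pi.add_apply, add_smul, Finset.sum_add_distrib]
  map_smul' c t := by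
    simp only [Pi.smul_apply, smul_eq_mul, mul_smul, Finset.smul_sum, RingHom.id_apply]

theorem ofCoord_apply (t : Coord (Fin (m + n))) : ofCoord h t =
    ∑ i, ∑ j, ∑ k, ∑ l, t (i, j, k, l) • (slUnit h i j ⊗ₜ[ℂ] slUnit h k l) := rfl

theorem ofCoord_unit (i j k l : Fin (m + n)) :
    ofCoord h (unit i j k l) = slUnit h i j ⊗ₜ[ℂ] slUnit h k l := by
  simp [ofCoord_apply, unit_apply, ite_and, ite_smul]

theorem ofCoord_coord (s : sl m n ⊗[ℂ] sl m n) : ofCoord h (coord m n s) = s := by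
  suffices h : ofCoord h ∘ₗ coord m n = LinearMap.id from LinearMap.congr_fun h s
  refine TensorProduct.ext' fun X Y => ?_
  rw [LinearMap.comp_apply, ofCoord_apply, LinearMap.id_apply]
  conv_rhs => rw [← toSl_coe h X, ← toSl_coe h Y, ← sum_smul_slUnit, ← sum_smul_slUnit]
  simp_rw [TensorProduct.sum_tmul, TensorProduct.tmul_sum, TensorProduct.smul_tmul_smul]
  rfl

include h in
theorem coord_injective : Function.Injective (coord m n) :=
  Function.LeftInverse.injective (ofCoord_coord h)

/-- The coordinates of `1 ⊗ A`. -/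
def oneTensor : (Fin (m + n) × Fin (m + n) → ℂ) →ₗ[ℂ] Coord (Fin (m + n)) where
  toFun A x := if x.1 = x.2.1 then A (x.2.2.1, x.2.2.2) else 0
  map_add' A B := by ext x; by_cases h : x.1 = x.2.1 <;> simp [h]
  map_smul' c A := by ext x; by_cases h : x.1 = x.2.1 <;> simp [h]

theorem oneTensor_apply (A : Fin (m + n) × Fin (m + n) → ℂ) (i j k l : Fin (m + n)) :
    oneTensor A (i, j, k, l) = if i = j then A (k, l) else 0 := rfl

/-- The exchange of the rows, followed by that of the columns, takes `1 ⊗ A` to `A ⊗ 1`. -/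
theorem oneTensor_mem_antisymTrace (A : Fin (m + n) × Fin (m + n) → ℂ) :
    oneTensor A ∈ antisymTrace (parity m n) := by
  suffices hs : ∀ k l, oneTensor (Pi.single (k, l) 1) ∈ antisymTrace (parity m n) by
    rw [pi_eq_sum_univ' A, map_sum]
    refine Submodule.sum_mem _ fun x _ => ?_
    rw [map_smul]
    refine Submodule.smul_mem _ _ ?_
    convert hs x.1 x.2 using 2
  intro k l
  have e : oneTensor (Pi.single (k, l) 1) = ∑ j, unit j j k l := by
    ext ⟨i', j', k', l'⟩
    rw [oneTensor_apply, Finset.sum_apply]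
    simp only [unit_apply, Pi.single_apply, Prod.mk.injEq]
    by_cases hk : k = k' ∧ l = l'
    · obtain ⟨rfl, rfl⟩ := hk
      simp [ite_and]
    · have h' : ¬ (k' = k ∧ l' = l) := fun ⟨a, b⟩ => hk ⟨a.symm, b.symm⟩
      rw [if_neg h', ite_self]
      exact (Finset.sum_eq_zero fun x _ => if_neg fun h'' => hk h''.2.2).symm
  have h1 : ∑ j, unit j j k l - tensorOne (Pi.single (k, l) 1) ∈ antisymTrace (parity m n) := by
    rw [tensorOne_single, ← Finset.sum_sub_distrib]
    refine Submodule.sum_mem _ fun j _ => ?_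
    have h1 := row_mem_antisymTrace (parity m n) j j k l
    have h2 := Submodule.smul_mem _ (rowSign (parity m n) j j k)
      (col_mem_antisymTrace (parity m n) k j j l)
    have h3 := add_mem h1 h2
    rw [smul_sub, sub_add_sub_cancel, smul_smul] at h3
    have e : rowSign (parity m n) j j k * colSign (parity m n) j j l = 1 := by
      rw [rowSign, colSign]
      generalize parity m n j = x; generalize parity m n k = y; generalize parity m n l = w
      fin_cases x <;> fin_cases y <;> fin_cases w <;> simp [sg]
    rwa [e, one_smul] at h3
  rw [e]
  have := add_mem h1 (tensorOne_mem_antisymTrace (parity m n) (Pi.single (k, l) 1))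
  rwa [sub_add_cancel] at this

/-- The partial supertrace over the first factor. -/
def trLeft (t : Coord (Fin (m + n))) (x : Fin (m + n) × Fin (m + n)) : ℂ :=
  ∑ a, sg (parity m n a) (parity m n a) * t (a, a, x.1, x.2)

/-- The partial supertrace over the second factor. -/
def trRight (t : Coord (Fin (m + n))) (x : Fin (m + n) × Fin (m + n)) : ℂ :=
  ∑ a, sg (parity m n a) (parity m n a) * t (x.1, x.2, a, a)

theorem slUnit_val (a b i j : Fin (m + n)) : (slUnit h a b).val i j =
    (if a = i ∧ b = j then 1 else 0) -
      (if a = b then sg (parity m n a) (parity m n a) / ((m : ℂ) - n) else 0) *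
        (if i = j then 1 else 0) := by
  have e : supertrace m n (Matrix.single a b 1 : Mat m n) =
      if a = b then sg (parity m n a) (parity m n a) else 0 := by
    rw [supertrace_apply]
    by_cases hab : a = b
    · subst hab
      rw [Finset.sum_eq_single a]
      · simp
      · intro c _ hc; simp [hc.symm]
      · simp
    · rw [if_neg hab]
      refine Finset.sum_eq_zero fun c _ => ?_
      rw [Matrix.single_apply, if_neg (fun h' => hab (h'.1.trans h'.2.symm)), mul_zero]
  rw [slUnit, toSl_val, e, Matrix.sub_apply, Matrix.smul_apply, Matrix.single_apply,
    Matrix.one_apply, smul_eq_mul, ite_div, zero_div]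

/-- Projecting both factors to `𝔰𝔩` changes a tensor by terms `1 ⊗ A`, `A ⊗ 1` and `1 ⊗ 1` that are
given by its partial supertraces. -/
theorem coord_ofCoord (t : Coord (Fin (m + n))) (i j k l : Fin (m + n)) :
    coord m n (ofCoord h t) (i, j, k, l) = t (i, j, k, l)
      - (if i = j then 1 else 0) * (trLeft t (k, l) / ((m : ℂ) - n))
      - (if k = l then 1 else 0) * (trRight t (i, j) / ((m : ℂ) - n))
      + (if i = j then 1 else 0) * (if k = l then 1 else 0) *
        ((∑ a, sg (parity m n a) (parity m n a) * trRight t (a, a)) / ((m : ℂ) - n) ^ 2) := by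
  have e : coord m n (ofCoord h t) (i, j, k, l) = ∑ a, ∑ b, ∑ c, ∑ e, t (a, b, c, e) *
      ((slUnit h a b).val i j * (slUnit h c e).val k l) := by
    simp only [ofCoord_apply, map_sum, map_smul, Finset.sum_apply, Pi.smul_apply, coord_tmul,
      smul_eq_mul]
  rw [e]
  set d : ℂ := (m : ℂ) - n with hd
  have e2 : ∀ a b c e, t (a, b, c, e) * ((slUnit h a b).val i j * (slUnit h c e).val k l) =
      (if a = i then if b = j then if c = k then if e = l then t (a, b, c, e) else 0 else 0
        else 0 else 0)
      - (if i = j then 1 else 0) * (if b = a then if c = k then if e = l then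
        sg (parity m n a) (parity m n a) * t (a, b, c, e) / d else 0 else 0 else 0)
      - (if k = l then 1 else 0) * (if a = i then if b = j then if e = c then
        sg (parity m n c) (parity m n c) * t (a, b, c, e) / d else 0 else 0 else 0)
      + (if i = j then 1 else 0) * (if k = l then 1 else 0) * (if b = a then if e = c then
        sg (parity m n a) (parity m n a) *
          (sg (parity m n c) (parity m n c) * t (a, b, c, e)) / d ^ 2 else 0 else 0) := by
    intro a b c e
    rw [slUnit_val, slUnit_val, ← hd, ite_and, ite_and]
    have h1 : (if a = b then sg (parity m n a) (parity m n a) / d else 0) =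
        if b = a then sg (parity m n a) (parity m n a) / d else 0 := by simp only [eq_comm]
    have h2 : (if c = e then sg (parity m n c) (parity m n c) / d else 0) =
        if e = c then sg (parity m n c) (parity m n c) / d else 0 := by simp only [eq_comm]
    rw [h1, h2]
    generalize t (a, b, c, e) = T
    generalize sg (parity m n a) (parity m n a) = S
    generalize sg (parity m n c) (parity m n c) = S'
    have m1 : ∀ (P Q R S : Prop) [Decidable P] [Decidable Q] [Decidable R] [Decidable S] (x : ℂ),
        (if P then if Q then if R then if S then x else 0 else 0 else 0 else 0) =
        (if P then if Q then 1 else 0 else 0) * (if R then if S then 1 else 0 else 0) * x := by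
      intros; split_ifs <;> simp
    have m2 : ∀ (P R S : Prop) [Decidable P] [Decidable R] [Decidable S] (x : ℂ),
        (if P then if R then if S then x else 0 else 0 else 0) =
        (if P then 1 else 0) * (if R then if S then 1 else 0 else 0) * x := by
      intros; split_ifs <;> simp
    have m3 : ∀ (P R S : Prop) [Decidable P] [Decidable R] [Decidable S] (x : ℂ),
        (if R then if S then if P then x else 0 else 0 else 0) =
        (if R then if S then 1 else 0 else 0) * (if P then 1 else 0) * x := by
      intros; split_ifs <;> simp
    have m4 : ∀ (P Q : Prop) [Decidable P] [Decidable Q] (x : ℂ),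
        (if P then if Q then x else 0 else 0) =
        (if P then 1 else 0) * (if Q then 1 else 0) * x := by
      intros; split_ifs <;> simp
    have m5 : ∀ (P : Prop) [Decidable P] (x : ℂ),
        (if P then x else 0) = (if P then 1 else 0) * x := by
      intros; split_ifs <;> simp
    rw [m1, m2, m3 (e = c), m4 (b = a) (e = c), m5 (b = a) (S / d), m5 (e = c) (S' / d)]
    ring_nf
  simp only [e2, Finset.sum_add_distrib, Finset.sum_sub_distrib, ← Finset.mul_sum]
  have h1 : ∀ (i : Fin (m + n)) (f : Fin (m + n) → ℂ),
      ∑ a, (if a = i then f a else 0) = f i := fun i f => by simp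
  have h0 : ∀ (P : Prop) [Decidable P] (f : Fin (m + n) → ℂ),
      ∑ a, (if P then f a else 0) = if P then ∑ a, f a else 0 := by
    intro P _ f; split_ifs <;> simp
  simp only [h0, h1, trLeft, trRight, Finset.sum_div, Finset.mul_sum]

end Transport

/-! ### The Cartan projection -/

section Projection

variable {m n : ℕ}

theorem sdim_add_ne_zero (hmn : 2 < |(m : ℤ) - (n : ℤ)|) (c : ℤ) (hc : |c| ≤ 2) :
    ((m : ℂ) - n) + c ≠ 0 := by
  intro h
  have h' : ((m : ℤ) - n + c : ℤ) = 0 := by exact_mod_cast h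
  have : (m : ℤ) - n = -c := by linarith
  rw [this, abs_neg] at hmn
  omega

theorem sdim_ne_zero (hmn : 2 < |(m : ℤ) - (n : ℤ)|) : (m : ℂ) - n ≠ 0 := by
  simpa using sdim_add_ne_zero hmn 0 (by simp)

theorem sdim_add_one_ne_zero (hmn : 2 < |(m : ℤ) - (n : ℤ)|) : (m : ℂ) - n + 1 ≠ 0 := by
  simpa using sdim_add_ne_zero hmn 1 (by simp)

theorem sdim_add_two_ne_zero (hmn : 2 < |(m : ℤ) - (n : ℤ)|) : (m : ℂ) - n + 2 ≠ 0 := by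
  simpa using sdim_add_ne_zero hmn 2 (by simp)

theorem two_lt_add (hmn : 2 < |(m : ℤ) - (n : ℤ)|) : 2 < m + n := by
  rcases le_total (m : ℤ) n with h | h
  · rw [abs_of_nonpos (by linarith)] at hmn; omega
  · rw [abs_of_nonneg (by linarith)] at hmn; omega

theorem isCompl_of_lt (hmn : 2 < |(m : ℤ) - (n : ℤ)|) :
    IsCompl (tracelessSym (parity m n)) (antisymTrace (parity m n)) :=
  isCompl_tracelessSym _ (by rw [sdim_parity]; exact sdim_add_one_ne_zero hmn)
    (by rw [sdim_parity]; exact sdim_add_two_ne_zero hmn)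

theorem four_lt_card (hm : 1 ≤ m) (hmn : 2 < |(m : ℤ) - (n : ℤ)|) (i : Fin (m + n))
    (hi : parity m n i ≠ 0) : 4 < Fintype.card (Fin (m + n)) := by
  have hn : 1 ≤ n := by
    by_contra h
    have : i.val < m := by omega
    exact hi (by simp [parity, this])
  rw [Fintype.card_fin]
  rcases le_total (m : ℤ) n with h | h
  · rw [abs_of_nonpos (by linarith)] at hmn; omega
  · rw [abs_of_nonneg (by linarith)] at hmn; omega

/-- `tracelessSym` is contained in `𝔰𝔩 ⊗ 𝔰𝔩`. -/
theorem coord_ofCoord_of_mem (h : (m : ℂ) - n ≠ 0) {t : Coord (Fin (m + n))}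
    (ht : t ∈ tracelessSym (parity m n)) : coord m n (ofCoord h t) = t := by
  have h1 : ∀ x, trRight t x = 0 := fun x => ht.2.2 x.1 x.2
  have h2 : ∀ x, trLeft t x = 0 := by
    intro x
    rw [← h1 x, trLeft, trRight]
    refine Finset.sum_congr rfl fun a _ => ?_
    rw [ht.1 a a x.1 x.2, ht.2.1 x.1 a a x.2, ← mul_assoc (rowSign _ _ _ _)]
    have e : rowSign (parity m n) a a x.1 * colSign (parity m n) a a x.2 =
        sg (parity m n x.1) (parity m n a) * sg (parity m n x.1) (parity m n a) *
        (sg (parity m n x.2) (parity m n a) * sg (parity m n x.2) (parity m n a)) := by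
      rw [rowSign, colSign]
      generalize parity m n a = u; generalize parity m n x.1 = y; generalize parity m n x.2 = w
      fin_cases u <;> fin_cases y <;> fin_cases w <;> simp [sg]
    rw [e, sg_mul_self, sg_mul_self, one_mul, one_mul]
  ext ⟨i, j, k, l⟩
  rw [coord_ofCoord, h1, h2]
  simp [h1]

theorem coord_ofCoord_sub_mem (h : (m : ℂ) - n ≠ 0) (t : Coord (Fin (m + n))) :
    coord m n (ofCoord h t) - t ∈ antisymTrace (parity m n) := by
  have e : coord m n (ofCoord h t) - t =
      -oneTensor (fun x => trLeft t x / ((m : ℂ) - n))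
      - tensorOne (fun x => trRight t x / ((m : ℂ) - n))
      + tensorOne (fun x => if x.1 = x.2 then
        (∑ a, sg (parity m n a) (parity m n a) * trRight t (a, a)) / ((m : ℂ) - n) ^ 2 else 0) := by
    ext ⟨i, j, k, l⟩
    rw [Pi.sub_apply, coord_ofCoord, Pi.add_apply, Pi.sub_apply, Pi.neg_apply, oneTensor_apply,
      tensorOne_apply, tensorOne_apply]
    split_ifs <;> ring
  rw [e]
  exact add_mem (sub_mem (neg_mem (oneTensor_mem_antisymTrace _))
    (tensorOne_mem_antisymTrace _ _)) (tensorOne_mem_antisymTrace _ _)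

variable (hmn : 2 < |(m : ℤ) - (n : ℤ)|)

/-- The projection of `𝔤𝔩 ⊗ 𝔤𝔩` to its traceless symmetric part. -/
def symProj : Coord (Fin (m + n)) →ₗ[ℂ] Coord (Fin (m + n)) :=
  (tracelessSym (parity m n)).projection (antisymTrace (parity m n)) (isCompl_of_lt hmn)

theorem symProj_mem (t : Coord (Fin (m + n))) : symProj hmn t ∈ tracelessSym (parity m n) :=
  Submodule.projection_apply_mem _ _

theorem symProj_of_mem {t : Coord (Fin (m + n))} (ht : t ∈ tracelessSym (parity m n)) :
    symProj hmn t = t :=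
  Submodule.projection_apply_of_mem_left _ ht

theorem symProj_eq_zero_iff {t : Coord (Fin (m + n))} :
    symProj hmn t = 0 ↔ t ∈ antisymTrace (parity m n) :=
  Submodule.projection_apply_eq_zero_iff _

theorem sub_symProj_mem (t : Coord (Fin (m + n))) :
    t - symProj hmn t ∈ antisymTrace (parity m n) := by
  rw [← symProj_eq_zero_iff hmn, map_sub, symProj_of_mem hmn (symProj_mem hmn t), sub_self]

theorem symProj_actMat (A : Mat m n) (t : Coord (Fin (m + n))) :
    symProj hmn (actMat A t) = actMat A (symProj hmn t) := by
  have h1 := (antisymTrace_stable (parity m n)).actMat_mem A (sub_symProj_mem hmn t)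
  rw [← symProj_eq_zero_iff hmn, map_sub, map_sub, sub_eq_zero] at h1
  rw [h1, symProj_of_mem hmn]
  exact (tracelessSym_stable (parity m n)).actMat_mem A (symProj_mem hmn t)

/-- The projection of `𝔰𝔩 ⊗ 𝔰𝔩` induced by `symProj`. -/
def slProj : (sl m n ⊗[ℂ] sl m n) →ₗ[ℂ] (sl m n ⊗[ℂ] sl m n) :=
  ofCoord (sdim_ne_zero hmn) ∘ₗ symProj hmn ∘ₗ coord m n

theorem coord_slProj (s : sl m n ⊗[ℂ] sl m n) :
    coord m n (slProj hmn s) = symProj hmn (coord m n s) :=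
  coord_ofCoord_of_mem _ (symProj_mem hmn _)

theorem mem_range_slProj {s : sl m n ⊗[ℂ] sl m n} :
    s ∈ LinearMap.range (slProj hmn) ↔ coord m n s ∈ tracelessSym (parity m n) := by
  constructor
  · rintro ⟨s, rfl⟩
    rw [coord_slProj]
    exact symProj_mem hmn _
  · intro hs
    refine ⟨s, coord_injective (sdim_ne_zero hmn) ?_⟩
    rw [coord_slProj, symProj_of_mem hmn hs]

theorem slProj_of_mem {s : sl m n ⊗[ℂ] sl m n}
    (hs : coord m n s ∈ tracelessSym (parity m n)) : slProj hmn s = s := by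
  apply coord_injective (sdim_ne_zero hmn)
  rw [coord_slProj, symProj_of_mem hmn hs]

include hmn in
theorem IsInvariant.stable {W : Submodule ℂ (sl m n ⊗[ℂ] sl m n)} (hW : IsInvariant m n W) :
    Stable (parity m n) (W.map (coord m n)) := by
  rintro a b _ ⟨s, hs, rfl⟩
  rw [← coord_tensorAct_slUnit (sdim_ne_zero hmn)]
  exact ⟨_, hW _ _ hs, rfl⟩

variable (hm : 1 ≤ m)

/-- The first index, which is even. -/
def idxFirst : Fin (m + n) := ⟨0, Nat.lt_of_lt_of_le hm (Nat.le_add_right m n)⟩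

/-- The last but one index. -/
def idxPenult : Fin (m + n) := ⟨m + n - 2, by have := two_lt_add hmn; omega⟩

/-- The last index. -/
def idxLast : Fin (m + n) := ⟨m + n - 1, by have := two_lt_add hmn; omega⟩

theorem parity_idxFirst : parity m n (idxFirst hm) = 0 := by
  have : 0 < m := hm
  simp [parity, idxFirst, this]

theorem parity_idxLast (hn : n ≠ 0) : parity m n (idxLast hmn) = 1 := by
  have : ¬ (m + n - 1 < m) := by omega
  simp [parity, idxLast, this]

theorem idxFirst_ne_idxPenult : idxFirst (n := n) hm ≠ idxPenult hmn := by
  have := two_lt_add hmn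
  simp only [idxFirst, idxPenult, ne_eq, Fin.mk.injEq]; omega

theorem idxFirst_ne_idxLast : idxFirst (n := n) hm ≠ idxLast hmn := by
  have := two_lt_add hmn
  simp only [idxFirst, idxLast, ne_eq, Fin.mk.injEq]; omega

theorem idxPenult_ne_idxLast : idxPenult hmn ≠ idxLast hmn := by
  have := two_lt_add hmn
  simp only [idxPenult, idxLast, ne_eq, Fin.mk.injEq]; omega

include hm in
theorem eq_bot_or_eq_range_slProj {W : Submodule ℂ (sl m n ⊗[ℂ] sl m n)}
    (hW : IsInvariant m n W) (hle : W ≤ LinearMap.range (slProj hmn)) :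
    W = ⊥ ∨ W = LinearMap.range (slProj hmn) := by
  have hle' : W.map (coord m n) ≤ tracelessSym (parity m n) := by
    rintro _ ⟨s, hs, rfl⟩
    exact (mem_range_slProj hmn).1 (hle hs)
  have hinj := coord_injective (sdim_ne_zero hmn)
  rcases eq_bot_or_eq_tracelessSym (by rw [sdim_parity]; exact sdim_add_one_ne_zero hmn)
    (by rw [sdim_parity]; exact sdim_add_two_ne_zero hmn) (parity_idxFirst hm)
    (idxFirst_ne_idxPenult hmn hm) (idxFirst_ne_idxLast hmn hm) (idxPenult_ne_idxLast hmn)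
    (four_lt_card hm hmn) (hW.stable hmn) hle' with h | h
  · left
    refine (Submodule.eq_bot_iff _).2 fun s hs => hinj ?_
    rw [map_zero]
    exact (Submodule.eq_bot_iff _).1 h _ ⟨s, hs, rfl⟩
  · right
    refine le_antisymm hle fun s hs => ?_
    rw [mem_range_slProj, ← h] at hs
    obtain ⟨s', hs', e⟩ := hs
    rwa [← hinj e]

theorem act_self_unit {I : Type*} [Fintype I] [DecidableEq I] (p : I → Fin 2) (c i j k l : I) :
    act p c c (unit i j k l) = wt i j k l c • unit i j k l := by
  ext ⟨i', j', k', l'⟩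
  rw [act_self_apply, Pi.smul_apply, smul_eq_mul, unit_apply]
  by_cases h : i = i' ∧ j = j' ∧ k = k' ∧ l = l'
  · obtain ⟨rfl, rfl, rfl, rfl⟩ := h
    rfl
  · rw [if_neg h, mul_zero, mul_zero]

theorem actMat_unit_of_isDiag {A : Mat m n} (hA : A.IsDiag) (i j k l : Fin (m + n)) :
    actMat A (unit i j k l) = (A i i - A j j + A k k - A l l) • unit i j k l := by
  have h : ∀ a, ∑ b, A a b • act (parity m n) a b (unit i j k l) =
      (A a a * wt i j k l a) • unit i j k l := by
    intro a
    rw [Finset.sum_eq_single a]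
    · rw [act_self_unit, smul_smul]
    · intro b _ hb; rw [hA hb.symm, zero_smul]
    · simp
  rw [actMat_apply, Finset.sum_congr rfl fun a _ => h a, ← Finset.sum_smul]
  congr 1
  simp [wt, mul_add, mul_sub, Finset.sum_add_distrib]

theorem diagEntry_val (A : Mat m n) (i : Fin (m + n)) : diagEntry m n A i.val = A i i := by
  simp [diagEntry]

/-- The coordinates of the highest weight vector of the Cartan product. -/
def topVector : Coord (Fin (m + n)) :=
  if n = 0 then unit (idxFirst hm) (idxLast hmn) (idxFirst hm) (idxLast hmn)
  else symUnit (parity m n) (idxFirst hm) (idxPenult hmn) (idxLast hmn)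

theorem unit_mem_tracelessSym {I : Type*} [Fintype I] [DecidableEq I] {p : I → Fin 2} {z b : I}
    (hz : p z = 0) (hb : p b = 0) (hzb : z ≠ b) : unit z b z b ∈ tracelessSym p := by
  refine ⟨fun i j k l => ?_, fun i j k l => ?_, fun i j => ?_⟩
  · rw [unit_apply, unit_apply]
    by_cases h : z = i ∧ b = j ∧ z = k ∧ b = l
    · obtain ⟨rfl, rfl, rfl, rfl⟩ := h
      simp [rowSign, hz]
    · rw [if_neg h, if_neg (by tauto), mul_zero]
  · rw [unit_apply, unit_apply]
    by_cases h : z = i ∧ b = j ∧ z = k ∧ b = l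
    · obtain ⟨rfl, rfl, rfl, rfl⟩ := h
      simp [colSign, hz, hb]
    · rw [if_neg h, if_neg (by tauto), mul_zero]
  · refine Finset.sum_eq_zero fun k _ => ?_
    rw [unit_apply, if_neg (fun h => hzb (h.2.2.1.trans h.2.2.2.symm)), mul_zero]

theorem topVector_mem : topVector hmn hm ∈ tracelessSym (parity m n) := by
  rw [topVector]
  split_ifs with hn
  · subst hn
    have : ∀ i, parity m 0 i = 0 := fun i => by
      have := i.2
      simp only [add_zero] at this
      simp [parity, this]
    exact unit_mem_tracelessSym (this _) (this _) (idxFirst_ne_idxLast hmn hm)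
  · exact symUnit_mem_tracelessSym (parity_idxFirst hm) (idxFirst_ne_idxPenult hmn hm)
      (idxFirst_ne_idxLast hmn hm) (idxPenult_ne_idxLast hmn)

theorem topVector_ne_zero : topVector hmn hm ≠ 0 := by
  intro h
  rw [topVector] at h
  split_ifs at h with hn
  · have := congr_fun h (idxFirst hm, idxLast hmn, idxFirst hm, idxLast hmn)
    simp [unit_apply] at this
  · have := congr_fun h (idxFirst hm, idxPenult hmn, idxFirst hm, idxLast hmn)
    simp [symUnit, unit_apply, idxPenult_ne_idxLast hmn] at this

theorem actMat_topVector_of_isDiag {A : Mat m n} (hA : A.IsDiag) :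
    actMat A (topVector hmn hm) = cartanWeight m n A • topVector hmn hm := by
  have e0 : diagEntry m n A 0 = A (idxFirst hm) (idxFirst hm) := diagEntry_val A (idxFirst hm)
  have e1 : diagEntry m n A (m + n - 1) = A (idxLast hmn) (idxLast hmn) :=
    diagEntry_val A (idxLast hmn)
  have e2 : diagEntry m n A (m + n - 2) = A (idxPenult hmn) (idxPenult hmn) :=
    diagEntry_val A (idxPenult hmn)
  rw [topVector, cartanWeight, e0, e1, e2]
  split_ifs with hn
  · rw [actMat_unit_of_isDiag hA]
    congr 1
    ring
  · rw [symUnit, map_add, map_smul, actMat_unit_of_isDiag hA, actMat_unit_of_isDiag hA]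
    module

/-- In a vector of weight `2 ε_z - ε_a - ε_b`, the operator `E a b` cancels the contributions of
the two summands. -/
theorem act_symUnit {I : Type*} [Fintype I] [DecidableEq I] {p : I → Fin 2} {z a b : I}
    (hz : p z = 0) (hb : p b = 1) (hzb : z ≠ b) (hab : a ≠ b) :
    act p a b (symUnit p z a b) = 0 := by
  simp only [symUnit, map_add, map_smul, act_unit, if_neg hzb.symm, if_neg hab, if_true, hz, hb]
  generalize p a = x
  fin_cases x <;> simp [sg]

theorem act_topVector {c d : Fin (m + n)} (hcd : c < d) :
    act (parity m n) c d (topVector hmn hm) = 0 := by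
  have hN := two_lt_add hmn
  have hd : d ≠ idxFirst hm := by
    rintro rfl
    exact absurd (Fin.lt_def.1 hcd) (by simp [idxFirst])
  have hc : c ≠ idxLast hmn := by
    rintro rfl
    have := Fin.lt_def.1 hcd
    have := d.2
    simp only [idxLast] at *
    omega
  rw [topVector]
  split_ifs with hn
  · rw [act_unit, if_neg hd, if_neg hc, if_neg hd, if_neg hc]
    simp
  · by_cases hca : c = idxPenult hmn
    · have hdb : d = idxLast hmn := by
        subst hca
        have := Fin.lt_def.1 hcd
        have := d.2
        apply Fin.ext
        simp only [idxPenult, idxLast] at *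
        omega
      subst hca hdb
      exact act_symUnit (parity_idxFirst hm) (parity_idxLast hmn hn)
        (idxFirst_ne_idxLast hmn hm) (idxPenult_ne_idxLast hmn)
    · rw [symUnit, map_add, map_smul, act_unit, act_unit, if_neg hd, if_neg hc, if_neg hd,
        if_neg hca, if_neg hc]
      simp [hd, hca]

include hm in
theorem isCartanProjection_slProj : IsCartanProjection m n (slProj hmn) := by
  have hinj := coord_injective (sdim_ne_zero hmn)
  refine ⟨fun X => LinearMap.ext fun s => hinj ?_, LinearMap.ext fun s => hinj ?_, ?_⟩
  · rw [LinearMap.comp_apply, LinearMap.comp_apply, coord_slProj, coord_tensorAct,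
      coord_tensorAct, coord_slProj, symProj_actMat]
  · rw [LinearMap.comp_apply, coord_slProj, coord_slProj, symProj_of_mem hmn (symProj_mem hmn _)]
  · have htop : coord m n (ofCoord (sdim_ne_zero hmn) (topVector hmn hm)) = topVector hmn hm :=
      coord_ofCoord_of_mem _ (topVector_mem hmn hm)
    refine ⟨fun X s hs => ?_, ⟨ofCoord (sdim_ne_zero hmn) (topVector hmn hm), ?_, ?_, ?_, ?_⟩,
      fun W' hle hW' => eq_bot_or_eq_range_slProj hmn hm hW' hle⟩
    · rw [mem_range_slProj] at hs ⊢
      rw [coord_tensorAct]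
      exact (tracelessSym_stable (parity m n)).actMat_mem _ hs
    · rw [mem_range_slProj, htop]
      exact topVector_mem hmn hm
    · intro h
      rw [h, map_zero] at htop
      exact topVector_ne_zero hmn hm htop.symm
    · intro X hX
      apply hinj
      rw [coord_tensorAct, htop, map_zero, actMat_apply]
      refine Finset.sum_eq_zero fun a _ => Finset.sum_eq_zero fun b _ => ?_
      by_cases hab : b ≤ a
      · rw [hX a b hab, zero_smul]
      · rw [act_topVector hmn hm (not_le.1 hab), smul_zero]
    · intro H hH
      apply hinj
      rw [coord_tensorAct, htop, map_smul, htop]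
      exact actMat_topVector_of_isDiag hmn hm hH

theorem coord_slUnit_tmul (h : (m : ℂ) - n ≠ 0) {a b c d : Fin (m + n)} (hab : a ≠ b)
    (hcd : c ≠ d) : coord m n (slUnit h a b ⊗ₜ slUnit h c d) = unit a b c d := by
  ext ⟨i, j, k, l⟩
  rw [coord_tmul, slUnit_val, slUnit_val, unit_apply, if_neg hab, if_neg hcd, zero_mul, zero_mul,
    sub_zero, sub_zero, ite_mul, one_mul, zero_mul]
  simp only [ite_and]

theorem slUnit_isDiag (h : (m : ℂ) - n ≠ 0) (c : Fin (m + n)) : (slUnit h c c).val.IsDiag := by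
  intro i j hij
  rw [slUnit_val, if_neg hij, mul_zero, sub_zero, if_neg]
  rintro ⟨rfl, rfl⟩
  exact hij rfl

theorem cartanWeight_slUnit (c : Fin (m + n)) :
    cartanWeight m n (slUnit (sdim_ne_zero hmn) c c).val =
      2 * (if c = idxFirst hm then 1 else 0) - (if c = idxLast hmn then 1 else 0) -
        (if n = 0 then if c = idxLast hmn then 1 else 0
          else if c = idxPenult hmn then 1 else 0) := by
  have e0 (A : Mat m n) : diagEntry m n A 0 = A (idxFirst hm) (idxFirst hm) :=
    diagEntry_val A (idxFirst hm)
  have e1 (A : Mat m n) : diagEntry m n A (m + n - 1) = A (idxLast hmn) (idxLast hmn) :=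
    diagEntry_val A (idxLast hmn)
  have e2 (A : Mat m n) : diagEntry m n A (m + n - 2) = A (idxPenult hmn) (idxPenult hmn) :=
    diagEntry_val A (idxPenult hmn)
  rw [cartanWeight, e0, e1, e2, slUnit_val, slUnit_val, slUnit_val]
  simp only [and_self, if_true, mul_one]
  split_ifs <;> ring

include hmn hm in
/-- A highest weight vector of the weight of the Cartan product lies in the range of the
projection. -/
theorem coord_mem_of_isCartanHighestWeightVector {v : sl m n ⊗[ℂ] sl m n}
    (hv : IsCartanHighestWeightVector m n v) : coord m n v ∈ tracelessSym (parity m n) := by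
  have hza := idxFirst_ne_idxPenult hmn hm
  have hzb := idxFirst_ne_idxLast hmn hm
  have hab := idxPenult_ne_idxLast hmn
  have hD : ∀ c, act (parity m n) c c (coord m n v) =
      cartanWeight m n (slUnit (sdim_ne_zero hmn) c c).val • coord m n v := fun c => by
    rw [← coord_tensorAct_slUnit (sdim_ne_zero hmn), hv.weight _ (slUnit_isDiag _ c), map_smul]
  have hz := hD (idxFirst hm)
  have ha := hD (idxPenult hmn)
  have hb := hD (idxLast hmn)
  rw [cartanWeight_slUnit hmn hm] at hz ha hb
  rw [if_pos rfl, if_neg hzb, if_neg hza, ite_self] at hz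
  rw [if_neg hab, if_neg hza.symm, if_pos rfl] at ha
  rw [if_pos rfl, if_neg hzb.symm, if_neg hab.symm] at hb
  have hmem := topVector_mem hmn hm
  by_cases hn : n = 0
  · rw [if_pos hn] at hb
    have h1 := weightOp'_of_eigen (D := fun c => act (parity m n) c c) (v := coord m n v)
      (z := idxFirst hm) (b := idxLast hmn) (by rw [hz]; norm_num) (by rw [hb]; norm_num)
    rw [weightOp'_act hzb, mul_smul] at h1
    rw [topVector, if_pos hn] at hmem
    rw [← smul_right_injective _ (by norm_num : (48 : ℂ) ≠ 0) h1]
    exact Submodule.smul_mem _ _ hmem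
  · rw [if_neg hn] at ha hb
    have h1 := weightOp_of_eigen (D := fun c => act (parity m n) c c) (v := coord m n v)
      (z := idxFirst hm) (a := idxPenult hmn) (b := idxLast hmn) (by rw [hz]; norm_num)
      (by rw [ha]; norm_num) (by rw [hb]; norm_num)
    rw [weightOp_act hza hzb hab, mul_smul, mul_smul, ← smul_add] at h1
    have h2 := smul_right_injective _ (by norm_num : (24 : ℂ) ≠ 0) h1
    -- the weight space has dimension two; the raising operator of the last simple root singles
    -- out a line in it
    have h3 : act (parity m n) (idxPenult hmn) (idxLast hmn) (coord m n v) = 0 := by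
      rw [← coord_tensorAct_slUnit (sdim_ne_zero hmn), hv.upper, map_zero]
      intro i j hij
      rw [slUnit_val, if_neg hab, zero_mul, sub_zero, if_neg]
      rintro ⟨rfl, rfl⟩
      have := two_lt_add hmn
      simp only [idxPenult, idxLast, Fin.mk_le_mk] at hij
      omega
    have h4 := congr_fun h3 (idxFirst hm, idxLast hmn, idxFirst hm, idxLast hmn)
    rw [act_apply, if_neg hza, if_pos rfl, if_neg hza, if_pos rfl, parity_idxFirst,
      parity_idxLast hmn hn, Pi.zero_apply] at h4
    rw [topVector, if_neg hn, symUnit, parity_idxLast hmn hn] at hmem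
    have h5 : coord m n v (idxFirst hm, idxLast hmn, idxFirst hm, idxPenult hmn) =
        sg (parity m n (idxPenult hmn)) 1 *
          coord m n v (idxFirst hm, idxPenult hmn, idxFirst hm, idxLast hmn) := by
      revert h4
      generalize parity m n (idxPenult hmn) = x
      generalize coord m n v (idxFirst hm, idxLast hmn, idxFirst hm, idxPenult hmn) = X
      generalize coord m n v (idxFirst hm, idxPenult hmn, idxFirst hm, idxLast hmn) = Y
      intro h4
      fin_cases x
      · simp [sg] at h4 ⊢
        linear_combination h4
      · simp [sg] at h4 ⊢
        linear_combination -h4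
    rw [h5] at h2
    rw [← h2]
    convert Submodule.smul_mem _
      (coord m n v (idxFirst hm, idxPenult hmn, idxFirst hm, idxLast hmn)) hmem using 1
    module

/-- The statement `a - b = 0 ↔ a = b` for a module whose additive structure is only given as a
monoid. -/
theorem add_neg_one_smul_eq_zero_iff {V : Type*} [AddCommMonoid V] [Module ℂ V] {a b : V} :
    a + (-1 : ℂ) • b = 0 ↔ a = b := by
  have h0 : (-1 : ℂ) • b + b = 0 := by
    rw [← one_smul ℂ b, smul_smul, ← add_smul]
    norm_num
  refine ⟨fun h => ?_, fun h => ?_⟩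
  · rw [← add_zero a, ← h0, ← add_assoc, h, zero_add]
  · rw [h, add_comm, h0]

include hmn hm in
/-- An equivariant map that takes values in the Cartan product and vanishes on it is zero: it kills
the whole weight space of the highest weight. -/
theorem eq_zero_of_equivariant {f : sl m n ⊗[ℂ] sl m n →ₗ[ℂ] sl m n ⊗[ℂ] sl m n}
    (hf : ∀ X s, f (tensorAct m n X s) = tensorAct m n X (f s))
    (hrange : ∀ s, coord m n (f s) ∈ tracelessSym (parity m n))
    (hzero : ∀ s, coord m n s ∈ tracelessSym (parity m n) → f s = 0) : f = 0 := by
  have h0 := sdim_ne_zero hmn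
  have hinj := coord_injective h0
  have hza := idxFirst_ne_idxPenult hmn hm
  have hzb := idxFirst_ne_idxLast hmn hm
  have hab := idxPenult_ne_idxLast hmn
  have htop := coord_ofCoord_of_mem h0 (topVector_mem hmn hm)
  set v := ofCoord h0 (topVector hmn hm) with hv
  set D : Fin (m + n) → Module.End ℂ (sl m n ⊗[ℂ] sl m n) :=
    fun c => tensorAct m n (slUnit h0 c c) with hD
  have hcoordD : ∀ c s, coord m n (D c s) = act (parity m n) c c (coord m n s) := fun c s =>
    coord_tensorAct_slUnit h0 c c s
  have hfD : ∀ c s, f (D c s) = D c (f s) := fun c s => hf _ s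
  have hv0 : v ≠ 0 := fun h => by
    rw [h, map_zero] at htop
    exact topVector_ne_zero hmn hm htop.symm
  have hinv : IsInvariant m n (LinearMap.range f) := by
    rintro X _ ⟨s, rfl⟩
    exact ⟨_, hf X s⟩
  have hle : LinearMap.range f ≤ LinearMap.range (slProj hmn) := by
    rintro _ ⟨s, rfl⟩
    exact (mem_range_slProj hmn).2 (hrange s)
  rcases eq_bot_or_eq_range_slProj hmn hm hinv hle with h | h
  · exact LinearMap.range_eq_bot.1 h
  exfalso
  -- otherwise the highest weight vector `v` has a preimage `t`, which may be replaced by its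
  -- component of the same weight; but `f` kills the whole weight space
  have hvf : v ∈ LinearMap.range f := by
    rw [h, mem_range_slProj, htop]
    exact topVector_mem hmn hm
  obtain ⟨t, ht⟩ := hvf
  by_cases hn : n = 0
  · have h1 : weightOp' D (idxFirst hm) (idxLast hmn) v = (48 : ℂ) • v := by
      apply hinj
      rw [map_weightOp' hcoordD, htop, map_smul, htop, weightOp'_act hzb, topVector, if_pos hn]
      simp [unit_apply]
    have h2 : f (weightOp' D (idxFirst hm) (idxLast hmn) t) = 0 := by
      apply hzero
      have hmem := topVector_mem hmn hm
      rw [topVector, if_pos hn] at hmem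
      rw [map_weightOp' hcoordD, weightOp'_act hzb]
      exact Submodule.smul_mem _ _ hmem
    rw [map_weightOp' hfD, ht, h1] at h2
    exact hv0 ((smul_eq_zero_iff_right (by norm_num)).1 h2)
  · -- the vector `E z b ⊗ E z b`, whose weight occurs with multiplicity one
    set e := slUnit h0 (idxFirst hm) (idxLast hmn) ⊗ₜ[ℂ] slUnit h0 (idxFirst hm) (idxLast hmn)
      with he
    have hce : coord m n e = unit _ _ _ _ := coord_slUnit_tmul h0 hzb hzb
    -- `f e` is a multiple of `e`, and `f` is nilpotent
    have hfe : f e = 0 := by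
      have h1 : weightOp' D (idxFirst hm) (idxLast hmn) e = (48 : ℂ) • e := by
        apply hinj
        rw [map_weightOp' hcoordD, map_smul, hce, weightOp'_act hzb]
        simp [unit_apply]
      have h2 : ∃ c : ℂ, (48 : ℂ) • f e = c • e := by
        refine ⟨48 * coord m n (f e) (idxFirst hm, idxLast hmn, idxFirst hm, idxLast hmn),
          hinj ?_⟩
        rw [← map_smul, ← h1, map_weightOp' hfD, map_weightOp' hcoordD, weightOp'_act hzb,
          map_smul, hce]
      obtain ⟨c, hc⟩ := h2
      have h3 : f (f e) = 0 := hzero _ (hrange _)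
      have h4 := congr_arg f hc
      rw [map_smul, map_smul, h3, smul_zero] at h4
      rcases smul_eq_zero.1 h4.symm with h5 | h5
      · rw [h5, zero_smul] at hc
        exact (smul_eq_zero_iff_right (by norm_num)).1 hc
      · exact h5
    set u := slUnit h0 (idxFirst hm) (idxPenult hmn) ⊗ₜ[ℂ] slUnit h0 (idxFirst hm) (idxLast hmn)
    set u' := slUnit h0 (idxFirst hm) (idxLast hmn) ⊗ₜ[ℂ] slUnit h0 (idxFirst hm) (idxPenult hmn)
    have hcu : coord m n u = unit _ _ _ _ := coord_slUnit_tmul h0 hza hzb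
    have hcu' : coord m n u' = unit _ _ _ _ := coord_slUnit_tmul h0 hzb hza
    have hvu : v = u + sg (parity m n (idxPenult hmn)) 1 • u' := by
      apply hinj
      rw [htop, topVector, if_neg hn, symUnit, map_add, map_smul, hcu, hcu',
        parity_idxLast hmn hn]
    -- `v` and the image of `e` under a lowering operator span the weight space of `v`
    have heu : tensorAct m n (slUnit h0 (idxLast hmn) (idxPenult hmn)) e =
        sg (parity m n (idxPenult hmn)) 1 • u + (-1 : ℂ) • u' := by
      apply hinj
      rw [coord_tensorAct_slUnit, hce, map_add, map_smul, map_smul, hcu, hcu', act_unit,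
        if_neg hza.symm, if_pos rfl, if_neg hza.symm, if_pos rfl, parity_idxFirst, parity_idxLast hmn hn]
      generalize parity m n (idxPenult hmn) = x
      fin_cases x <;> simp [sg]
    have h1 : f u + sg (parity m n (idxPenult hmn)) 1 • f u' = 0 := by
      rw [← map_smul, ← map_add, ← hvu]
      exact hzero v (by rw [htop]; exact topVector_mem hmn hm)
    have h2 : sg (parity m n (idxPenult hmn)) 1 • f u + (-1 : ℂ) • f u' = 0 := by
      rw [← map_smul, ← map_smul, ← map_add, ← heu, hf, hfe, map_zero]
    have hu' : f u' = sg (parity m n (idxPenult hmn)) 1 • f u :=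
      (add_neg_one_smul_eq_zero_iff.1 h2).symm
    have hu : f u = 0 := by
      rw [hu', smul_smul, sg_mul_self, one_smul, ← two_smul ℂ] at h1
      exact (smul_eq_zero_iff_right (by norm_num)).1 h1
    rw [hu, smul_zero] at hu'
    have h3 : weightOp D (idxFirst hm) (idxPenult hmn) (idxLast hmn) v = (24 : ℂ) • v := by
      apply hinj
      rw [map_weightOp hcoordD, map_smul, weightOp_of_mem (htop ▸ topVector_mem hmn hm)
        (parity_idxFirst hm) hza hzb hab, htop, topVector, if_neg hn]
      congr 1
      simp [symUnit, unit_apply, hab.symm]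
    obtain ⟨c, c', hcc⟩ : ∃ c c' : ℂ, weightOp D (idxFirst hm) (idxPenult hmn) (idxLast hmn) t =
        c • u + c' • u' := by
      refine ⟨24 * coord m n t (idxFirst hm, idxPenult hmn, idxFirst hm, idxLast hmn),
        24 * coord m n t (idxFirst hm, idxLast hmn, idxFirst hm, idxPenult hmn), hinj ?_⟩
      rw [map_weightOp hcoordD, weightOp_act hza hzb hab, map_add, map_smul, map_smul, hcu, hcu']
    have h4 := congr_arg f hcc
    rw [map_weightOp hfD, ht, h3, map_add, map_smul, map_smul, hu, hu', smul_zero, smul_zero,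
      add_zero] at h4
    exact hv0 ((smul_eq_zero_iff_right (by norm_num)).1 h4)

include hm in
/-- The projection onto the Cartan product is unique. -/
theorem IsCartanProjection.eq_slProj {P : (sl m n ⊗[ℂ] sl m n) →ₗ[ℂ] (sl m n ⊗[ℂ] sl m n)}
    (hP : IsCartanProjection m n P) : P = slProj hmn := by
  have hS := isCartanProjection_slProj hmn hm
  have hPid : ∀ s ∈ LinearMap.range P, P s = s := by
    rintro _ ⟨s, rfl⟩
    exact LinearMap.congr_fun hP.idempotent s
  have hinf : IsInvariant m n (LinearMap.range P ⊓ LinearMap.range (slProj hmn)) := fun X s hs =>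
    ⟨hP.range.invariant X s hs.1, hS.range.invariant X s hs.2⟩
  obtain ⟨v, hv, hw⟩ := hP.range.highest
  have hne : LinearMap.range P ⊓ LinearMap.range (slProj hmn) ≠ ⊥ := fun h =>
    hw.ne_zero ((Submodule.eq_bot_iff _).1 h v ⟨hv, (mem_range_slProj hmn).2
      (coord_mem_of_isCartanHighestWeightVector hmn hm hw)⟩)
  have h1 := (hP.range.simple _ inf_le_left hinf).resolve_left hne
  have h2 := (hS.range.simple _ inf_le_right hinf).resolve_left hne
  have hR : LinearMap.range P = LinearMap.range (slProj hmn) := h1.symm.trans h2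
  have h0 : P + (-1 : ℂ) • slProj hmn = 0 := by
    refine eq_zero_of_equivariant hmn hm (fun X s => ?_) (fun s => ?_) (fun s hs => ?_)
    · have e1 := LinearMap.congr_fun (hP.equivariant X) s
      have e2 := LinearMap.congr_fun (hS.equivariant X) s
      simp only [LinearMap.comp_apply] at e1 e2
      rw [LinearMap.add_apply, LinearMap.add_apply, LinearMap.smul_apply, LinearMap.smul_apply,
        e1, e2, map_add, map_smul]
    · rw [← mem_range_slProj hmn, LinearMap.add_apply]
      exact add_mem (hR ▸ ⟨s, rfl⟩) (Submodule.smul_mem _ _ ⟨s, rfl⟩)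
    · rw [LinearMap.add_apply, LinearMap.smul_apply, slProj_of_mem hmn hs,
        hPid s (by rwa [hR, mem_range_slProj]), add_neg_one_smul_eq_zero_iff]
  refine LinearMap.ext fun s => ?_
  have h3 := LinearMap.congr_fun h0 s
  rw [LinearMap.add_apply, LinearMap.smul_apply] at h3
  exact add_neg_one_smul_eq_zero_iff.1 h3

include hm in
theorem cartanProjection_eq : cartanProjection m n = slProj hmn :=
  (Classical.epsilon_spec ⟨_, isCartanProjection_slProj hmn hm⟩ :
    IsCartanProjection m n (cartanProjection m n)).eq_slProj hmn hm

end Projection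

/-! ### The defining relations of the ideal -/

section Relations

variable {m n : ℕ}

/-- The superbracket as a linear map on `𝔤 ⊗ 𝔤`. -/
def bracketTensor (m n : ℕ) : sl m n ⊗[ℂ] sl m n →ₗ[ℂ] sl m n := TensorProduct.lift (bracket m n)

theorem killing_eq (X Y : sl m n) :
    killing m n X Y = 2 * ((m : ℂ) - n) * supertrace m n (X.val * Y.val) := by
  simp [killing, supertrace, Matrix.mul_apply, Finset.mul_sum]

/-- The Killing form as a linear form on `𝔤 ⊗ 𝔤`. -/
def killingTensor (m n : ℕ) : sl m n ⊗[ℂ] sl m n →ₗ[ℂ] ℂ :=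
  TensorProduct.lift <| LinearMap.mk₂ ℂ (killing m n)
    (fun X X' Y => by simp [killing_eq, add_mul, mul_add])
    (fun c X Y => by simp [killing_eq, mul_left_comm])
    (fun X Y Y' => by simp [killing_eq, mul_add])
    (fun c X Y => by simp [killing_eq, mul_left_comm])

theorem bracketTensor_tmul (X Y : sl m n) : bracketTensor m n (X ⊗ₜ Y) = bracket m n X Y := rfl

theorem killingTensor_tmul (X Y : sl m n) : killingTensor m n (X ⊗ₜ Y) = killing m n X Y := rfl

theorem bracketTensor_apply (s : sl m n ⊗[ℂ] sl m n) (i l : Fin (m + n)) :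
    (bracketTensor m n s).val i l = ∑ k, (coord m n s (i, k, k, l) -
      sg (parity m n i + parity m n k) (parity m n k + parity m n l) *
        coord m n s (k, l, i, k)) := by
  induction s using TensorProduct.induction_on with
  | zero => simp
  | tmul X Y =>
    rw [bracketTensor_tmul]
    refine (matBracket_apply _ _ _ _).trans (Finset.sum_congr rfl fun k _ => ?_)
    rw [coord_tmul, coord_tmul]
    ring
  | add s t hs ht =>
    rw [map_add, map_add, Submodule.coe_add, Matrix.add_apply, hs, ht, ← Finset.sum_add_distrib]
    refine Finset.sum_congr rfl fun k _ => ?_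
    rw [Pi.add_apply, Pi.add_apply]
    ring

theorem killingTensor_apply (s : sl m n ⊗[ℂ] sl m n) :
    killingTensor m n s = 2 * ((m : ℂ) - n) *
      ∑ i, sg (parity m n i) (parity m n i) * ∑ j, coord m n s (i, j, j, i) := by
  induction s using TensorProduct.induction_on with
  | zero => simp
  | tmul X Y =>
    rw [killingTensor_tmul, killing_eq, supertrace_apply]
    simp only [Matrix.mul_apply, coord_tmul]
  | add s t hs ht =>
    rw [map_add, map_add, hs, ht, ← mul_add, ← Finset.sum_add_distrib]
    congr 1
    refine Finset.sum_congr rfl fun k _ => ?_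
    simp only [Pi.add_apply, Finset.sum_add_distrib, mul_add]

theorem sum_middle_eq_zero {t : Coord (Fin (m + n))} (ht : t ∈ tracelessSym (parity m n))
    (i l : Fin (m + n)) : ∑ k, t (i, k, k, l) = 0 := by
  rw [← ht.2.2 i l]
  refine Finset.sum_congr rfl fun k _ => ?_
  rw [ht.2.1, colSign, mul_assoc (sg _ _), sg_mul_self, mul_one]

theorem sum_outer_eq_zero {t : Coord (Fin (m + n))} (ht : t ∈ tracelessSym (parity m n))
    (i l : Fin (m + n)) :
    ∑ k, sg (parity m n i + parity m n k) (parity m n k + parity m n l) * t (k, l, i, k) = 0 := by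
  rw [← ht.2.2 i l]
  refine Finset.sum_congr rfl fun k _ => ?_
  rw [ht.1, ← mul_assoc, rowSign]
  congr 1
  generalize parity m n i = x
  generalize parity m n k = y
  generalize parity m n l = z
  fin_cases x <;> fin_cases y <;> fin_cases z <;> simp [sg]

theorem bracketTensor_eq_zero {s : sl m n ⊗[ℂ] sl m n}
    (hs : coord m n s ∈ tracelessSym (parity m n)) : bracketTensor m n s = 0 := by
  ext i l
  rw [bracketTensor_apply, Finset.sum_sub_distrib, sum_middle_eq_zero hs, sum_outer_eq_zero hs,
    sub_zero]
  rfl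

theorem killingTensor_eq_zero {s : sl m n ⊗[ℂ] sl m n}
    (hs : coord m n s ∈ tracelessSym (parity m n)) : killingTensor m n s = 0 := by
  rw [killingTensor_apply]
  simp [sum_middle_eq_zero hs]

section Rel

variable {A : Type*} [Ring A] [Algebra ℂ A]

/-- The linear map `X ⊗ Y ↦ φ X * φ Y - ½ φ [X, Y] - lam ⟨X, Y⟩`, for a linear map `φ` from `𝔤` to
an algebra. -/
def rel (φ : sl m n →ₗ[ℂ] A) (lam : ℂ) : sl m n ⊗[ℂ] sl m n →ₗ[ℂ] A :=
  LinearMap.mul' ℂ A ∘ₗ TensorProduct.map φ φ - (1 / 2 : ℂ) • (φ ∘ₗ bracketTensor m n)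
    - lam • (Algebra.linearMap ℂ A ∘ₗ killingTensor m n)

theorem rel_apply (φ : sl m n →ₗ[ℂ] A) (lam : ℂ) (s : sl m n ⊗[ℂ] sl m n) :
    rel φ lam s = LinearMap.mul' ℂ A (TensorProduct.map φ φ s) -
      (1 / 2 : ℂ) • φ (bracketTensor m n s) - lam • algebraMap ℂ A (killingTensor m n s) := rfl

theorem rel_tmul (φ : sl m n →ₗ[ℂ] A) (lam : ℂ) (X Y : sl m n) :
    rel φ lam (X ⊗ₜ Y) = φ X * φ Y - (1 / 2 : ℂ) • φ (bracket m n X Y) -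
      (lam * killing m n X Y) • 1 := by
  rw [rel_apply, bracketTensor_tmul, killingTensor_tmul, TensorProduct.map_tmul,
    LinearMap.mul'_apply, mul_smul, Algebra.algebraMap_eq_smul_one]

theorem map_rel {B : Type*} [Ring B] [Algebra ℂ B] (Φ : A →ₐ[ℂ] B) (φ : sl m n →ₗ[ℂ] A) (lam : ℂ)
    (s : sl m n ⊗[ℂ] sl m n) : Φ (rel φ lam s) = rel (Φ.toLinearMap ∘ₗ φ) lam s := by
  induction s using TensorProduct.induction_on with
  | zero => simp
  | tmul X Y => simp [rel_tmul]
  | add s t hs ht => simp [hs, ht]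

theorem bracket_toSl (h : (m : ℂ) - n ≠ 0) (A B : Mat m n) :
    bracket m n (toSl h A) (toSl h B) = toSl h (matBracket m n A B) := by
  ext i j
  change matBracket m n (toSl h A).val (toSl h B).val i j = _
  have h1 : ∀ C : Mat m n, matBracket m n 1 C = 0 := fun C => by
    ext i j
    have e : ∀ x : Fin 2, x + x = 0 := by decide
    simp [matBracket_apply, Matrix.one_apply, Finset.sum_sub_distrib, e]
  have h2 : ∀ C : Mat m n, matBracket m n C 1 = 0 := fun C => by
    ext i j
    have e : ∀ x : Fin 2, x + x = 0 := by decide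
    simp [matBracket_apply, Matrix.one_apply, Finset.sum_sub_distrib, e]
  rw [toSl_val, toSl_val, toSl_val, supertrace_matBracket, zero_div, zero_smul, sub_zero, map_sub,
    map_sub, LinearMap.sub_apply, LinearMap.sub_apply, map_smul, map_smul, map_smul,
    LinearMap.smul_apply, LinearMap.smul_apply, h1, h2, h1]
  simp

theorem matBracket_single (i j k l : Fin (m + n)) :
    matBracket m n (Matrix.single i j 1) (Matrix.single k l 1) =
      (if j = k then Matrix.single i l 1 else 0) -
        sg (parity m n i + parity m n j) (parity m n k + parity m n l) •
          (if i = l then Matrix.single k j 1 else 0) := by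
  ext a b
  rw [matBracket_apply, Finset.sum_sub_distrib]
  congr 1
  · rw [← Matrix.mul_apply]
    split_ifs with h
    · rw [h, Matrix.single_mul_single_same, one_mul]
    · rw [Matrix.single_mul_single_of_ne _ _ _ _ h]
  · rw [Matrix.smul_apply, smul_eq_mul, sg_comm]
    split_ifs with h
    · subst h
      rw [Finset.sum_eq_single i]
      · by_cases ha : k = a
        · by_cases hb : j = b
          · subst ha hb
            rw [sg_comm]
            simp
          · simp [hb]
        · simp [ha]
      · intro c _ hc
        simp [hc.symm]
      · simp
    · rw [Matrix.zero_apply, mul_zero]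
      refine Finset.sum_eq_zero fun c _ => ?_
      rw [Matrix.single_apply, Matrix.single_apply]
      split_ifs with h1 h2
      · exact absurd (h2.1.trans h1.2.symm) h
      all_goals simp

theorem killing_toSl (h : (m : ℂ) - n ≠ 0) (A B : Mat m n) :
    killing m n (toSl h A) (toSl h B) = 2 * ((m : ℂ) - n) * supertrace m n (A * B) -
      2 * (supertrace m n A * supertrace m n B) := by
  rw [killing_eq, toSl_val, toSl_val, sub_mul, mul_sub, mul_sub]
  simp only [smul_mul_assoc, mul_smul_comm, one_mul, mul_one, map_sub, map_smul, smul_eq_mul,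
    supertrace_one]
  field_simp
  ring

theorem supertrace_single (i j : Fin (m + n)) : supertrace m n (Matrix.single i j 1) =
    if i = j then sg (parity m n i) (parity m n i) else 0 := by
  rw [supertrace_apply]
  simp [Matrix.single_apply, ite_and, eq_comm]

theorem rel_slUnit (h : (m : ℂ) - n ≠ 0) (φ : sl m n →ₗ[ℂ] A) (lam : ℂ) (i j k l : Fin (m + n)) :
    rel φ lam (slUnit h i j ⊗ₜ slUnit h k l) = φ (slUnit h i j) * φ (slUnit h k l) -
      (1 / 2 : ℂ) • ((if j = k then φ (slUnit h i l) else 0) -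
        sg (parity m n i + parity m n j) (parity m n k + parity m n l) •
          (if i = l then φ (slUnit h k j) else 0)) -
      (2 * lam * (((m : ℂ) - n) * (if j = k ∧ i = l then sg (parity m n i) (parity m n i) else 0) -
        if i = j ∧ k = l then sg (parity m n i) (parity m n i) * sg (parity m n k) (parity m n k)
          else 0)) • 1 := by
  rw [rel_tmul, slUnit, slUnit, bracket_toSl, matBracket_single, killing_toSl,
    map_sub, map_smul, map_sub, map_smul, supertrace_single, supertrace_single]
  congr 2
  · congr 2
    · split_ifs
      · rfl
      · exact (congrArg φ (map_zero _)).trans (map_zero _)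
    · congr 1
      split_ifs
      · rfl
      · exact (congrArg φ (map_zero _)).trans (map_zero _)
  · by_cases hjk : j = k
    · subst hjk
      rw [Matrix.single_mul_single_same, one_mul, supertrace_single]
      split_ifs <;> simp_all <;> ring
    · rw [Matrix.single_mul_single_of_ne _ _ _ _ hjk]
      split_ifs <;> simp_all
      ring

end Rel

section Ideal

variable (hm : 1 ≤ m) (hmn : 2 < |(m : ℤ) - (n : ℤ)|) (lam : ℂ)

include hm in
/-- Since the bracket and the Killing form vanish on the Cartan product, the ideal is generated by
the images of the elements of the kernel of the projection. -/
theorem tensorIdeal_generator (X Y : sl m n) :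
    TensorAlgebra.ι ℂ X * TensorAlgebra.ι ℂ Y - incl₂ m n (cartanProduct m n X Y)
        - (1 / 2 : ℂ) • TensorAlgebra.ι ℂ (bracket m n X Y)
        - algebraMap ℂ (T m n) (lam * killing m n X Y) =
      rel (TensorAlgebra.ι ℂ) lam (X ⊗ₜ Y + (-1 : ℂ) • slProj hmn (X ⊗ₜ Y)) := by
  have hmem : coord m n (slProj hmn (X ⊗ₜ Y)) ∈ tracelessSym (parity m n) := by
    rw [coord_slProj]
    exact symProj_mem hmn _
  rw [map_add, map_smul, rel_tmul, rel_apply _ _ (slProj hmn _), bracketTensor_eq_zero hmem,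
    killingTensor_eq_zero hmem, cartanProduct, cartanProjection_eq hmn hm, map_zero, map_zero,
    smul_zero, smul_zero, sub_zero, sub_zero, Algebra.algebraMap_eq_smul_one, incl₂,
    LinearMap.comp_apply, neg_one_smul]
  abel

theorem slProj_ofCoord {t : Coord (Fin (m + n))} (ht : t ∈ antisymTrace (parity m n)) :
    slProj hmn (ofCoord (sdim_ne_zero hmn) t) = 0 := by
  rw [slProj, LinearMap.comp_apply, LinearMap.comp_apply, (symProj_eq_zero_iff hmn).2, map_zero]
  have h1 := add_mem (coord_ofCoord_sub_mem (sdim_ne_zero hmn) t) ht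
  rwa [sub_add_cancel] at h1

include hm in
theorem rel_mem_J {t : Coord (Fin (m + n))} (ht : t ∈ antisymTrace (parity m n)) :
    rel (ιU m n) lam (ofCoord (sdim_ne_zero hmn) t) ∈ J m n lam := by
  have key : ∀ s : sl m n ⊗[ℂ] sl m n,
      rel (TensorAlgebra.ι ℂ) lam (s + (-1 : ℂ) • slProj hmn s) ∈ tensorIdeal m n lam := by
    intro s
    induction s using TensorProduct.induction_on with
    | zero => simp
    | tmul X Y =>
      exact TwoSidedIdeal.subset_span ⟨X, Y, (tensorIdeal_generator hm hmn lam X Y).symm⟩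
    | add s t hs ht =>
      rw [map_add (slProj hmn), smul_add, add_add_add_comm, map_add]
      exact add_mem hs ht
  have h1 := key (ofCoord (sdim_ne_zero hmn) t)
  rw [slProj_ofCoord hmn ht, smul_zero, add_zero] at h1
  have h2 := map_rel (toU m n) (TensorAlgebra.ι ℂ) lam (ofCoord (sdim_ne_zero hmn) t)
  rw [ιU, ← h2]
  exact TwoSidedIdeal.subset_span ⟨_, h1, rfl⟩

include hm in
/-- An algebra homomorphism that satisfies the antisymmetrized relations kills the ideal. -/
theorem J_le_ker {A : Type*} [Ring A] [Algebra ℂ A] (Φ : U m n →ₐ[ℂ] A)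
    (hrow : ∀ i j k l, rel (Φ.toLinearMap ∘ₗ ιU m n) lam (ofCoord (sdim_ne_zero hmn)
      (unit i j k l - rowSign (parity m n) i j k • unit k j i l)) = 0)
    (hcol : ∀ i j k l, rel (Φ.toLinearMap ∘ₗ ιU m n) lam (ofCoord (sdim_ne_zero hmn)
      (unit i j k l - colSign (parity m n) j k l • unit i l k j)) = 0) :
    J m n lam ≤ TwoSidedIdeal.ker Φ := by
  have hK : ∀ t ∈ antisymTrace (parity m n),
      rel (Φ.toLinearMap ∘ₗ ιU m n) lam (ofCoord (sdim_ne_zero hmn) t) = 0 := by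
    intro t ht
    have : antisymTrace (parity m n) ≤
        LinearMap.ker (rel (Φ.toLinearMap ∘ₗ ιU m n) lam ∘ₗ ofCoord (sdim_ne_zero hmn)) := by
      rw [antisymTrace, Submodule.span_le]
      rintro _ ((⟨x, rfl⟩ | ⟨x, rfl⟩) | ⟨A, rfl⟩)
      · exact hrow _ _ _ _
      · exact hcol _ _ _ _
      · rw [SetLike.mem_coe, LinearMap.mem_ker, LinearMap.comp_apply]
        have h0 : ofCoord (sdim_ne_zero hmn) (tensorOne A) = 0 := by
          rw [ofCoord_apply]
          have h1 : ∑ k, slUnit (sdim_ne_zero hmn) k k = 0 := by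
            have := sum_smul_slUnit (sdim_ne_zero hmn) 1
            rw [toSl_one] at this
            simpa [Matrix.one_apply, ite_smul] using this
          refine Finset.sum_eq_zero fun i _ => Finset.sum_eq_zero fun j _ => ?_
          simp only [tensorOne_apply, ite_smul, zero_smul, Finset.sum_ite_eq, Finset.mem_univ,
            if_true]
          rw [← Finset.smul_sum, ← TensorProduct.tmul_sum, h1, TensorProduct.tmul_zero, smul_zero]
        rw [h0, map_zero]
    exact this ht
  have h0 : tensorIdeal m n lam ≤ TwoSidedIdeal.ker (Φ.comp (toU m n)) := by
    refine TwoSidedIdeal.span_le.2 ?_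
    rintro _ ⟨X, Y, rfl⟩
    rw [tensorIdeal_generator hm hmn, SetLike.mem_coe, TwoSidedIdeal.mem_ker, map_rel]
    have h2 : coord m n (X ⊗ₜ Y + (-1 : ℂ) • slProj hmn (X ⊗ₜ Y)) ∈ antisymTrace (parity m n) := by
      rw [map_add, map_smul, coord_slProj, neg_one_smul, ← sub_eq_add_neg]
      exact sub_symProj_mem hmn _
    have h3 := hK _ h2
    rw [ofCoord_coord] at h3
    exact h3
  refine TwoSidedIdeal.span_le.2 ?_
  rintro _ ⟨t, ht, rfl⟩
  exact (TwoSidedIdeal.mem_ker _).2 ((TwoSidedIdeal.mem_ker (Φ.comp (toU m n))).1 (h0 ht))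

end Ideal

end Relations

/-! ### Consequences of the relations for three indices of the same parity -/

section Triple

variable {A : Type*} [Ring A] {e11 e22 e12 e21 e13 e23 K : A}

/-- Two evaluations of `E₂₁ E₁₂ E₂₃` for three even indices. -/
theorem mul_eq_zero_of_even (h1 : 2 * (e11 * e22 - e21 * e12) = e11 - e22 - 2 * K)
    (h2 : 2 * (e21 * e13) = (2 * e11 + 1) * e23) (h3 : 2 * (e12 * e23) = (2 * e22 + 1) * e13)
    (hc : e21 * e22 = e22 * e21 - e21) (hd : e11 * e22 = e22 * e11) : (4 * K + 1) * e23 = 0 := by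
  linear_combination (norm := noncomm_ring) 2 * h1 * e23 + 2 * e21 * h3 + 4 * hc * e13
    + (2 * e22 - 1) * h2 - 4 * hd * e23

/-- Two evaluations of `E₂₁ E₁₂ E₂₃` for three odd indices. -/
theorem mul_eq_zero_of_odd (h1 : 2 * (e11 * e22 + e21 * e12) = e22 - e11 - 2 * K)
    (h2 : 2 * (e21 * e13) = (1 - 2 * e11) * e23) (h3 : 2 * (e12 * e23) = (1 - 2 * e22) * e13)
    (hc : e21 * e22 = e22 * e21 - e21) (hd : e11 * e22 = e22 * e11)
    (h4 : 2 * (e22 * e23) = e23) : (4 * K + 1) * e23 = 0 := by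
  linear_combination (norm := noncomm_ring) 2 * h1 * e23 - 2 * e21 * h3 + 4 * hc * e13
    + (2 * e22 - 3) * h2 + 4 * hd * e23 - 4 * e11 * h4 + 2 * h4

end Triple

section Enveloping

variable {m n : ℕ}

theorem slUnit_isHomogeneous (h : (m : ℂ) - n ≠ 0) (i j : Fin (m + n)) :
    IsHomogeneous m n (parity m n i + parity m n j) (slUnit h i j) := by
  intro a b hab
  rw [slUnit_val] at hab
  by_cases h1 : i = a ∧ j = b
  · rw [h1.1, h1.2]
  · rw [if_neg h1] at hab
    by_cases h2 : i = j
    · by_cases h3 : a = b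
      · have e : ∀ x : Fin 2, x + x = 0 := by decide
        rw [h2, h3, e, e]
      · simp [h3] at hab
    · simp [h2] at hab

theorem ιU_comm {a b : Fin 2} {X Y : sl m n} (hX : IsHomogeneous m n a X)
    (hY : IsHomogeneous m n b Y) :
    ιU m n X * ιU m n Y - sg a b • (ιU m n Y * ιU m n X) = ιU m n (bracket m n X Y) := by
  have := RingQuot.mkAlgHom_rel ℂ (EnvRel.super_comm a b X Y hX hY)
  rw [map_sub, map_smul, map_mul, map_mul] at this
  exact this

theorem map_bracket_slUnit {V : Type*} [AddCommGroup V] [Module ℂ V] (h : (m : ℂ) - n ≠ 0)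
    (φ : sl m n →ₗ[ℂ] V) (i j k l : Fin (m + n)) :
    φ (bracket m n (slUnit h i j) (slUnit h k l)) = (if j = k then φ (slUnit h i l) else 0) -
      sg (parity m n i + parity m n j) (parity m n k + parity m n l) •
        (if i = l then φ (slUnit h k j) else 0) := by
  rw [slUnit, slUnit, bracket_toSl, matBracket_single]
  change (φ ∘ₗ toSl h) _ = _
  rw [map_sub, map_smul, apply_ite (φ ∘ₗ toSl h), apply_ite (φ ∘ₗ toSl h), map_zero]
  rfl

/-- The universal property of `U(𝔤)`. -/
def liftU {A : Type*} [Ring A] [Algebra ℂ A] (φ : sl m n →ₗ[ℂ] A)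
    (hφ : ∀ a b X Y, IsHomogeneous m n a X → IsHomogeneous m n b Y →
      φ X * φ Y - sg a b • (φ Y * φ X) = φ (bracket m n X Y)) : U m n →ₐ[ℂ] A :=
  RingQuot.liftAlgHom ℂ ⟨TensorAlgebra.lift ℂ φ, by
    rintro _ _ ⟨a, b, X, Y, hX, hY⟩
    rw [map_sub, map_smul, map_mul, map_mul, TensorAlgebra.lift_ι_apply, TensorAlgebra.lift_ι_apply,
      TensorAlgebra.lift_ι_apply]
    exact hφ a b X Y hX hY⟩

theorem liftU_ιU {A : Type*} [Ring A] [Algebra ℂ A] (φ : sl m n →ₗ[ℂ] A)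
    (hφ : ∀ a b X Y, IsHomogeneous m n a X → IsHomogeneous m n b Y →
      φ X * φ Y - sg a b • (φ Y * φ X) = φ (bracket m n X Y)) (X : sl m n) :
    liftU φ hφ (ιU m n X) = φ X :=
  (RingQuot.liftAlgHom_mkAlgHom_apply _ _ _ _).trans (TensorAlgebra.lift_ι_apply _ _)

theorem U_induction {C : U m n → Prop} (scalar : ∀ r : ℂ, C (algebraMap ℂ _ r))
    (basic : ∀ X, C (ιU m n X)) (mul : ∀ x y, C x → C y → C (x * y))
    (add : ∀ x y, C x → C y → C (x + y)) (x : U m n) : C x := by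
  obtain ⟨t, rfl⟩ := RingQuot.mkAlgHom_surjective ℂ (EnvRel m n) x
  induction t using TensorAlgebra.induction with
  | algebraMap r => rw [AlgHom.commutes]; exact scalar r
  | ι X => exact basic X
  | mul a b ha hb => rw [map_mul]; exact mul _ _ ha hb
  | add a b ha hb => rw [map_add]; exact add _ _ ha hb

theorem map_comm {A : Type*} [Ring A] [Algebra ℂ A] (Φ : U m n →ₐ[ℂ] A) {a b : Fin 2} {X Y : sl m n}
    (hX : IsHomogeneous m n a X) (hY : IsHomogeneous m n b Y) :
    (Φ.toLinearMap ∘ₗ ιU m n) X * (Φ.toLinearMap ∘ₗ ιU m n) Y -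
      sg a b • ((Φ.toLinearMap ∘ₗ ιU m n) Y * (Φ.toLinearMap ∘ₗ ιU m n) X) =
      (Φ.toLinearMap ∘ₗ ιU m n) (bracket m n X Y) := by
  simp only [LinearMap.comp_apply, AlgHom.toLinearMap_apply, ← ιU_comm hX hY, map_sub, map_mul,
    map_smul]

theorem map_comm_slUnit {A : Type*} [Ring A] [Algebra ℂ A] (Φ : U m n →ₐ[ℂ] A)
    (h : (m : ℂ) - n ≠ 0) (i j k l : Fin (m + n)) :
    (Φ.toLinearMap ∘ₗ ιU m n) (slUnit h i j) * (Φ.toLinearMap ∘ₗ ιU m n) (slUnit h k l) -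
      sg (parity m n i + parity m n j) (parity m n k + parity m n l) •
        ((Φ.toLinearMap ∘ₗ ιU m n) (slUnit h k l) * (Φ.toLinearMap ∘ₗ ιU m n) (slUnit h i j)) =
      (if j = k then (Φ.toLinearMap ∘ₗ ιU m n) (slUnit h i l) else 0) -
        sg (parity m n i + parity m n j) (parity m n k + parity m n l) •
          (if i = l then (Φ.toLinearMap ∘ₗ ιU m n) (slUnit h k j) else 0) := by
  rw [map_comm Φ (slUnit_isHomogeneous h i j) (slUnit_isHomogeneous h k l), map_bracket_slUnit]

variable (hm : 1 ≤ m) (hmn : 2 < |(m : ℤ) - (n : ℤ)|) {lam : ℂ}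
  {A : Type*} [Ring A] [Algebra ℂ A] {Φ : U m n →ₐ[ℂ] A} (hJ : J m n lam ≤ TwoSidedIdeal.ker Φ)

include hm hJ

theorem rel_row (i j k l : Fin (m + n)) :
    rel (Φ.toLinearMap ∘ₗ ιU m n) lam
      (slUnit (sdim_ne_zero hmn) i j ⊗ₜ slUnit (sdim_ne_zero hmn) k l) =
    rowSign (parity m n) i j k • rel (Φ.toLinearMap ∘ₗ ιU m n) lam
      (slUnit (sdim_ne_zero hmn) k j ⊗ₜ slUnit (sdim_ne_zero hmn) i l) := by
  have h1 := (TwoSidedIdeal.mem_ker Φ).1 (hJ (rel_mem_J hm hmn lam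
    (row_mem_antisymTrace (parity m n) i j k l)))
  rw [map_rel, map_sub, map_sub, map_smul, map_smul, ofCoord_unit, ofCoord_unit] at h1
  exact sub_eq_zero.1 h1

/-- For distinct indices `x, y, z` of the same parity, `E y z` vanishes in the quotient unless `lam`
is critical. If all of `𝔤` vanishes in the quotient, a relation reduces to its constant term
`2 lam (m - n + 1)`. -/
theorem triple_relations {x y z : Fin (m + n)} (hxy : x ≠ y) (hxz : x ≠ z) (hyz : y ≠ z)
    (hp : parity m n x = parity m n y) (hp' : parity m n x = parity m n z) :
    (8 * lam * ((m : ℂ) - n + 1) + 1) • Φ (ιU m n (slUnit (sdim_ne_zero hmn) y z)) = 0 ∧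
    ((∀ X, Φ (ιU m n X) = 0) → (2 * lam * ((m : ℂ) - n + 1)) • (1 : A) = 0) := by
  have h0 := sdim_ne_zero hmn
  have r1 := rel_row hm hmn hJ x x y y
  have r2 := rel_row hm hmn hJ y x x z
  have r3 := rel_row hm hmn hJ x y y z
  have r4 := rel_row hm hmn hJ y y y z
  have c1 := map_comm_slUnit Φ h0 y x y y
  have c2 := map_comm_slUnit Φ h0 x x y y
  have e0 : ∀ u : Fin 2, u + u = 0 := by decide
  simp only [rel_slUnit, rowSign, ← hp, ← hp', hxy, hxz, hyz, hxy.symm, e0,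
    sg_zero_left, and_false, and_self,
    if_true, if_false, one_smul, smul_zero, mul_zero, sub_zero, zero_sub, zero_smul]
    at r1 r2 r3 r4 c1 c2
  change _ • (Φ.toLinearMap ∘ₗ ιU m n) (slUnit h0 y z) = 0 ∧
    ((∀ X, (Φ.toLinearMap ∘ₗ ιU m n) X = 0) → _)
  generalize Φ.toLinearMap ∘ₗ ιU m n = φ at *
  have two : ∀ w : A, 2 * w = (2 : ℂ) • w := fun w => by rw [two_smul, two_mul]
  have four : ∀ w : A, 4 * w = (4 : ℂ) • w := fun w => by
    rw [← Nat.cast_ofNat, ← Nat.cast_ofNat (R := ℂ), Nat.cast_smul_eq_nsmul, nsmul_eq_mul]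
  generalize parity m n x = q at *
  fin_cases q
  all_goals
    simp only [sg, mul_one] at r1 r2 r3 r4
  · refine ⟨?_, fun hz => ?_⟩
    · have key := mul_eq_zero_of_even (K := (2 * lam * ((m : ℂ) - n + 1)) • (1 : A))
        (e11 := φ (slUnit h0 x x)) (e22 := φ (slUnit h0 y y)) (e12 := φ (slUnit h0 x y))
        (e21 := φ (slUnit h0 y x)) (e13 := φ (slUnit h0 x z)) (e23 := φ (slUnit h0 y z))
        (by rw [two, two]; linear_combination (norm := module) (2 : ℂ) • r1)
        (by rw [add_mul, mul_assoc, one_mul, two, two]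
            linear_combination (norm := module) (2 : ℂ) • r2)
        (by rw [add_mul, mul_assoc, one_mul, two, two]
            linear_combination (norm := module) (2 : ℂ) • r3)
        (by linear_combination (norm := module) c1)
        (by linear_combination (norm := module) c2)
      rw [add_mul, mul_assoc, one_mul, smul_mul_assoc, one_mul, four] at key
      linear_combination (norm := module) key
    · simp only [hz, mul_zero] at r1
      linear_combination (norm := module) r1
  · refine ⟨?_, fun hz => ?_⟩
    · have key := mul_eq_zero_of_odd (K := (2 * lam * ((m : ℂ) - n + 1)) • (1 : A))
        (e11 := φ (slUnit h0 x x)) (e22 := φ (slUnit h0 y y)) (e12 := φ (slUnit h0 x y))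
        (e21 := φ (slUnit h0 y x)) (e13 := φ (slUnit h0 x z)) (e23 := φ (slUnit h0 y z))
        (by rw [two, two]; linear_combination (norm := module) (2 : ℂ) • r1)
        (by rw [sub_mul, mul_assoc, one_mul, two, two]
            linear_combination (norm := module) (2 : ℂ) • r2)
        (by rw [sub_mul, mul_assoc, one_mul, two, two]
            linear_combination (norm := module) (2 : ℂ) • r3)
        (by linear_combination (norm := module) c1)
        (by linear_combination (norm := module) c2)
        (by rw [two]; linear_combination (norm := module) r4)
      rw [add_mul, mul_assoc, one_mul, smul_mul_assoc, one_mul, four] at key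
      linear_combination (norm := module) key
    · simp only [hz, mul_zero] at r1
      linear_combination (norm := module) r1

omit hm hJ in
/-- The kernel of a homomorphism from `𝔤` contains `[X, Y]` if it contains a homogeneous `X` and
`Y` is homogeneous; hence it is all of `𝔤` as soon as it contains one matrix unit. -/
theorem map_ιU_eq_zero {x y : Fin (m + n)}
    (h : Φ (ιU m n (slUnit (sdim_ne_zero hmn) x y)) = 0) (X : sl m n) : Φ (ιU m n X) = 0 := by
  have h0 := sdim_ne_zero hmn
  have row : ∀ {a b c : Fin (m + n)}, c ≠ a → Φ (ιU m n (slUnit h0 a b)) = 0 →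
      Φ (ιU m n (slUnit h0 a c)) = 0 := by
    intro a b c hc hab
    have h1 := map_comm_slUnit Φ h0 a b b c
    simp only [LinearMap.comp_apply, AlgHom.toLinearMap_apply, hab, if_true, if_neg hc.symm] at h1
    simpa using h1.symm
  have col : ∀ {a b c : Fin (m + n)}, c ≠ b → Φ (ιU m n (slUnit h0 a b)) = 0 →
      Φ (ιU m n (slUnit h0 c b)) = 0 := by
    intro a b c hc hab
    have h1 := map_comm_slUnit Φ h0 a b c a
    simp only [LinearMap.comp_apply, AlgHom.toLinearMap_apply, hab, if_true, if_neg hc.symm] at h1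
    simpa using h1.symm
  have off : ∀ a b, a ≠ b → Φ (ιU m n (slUnit h0 a b)) = 0 := by
    intro a b hab
    obtain ⟨c, hca, hcx⟩ : ∃ c : Fin (m + n), c ≠ a ∧ c ≠ x := by
      by_contra! hc
      have h2 : (Finset.univ : Finset (Fin (m + n))) ⊆ {a, x} := fun c _ => by
        by_cases hca : c = a
        · simp [hca]
        · simp [hc c hca]
      have h3 := (Finset.card_le_card h2).trans Finset.card_le_two
      rw [Finset.card_univ, Fintype.card_fin] at h3
      exact absurd (two_lt_add hmn) (not_lt.2 h3)
    exact row hab.symm (col hca.symm (row hcx h))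
  have diag : ∀ a b, Φ (ιU m n (slUnit h0 a a)) =
      (sg (parity m n a) (parity m n a) * sg (parity m n b) (parity m n b)) •
        Φ (ιU m n (slUnit h0 b b)) := by
    intro a b
    by_cases hab : a = b
    · rw [hab, sg_mul_self, one_smul]
    have h1 := map_comm_slUnit Φ h0 a b b a
    simp only [LinearMap.comp_apply, AlgHom.toLinearMap_apply, off a b hab, if_true] at h1
    rw [zero_mul, mul_zero, smul_zero, sub_zero] at h1
    rw [sub_eq_zero.1 h1.symm]
    congr 1
    generalize parity m n a = u
    generalize parity m n b = v
    fin_cases u <;> fin_cases v <;> simp [sg]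
  have diag0 : ∀ b, Φ (ιU m n (slUnit h0 b b)) = 0 := by
    intro b
    have h1 : ∑ a, slUnit h0 a a = 0 := by
      have := sum_smul_slUnit h0 1
      rw [toSl_one] at this
      simpa [Matrix.one_apply, ite_smul] using this
    have h2 : ∑ a, Φ (ιU m n (slUnit h0 a a)) = 0 := by
      rw [← map_sum, ← map_sum, h1, map_zero, map_zero]
    rw [Finset.sum_congr rfl fun a _ => diag a b, ← Finset.sum_smul, ← Finset.sum_mul] at h2
    change (sdim (parity m n) * _) • _ = (0 : A) at h2
    rw [sdim_parity] at h2
    exact (smul_eq_zero_iff_right (mul_ne_zero h0 (sg_ne_zero _ _))).1 h2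
  rw [← toSl_coe h0 X, ← sum_smul_slUnit]
  simp only [map_sum, map_smul]
  refine Finset.sum_eq_zero fun a _ => Finset.sum_eq_zero fun b _ => ?_
  by_cases hab : a = b
  · rw [hab, diag0, smul_zero]
  · rw [off a b hab, smul_zero]

omit hm hJ in
include hmn in
/-- One of `m` and `n` is at least three. -/
theorem exists_three_of_same_parity : ∃ x y z : Fin (m + n), x ≠ y ∧ x ≠ z ∧ y ≠ z ∧
    parity m n x = parity m n y ∧ parity m n x = parity m n z := by
  rcases le_total (m : ℤ) n with h | h
  · rw [abs_of_nonpos (by linarith)] at hmn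
    refine ⟨⟨m, by omega⟩, ⟨m + 1, by omega⟩, ⟨m + 2, by omega⟩, ?_⟩
    simp [parity]
  · rw [abs_of_nonneg (by linarith)] at hmn
    refine ⟨⟨0, by omega⟩, ⟨1, by omega⟩, ⟨2, by omega⟩, ?_⟩
    have h0 : 0 < m := by omega
    have h1 : 1 < m := by omega
    have h2 : 2 < m := by omega
    simp [parity, h0, h1, h2]

include hmn in
theorem map_ιU_eq_zero_of_ne (hlam : lam ≠ criticalValue m n) (X : sl m n) :
    Φ (ιU m n X) = 0 := by
  obtain ⟨x, y, z, hxy, hxz, hyz, hp, hp'⟩ := exists_three_of_same_parity hmn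
  refine map_ιU_eq_zero (x := y) (y := z) hmn ?_ X
  refine (smul_eq_zero_iff_right ?_).1 (triple_relations hm hmn hJ hxy hxz hyz hp hp').1
  intro h
  apply hlam
  have h1 := sdim_add_one_ne_zero hmn
  rw [criticalValue]
  field_simp
  linear_combination h

include hmn in
theorem one_eq_zero_of_ne (hlam : lam ≠ criticalValue m n) (hlam0 : lam ≠ 0) : (1 : A) = 0 := by
  obtain ⟨x, y, z, hxy, hxz, hyz, hp, hp'⟩ := exists_three_of_same_parity hmn
  have h1 := (triple_relations hm hmn hJ hxy hxz hyz hp hp').2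
    (map_ιU_eq_zero_of_ne hm hmn hJ hlam)
  refine (smul_eq_zero_iff_right ?_).1 h1
  exact mul_ne_zero (mul_ne_zero two_ne_zero hlam0) (sdim_add_one_ne_zero hmn)

end Enveloping

section Finite

variable {m n : ℕ} (hm : 1 ≤ m) (hmn : 2 < |(m : ℤ) - (n : ℤ)|) {lam : ℂ}

/-- The quotient map modulo a two-sided ideal. -/
def quotientMap (I : TwoSidedIdeal (U m n)) : U m n →ₐ[ℂ] I.ringCon.Quotient := I.ringCon.mkₐ ℂ

theorem ker_quotientMap (I : TwoSidedIdeal (U m n)) : TwoSidedIdeal.ker (quotientMap I) = I :=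
  TwoSidedIdeal.ker_ringCon_mk' I

/-- The augmentation of `U(𝔤)`, with kernel `𝔤 U(𝔤)`. -/
def augmentation (m n : ℕ) : U m n →ₐ[ℂ] ℂ := liftU 0 fun _ _ _ _ _ _ => by simp

theorem augmentation_ιU (X : sl m n) : augmentation m n (ιU m n X) = 0 := liftU_ιU _ _ _

theorem sub_augmentation_mem (x : U m n) :
    x - algebraMap ℂ _ (augmentation m n x) ∈ gU m n := by
  have hmul : ∀ x ∈ gU m n, ∀ y, x * y ∈ gU m n := by
    intro x hx y
    have : gU m n * ⊤ ≤ gU m n := by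
      rw [gU, mul_assoc]
      exact mul_le_mul_right le_top _
    exact this (Submodule.mul_mem_mul hx Submodule.mem_top)
  induction x using U_induction with
  | scalar r =>
    rw [AlgHom.commutes]
    simp
  | basic X =>
    rw [augmentation_ιU, map_zero, sub_zero, ← mul_one (ιU m n X)]
    exact Submodule.mul_mem_mul ⟨X, rfl⟩ Submodule.mem_top
  | mul x y hx hy =>
    have e : x * y - algebraMap ℂ (U m n) (augmentation m n (x * y)) =
        (x - algebraMap ℂ (U m n) (augmentation m n x)) * y +
          augmentation m n x • (y - algebraMap ℂ (U m n) (augmentation m n y)) := by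
      rw [map_mul, map_mul, Algebra.smul_def, sub_mul, mul_sub]
      abel
    rw [e]
    exact add_mem (hmul _ hx _) (Submodule.smul_mem _ _ hy)
  | add x y hx hy =>
    rw [map_add, map_add, add_sub_add_comm]
    exact add_mem hx hy

include hm hmn

theorem J_zero_le : J m n 0 ≤ TwoSidedIdeal.ker (augmentation m n) := by
  have h : (augmentation m n).toLinearMap ∘ₗ ιU m n = 0 := LinearMap.ext augmentation_ιU
  have hr : ∀ s, rel (0 : sl m n →ₗ[ℂ] ℂ) 0 s = 0 := fun s => by
    simp [rel_apply]
  refine J_le_ker hm hmn 0 _ (fun i j k l => ?_) fun i j k l => ?_ <;> rw [h, hr]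

theorem ιU_mem_J (hlam : lam ≠ criticalValue m n) (X : sl m n) : ιU m n X ∈ J m n lam := by
  rw [← ker_quotientMap (J m n lam), TwoSidedIdeal.mem_ker]
  exact map_ιU_eq_zero_of_ne hm hmn (ker_quotientMap _).ge hlam X

theorem gU_le_J (hlam : lam ≠ criticalValue m n) {x : U m n} (hx : x ∈ gU m n) :
    x ∈ J m n lam := by
  induction hx using Submodule.mul_induction_on' with
  | mem_mul_mem x hx y hy =>
    obtain ⟨X, rfl⟩ := hx
    exact TwoSidedIdeal.mul_mem_right _ _ _ (ιU_mem_J hm hmn hlam X)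
  | add x _ y _ hx hy => exact add_mem hx hy

theorem finiteCodim_J (hlam : lam ≠ criticalValue m n) : FiniteCodim m n (J m n lam) := by
  refine Module.Finite.of_surjective
    (Algebra.linearMap ℂ (J m n lam).ringCon.Quotient) fun y => ?_
  obtain ⟨x, rfl⟩ := RingCon.mkₐ_surjective (α := ℂ) (J m n lam).ringCon y
  have h1 := gU_le_J hm hmn hlam (sub_augmentation_mem x)
  rw [← ker_quotientMap (J m n lam), TwoSidedIdeal.mem_ker, map_sub, AlgHom.commutes] at h1
  exact ⟨_, (sub_eq_zero.1 h1).symm⟩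

theorem J_eq_top (hlam : lam ≠ criticalValue m n) (hlam0 : lam ≠ 0) : J m n lam = ⊤ := by
  have h1 := one_eq_zero_of_ne hm hmn (ker_quotientMap (J m n lam)).ge hlam hlam0
  rw [← map_one (quotientMap (J m n lam)), ← TwoSidedIdeal.mem_ker, ker_quotientMap] at h1
  exact (TwoSidedIdeal.one_mem_iff _).1 h1

theorem J_zero_eq_gU : (J m n 0 : Set (U m n)) = gU m n := by
  have h0 : (0 : ℂ) ≠ criticalValue m n := by
    rw [criticalValue]
    exact (div_ne_zero (by norm_num) (mul_ne_zero (by norm_num) (sdim_add_one_ne_zero hmn))).symm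
  refine Set.Subset.antisymm (fun x hx => ?_) fun x hx => gU_le_J hm hmn h0 hx
  have h1 := sub_augmentation_mem x
  rwa [(TwoSidedIdeal.mem_ker (augmentation m n)).1 (J_zero_le hm hmn hx), map_zero,
    sub_zero] at h1

end Finite

/-! ### Quotients of the enveloping algebra at the critical value -/

/-- The element `r i j * r k l - δ j k * r i l`; if `r i j = a i * b j` in a Weyl superalgebra, it
is the normally ordered product of `r i j` and `r k l`, up to sign. -/
def normalProd {I A : Type*} [DecidableEq I] [Ring A] (r : I → I → A) (i j k l : I) : A :=
  r i j * r k l - if j = k then r i l else 0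

/-- The relations between the elements `r i j = a i * b j` of a Weyl superalgebra: the normally
ordered products are supersymmetric in the row indices and in the column indices. -/
structure IsOscillator {I A : Type*} [DecidableEq I] [Ring A] [Algebra ℂ A] (p : I → Fin 2)
    (r : I → I → A) : Prop where
  row : ∀ i j k l, normalProd r i j k l = rowSign p i j k • normalProd r k j i l
  col : ∀ i j k l, normalProd r i j k l = colSign p j k l • normalProd r i l k j

theorem IsOscillator.comm {I A : Type*} [DecidableEq I] [Ring A] [Algebra ℂ A] {p : I → Fin 2}
    {r : I → I → A} (hr : IsOscillator p r) (i j k l : I) :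
    r i j * r k l - sg (p i + p j) (p k + p l) • (r k l * r i j) =
      (if j = k then r i l else 0) -
        sg (p i + p j) (p k + p l) • (if i = l then r k j else 0) := by
  have h1 := hr.row i j k l
  rw [hr.col k j i l, smul_smul] at h1
  have e : rowSign p i j k * colSign p j i l = sg (p i + p j) (p k + p l) := by
    rw [rowSign, colSign, sg_add_left, sg_add_right, sg_add_right]
    generalize p i = x
    generalize p j = y
    generalize p k = z
    generalize p l = w
    fin_cases x <;> fin_cases y <;> fin_cases z <;> fin_cases w <;> simp [sg]
  rw [e, normalProd, normalProd] at h1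
  simp only [eq_comm (a := l)] at h1
  linear_combination (norm := module) h1

theorem sum_sum_comm {I M : Type*} [Fintype I] [AddCommMonoid M] (F : I → I → I → I → M) :
    ∑ i, ∑ j, ∑ k, ∑ l, F i j k l = ∑ k, ∑ l, ∑ i, ∑ j, F i j k l := by
  have := Finset.sum_comm (s := Finset.univ) (t := Finset.univ)
    (f := fun (x : I × I) (y : I × I) => F x.1 x.2 y.1 y.2)
  simpa only [Fintype.sum_prod_type] using this

section Hom

variable {m n : ℕ} {A : Type*} [Ring A] [Algebra ℂ A] (r : Fin (m + n) → Fin (m + n) → A)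

/-- The linear map `X ↦ ∑ Xᵢⱼ rᵢⱼ` on `𝔤𝔩`. -/
def matSum : Mat m n →ₗ[ℂ] A where
  toFun X := ∑ i, ∑ j, X i j • r i j
  map_add' X Y := by simp only [Matrix.add_apply, add_smul, Finset.sum_add_distrib]
  map_smul' c X := by
    simp only [Matrix.smul_apply, smul_eq_mul, mul_smul, Finset.smul_sum, RingHom.id_apply]

theorem matSum_apply (X : Mat m n) : matSum r X = ∑ i, ∑ j, X i j • r i j := rfl

theorem matSum_single (i j : Fin (m + n)) : matSum r (Matrix.single i j 1) = r i j := by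
  simp [matSum_apply, Matrix.single_apply, ite_and, ite_smul]

theorem matSum_one : matSum r 1 = ∑ i, r i i := by
  simp [matSum_apply, Matrix.one_apply, ite_smul]

variable {r}

theorem matSum_comm (hr : IsOscillator (parity m n) r) {a b : Fin 2} {X Y : sl m n}
    (hX : IsHomogeneous m n a X) (hY : IsHomogeneous m n b Y) :
    matSum r X.val * matSum r Y.val - sg a b • (matSum r Y.val * matSum r X.val) =
      matSum r (bracket m n X Y).val := by
  have e1 : (bracket m n X Y).val = ∑ i, ∑ j, ∑ k, ∑ l, (X.val i j * Y.val k l) •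
      matBracket m n (Matrix.single i j 1) (Matrix.single k l 1) := by
    change matBracket m n X.val Y.val = _
    conv_lhs => rw [Matrix.matrix_eq_sum_single X.val, Matrix.matrix_eq_sum_single Y.val]
    have e (C : Mat m n) (i j : Fin (m + n)) : Matrix.single i j (C i j) =
        C i j • Matrix.single i j (1 : ℂ) := by rw [Matrix.smul_single, smul_eq_mul, mul_one]
    simp only [e, map_sum, map_smul, LinearMap.sum_apply, LinearMap.smul_apply, Finset.smul_sum,
      smul_smul]
    simp only [mul_comm (Y.val _ _)]
    exact sum_sum_comm fun k l i j => (X.val i j * Y.val k l) •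
      matBracket m n (Matrix.single i j 1) (Matrix.single k l 1)
  have e2 : ∀ Z W : sl m n, matSum r Z.val * matSum r W.val =
      ∑ i, ∑ j, ∑ k, ∑ l, (Z.val i j * W.val k l) • (r i j * r k l) := by
    intro Z W
    simp only [matSum_apply, Finset.sum_mul, Finset.mul_sum, smul_mul_smul_comm]
    exact sum_sum_comm (M := A) _
  have e3 : matSum r Y.val * matSum r X.val =
      ∑ i, ∑ j, ∑ k, ∑ l, (X.val i j * Y.val k l) • (r k l * r i j) := by
    rw [e2, sum_sum_comm]
    simp only [mul_comm (X.val _ _)]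
  rw [e1, e2, e3]
  simp only [map_sum, map_smul, Finset.smul_sum, ← Finset.sum_sub_distrib]
  refine Finset.sum_congr rfl fun i _ => Finset.sum_congr rfl fun j _ =>
    Finset.sum_congr rfl fun k _ => Finset.sum_congr rfl fun l _ => ?_
  by_cases hx : X.val i j = 0
  · simp [hx]
  by_cases hy : Y.val k l = 0
  · simp [hy]
  rw [matBracket_single, map_sub, map_smul, apply_ite (matSum r), apply_ite (matSum r), map_zero,
    matSum_single, matSum_single, ← hr.comm i j k l, ← hX i j hx, ← hY k l hy]
  module

variable (hm : 1 ≤ m) (hmn : 2 < |(m : ℤ) - (n : ℤ)|)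

include hmn in
theorem criticalValue_mul : criticalValue m n * (8 * ((m : ℂ) - n + 1)) = -1 := by
  have := sdim_add_one_ne_zero hmn
  rw [criticalValue]
  field_simp

include hmn in
/-- The traceless part of a diagonal unit is shifted by a half, as `∑ r i i` acts by
`-(m - n) / 2`. -/
theorem matSum_slUnit (hsum : ∑ i, r i i = (-((m : ℂ) - n) / 2) • (1 : A)) (i j : Fin (m + n)) :
    matSum r (slUnit (sdim_ne_zero hmn) i j).val = r i j +
      (if i = j then sg (parity m n i) (parity m n i) / 2 else 0 : ℂ) • (1 : A) := by
  have h0 := sdim_ne_zero hmn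
  rw [slUnit, toSl_val, map_sub, map_smul, matSum_single, matSum_one, hsum, supertrace_single,
    smul_smul, sub_eq_add_neg, ← neg_smul]
  congr 2
  split_ifs
  · field_simp
  · simp

/-- The relations in terms of the normally ordered products. The constant terms of the two kinds
have the same coefficient because `1 / 4 + 2 c = -2 c (m - n)` holds for the critical value `c`. -/
theorem rel_matSum (hsum : ∑ i, r i i = (-((m : ℂ) - n) / 2) • (1 : A)) (i j k l : Fin (m + n)) :
    rel (matSum r ∘ₗ (sl m n).subtype) (criticalValue m n)
      (slUnit (sdim_ne_zero hmn) i j ⊗ₜ slUnit (sdim_ne_zero hmn) k l) =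
    normalProd r i j k l + (if j = k then 1 / 2 else 0 : ℂ) • r i l +
      (if i = j then sg (parity m n i) (parity m n i) / 2 else 0 : ℂ) • r k l +
      (if k = l then sg (parity m n k) (parity m n k) / 2 else 0 : ℂ) • r i j +
      (if i = l then sg (parity m n i + parity m n j) (parity m n k + parity m n l) / 2
        else 0 : ℂ) • r k j +
      ((-2 * criticalValue m n * ((m : ℂ) - n)) *
        ((if i = j ∧ k = l then sg (parity m n i) (parity m n i) * sg (parity m n k) (parity m n k)
          else 0) +
        (if j = k ∧ i = l then sg (parity m n i) (parity m n i) else 0))) • (1 : A) := by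
  have hc := criticalValue_mul hmn
  rw [rel_slUnit]
  simp only [LinearMap.comp_apply, Submodule.subtype_apply, matSum_slUnit hmn hsum]
  rw [normalProd]
  generalize criticalValue m n = c at *
  generalize (m : ℂ) - n = d at *
  have e : ∀ x : Fin 2, x + x = 0 := by decide
  simp only [add_mul, mul_add, smul_mul_assoc, mul_smul_comm, one_mul, mul_one]
  have hite : ∀ (P : Prop) [Decidable P] (x : A),
      (if P then x else 0) = (if P then (1 : ℂ) else 0) • x := fun P _ x => by
    split_ifs <;> simp
  simp only [hite, smul_add, smul_smul]
  have hconst : (if k = l then sg (parity m n k) (parity m n k) / 2 else 0 : ℂ) *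
        (if i = j then sg (parity m n i) (parity m n i) / 2 else 0) -
      1 / 2 * ((if j = k then 1 else 0) * (if i = l then sg (parity m n i) (parity m n i) / 2
          else 0) - sg (parity m n i + parity m n j) (parity m n k + parity m n l) *
        ((if i = l then 1 else 0) * (if k = j then sg (parity m n k) (parity m n k) / 2 else 0))) -
      2 * c * (d * (if j = k ∧ i = l then sg (parity m n i) (parity m n i) else 0) -
        if i = j ∧ k = l then sg (parity m n i) (parity m n i) * sg (parity m n k) (parity m n k)
          else 0) =
      -2 * c * d * ((if i = j ∧ k = l then
          sg (parity m n i) (parity m n i) * sg (parity m n k) (parity m n k) else 0) +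
        if j = k ∧ i = l then sg (parity m n i) (parity m n i) else 0) := by
    have hd : 1 / 4 + 2 * c = -2 * c * d := by linear_combination hc / 4
    by_cases h1 : j = k ∧ i = l
    · obtain ⟨rfl, rfl⟩ := h1
      have hs : sg (parity m n i + parity m n j) (parity m n j + parity m n i) *
          sg (parity m n j) (parity m n j) = sg (parity m n i) (parity m n i) := by
        generalize parity m n i = x
        generalize parity m n j = y
        fin_cases x <;> fin_cases y <;> simp [sg]
      simp only [and_self, if_true, eq_comm (a := j) (b := i), one_mul]
      split_ifs
      · linear_combination hs / 4 +
          sg (parity m n i) (parity m n i) * sg (parity m n j) (parity m n j) * hd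
      · linear_combination hs / 4
    · rw [if_neg h1]
      have h2 : ((if j = k then 1 else 0 : ℂ) *
          if i = l then sg (parity m n i) (parity m n i) / 2 else 0) = 0 := by
        by_cases h : j = k
        · rw [if_neg fun h' => h1 ⟨h, h'⟩, mul_zero]
        · rw [if_neg h, zero_mul]
      have h3 : ((if i = l then 1 else 0 : ℂ) *
          if k = j then sg (parity m n k) (parity m n k) / 2 else 0) = 0 := by
        by_cases h : i = l
        · rw [if_neg fun h' : k = j => h1 ⟨h'.symm, h⟩, mul_zero]
        · rw [if_neg h, zero_mul]
      rw [h2, h3, ite_and]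
      split_ifs
      · linear_combination
          sg (parity m n i) (parity m n i) * sg (parity m n k) (parity m n k) * hd
      all_goals ring
  match_scalars
  · ring
  · ring
  · ring
  · linear_combination hconst
  · split_ifs <;> ring
  · split_ifs <;> ring

variable (hr : IsOscillator (parity m n) r)

/-- The homomorphism from `U(𝔤)` given by oscillators. -/
def oscillatorHom (hr : IsOscillator (parity m n) r) : U m n →ₐ[ℂ] A :=
  liftU (matSum r ∘ₗ (sl m n).subtype) fun _ _ _ _ hX hY => matSum_comm hr hX hY

theorem oscillatorHom_ιU (X : sl m n) : oscillatorHom hr (ιU m n X) = matSum r X.val :=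
  liftU_ιU _ _ X

include hm hmn in
/-- At the critical value, the quadratic relations for `X = ∑ Xᵢⱼ rᵢⱼ` amount to the supersymmetry
of the normally ordered products. -/
theorem J_le_ker_oscillatorHom (hsum : ∑ i, r i i = (-((m : ℂ) - n) / 2) • (1 : A)) :
    J m n (criticalValue m n) ≤ TwoSidedIdeal.ker (oscillatorHom hr) := by
  have h0 : (oscillatorHom hr).toLinearMap ∘ₗ ιU m n = matSum r ∘ₗ (sl m n).subtype :=
    LinearMap.ext (oscillatorHom_ιU hr)
  refine J_le_ker hm hmn _ _ (fun i j k l => ?_) fun i j k l => ?_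
  · rw [h0, map_sub, map_sub, map_smul, map_smul, ofCoord_unit, ofCoord_unit, rel_matSum hmn hsum,
      rel_matSum hmn hsum, hr.row i j k l]
    generalize -2 * criticalValue m n * ((m : ℂ) - n) = c
    have a1 : rowSign (parity m n) i j k * (if j = i then 1 / 2 else 0) =
        if i = j then sg (parity m n i) (parity m n i) / 2 else 0 := by
      by_cases h : i = j
      · subst h
        simp only [if_true, rowSign]
        generalize parity m n i = ui
        generalize parity m n k = uk
        fin_cases ui <;> fin_cases uk <;> norm_num [sg]
      · simp [h, Ne.symm h]
    have a2 : rowSign (parity m n) i j k *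
        (if k = j then sg (parity m n k) (parity m n k) / 2 else 0) =
        if j = k then 1 / 2 else 0 := by
      by_cases h : j = k
      · subst h
        simp only [if_true, rowSign]
        generalize parity m n i = ui
        generalize parity m n j = uj
        fin_cases ui <;> fin_cases uj <;> norm_num [sg]
      · simp [h, Ne.symm h]
    have a3 : rowSign (parity m n) i j k *
        (if i = l then sg (parity m n i) (parity m n i) / 2 else 0) =
        if i = l then sg (parity m n i + parity m n j) (parity m n k + parity m n l) / 2
          else 0 := by
      by_cases h : i = l
      · subst h
        simp only [if_true, rowSign, sg_add_left, sg_add_right]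
        generalize parity m n i = ui
        generalize parity m n j = uj
        generalize parity m n k = uk
        fin_cases ui <;> fin_cases uj <;> fin_cases uk <;> norm_num [sg]
      · simp [h]
    have a4 : rowSign (parity m n) i j k *
        (if k = l then sg (parity m n k + parity m n j) (parity m n i + parity m n l) / 2
          else 0) =
        if k = l then sg (parity m n k) (parity m n k) / 2 else 0 := by
      by_cases h : k = l
      · subst h
        simp only [if_true, rowSign, sg_add_left, sg_add_right]
        generalize parity m n i = ui
        generalize parity m n j = uj
        generalize parity m n k = uk
        fin_cases ui <;> fin_cases uj <;> fin_cases uk <;> norm_num [sg]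
      · simp [h]
    have a5 : rowSign (parity m n) i j k * ((if k = j ∧ i = l then
          sg (parity m n k) (parity m n k) * sg (parity m n i) (parity m n i) else 0) +
        (if j = i ∧ k = l then sg (parity m n k) (parity m n k) else 0)) =
        (if i = j ∧ k = l then sg (parity m n i) (parity m n i) * sg (parity m n k) (parity m n k)
          else 0) +
        (if j = k ∧ i = l then sg (parity m n i) (parity m n i) else 0) := by
      have b1 : rowSign (parity m n) i j k * (if k = j ∧ i = l then
          sg (parity m n k) (parity m n k) * sg (parity m n i) (parity m n i) else 0) =
          if j = k ∧ i = l then sg (parity m n i) (parity m n i) else 0 := by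
        by_cases h : j = k ∧ i = l
        · obtain ⟨rfl, rfl⟩ := h
          simp only [and_self, if_true, rowSign]
          generalize parity m n i = x
          generalize parity m n j = y
          fin_cases x <;> fin_cases y <;> norm_num [sg]
        · rw [if_neg h, if_neg fun h' => h ⟨h'.1.symm, h'.2⟩, mul_zero]
      have b2 : rowSign (parity m n) i j k * (if j = i ∧ k = l then
          sg (parity m n k) (parity m n k) else 0) = if i = j ∧ k = l then
          sg (parity m n i) (parity m n i) * sg (parity m n k) (parity m n k) else 0 := by
        by_cases h : i = j ∧ k = l
        · obtain ⟨rfl, rfl⟩ := h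
          simp only [and_self, if_true, rowSign]
          generalize parity m n i = x
          generalize parity m n k = y
          fin_cases x <;> fin_cases y <;> norm_num [sg]
        · rw [if_neg h, if_neg fun h' => h ⟨h'.1.symm, h'.2⟩, mul_zero]
      rw [mul_add, b1, b2, add_comm]
    linear_combination (norm := module) -(a1 • r k l) - a2 • r i l - a3 • r k j - a4 • r i j -
      (c * a5) • (1 : A)
  · rw [h0, map_sub, map_sub, map_smul, map_smul, ofCoord_unit, ofCoord_unit, rel_matSum hmn hsum,
      rel_matSum hmn hsum, hr.col i j k l]
    generalize -2 * criticalValue m n * ((m : ℂ) - n) = c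
    have a1 : colSign (parity m n) j k l * (if l = k then 1 / 2 else 0) =
        if k = l then sg (parity m n k) (parity m n k) / 2 else 0 := by
      by_cases h : k = l
      · subst h
        simp only [if_true, colSign]
        generalize parity m n j = uj
        generalize parity m n k = uk
        fin_cases uj <;> fin_cases uk <;> norm_num [sg]
      · simp [h, Ne.symm h]
    have a2 : colSign (parity m n) j k l *
        (if i = l then sg (parity m n i) (parity m n i) / 2 else 0) =
        if i = l then sg (parity m n i + parity m n j) (parity m n k + parity m n l) / 2
          else 0 := by
      by_cases h : i = l
      · subst h
        simp only [if_true, colSign, sg_add_left, sg_add_right]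
        generalize parity m n i = ui
        generalize parity m n j = uj
        generalize parity m n k = uk
        fin_cases ui <;> fin_cases uj <;> fin_cases uk <;> norm_num [sg]
      · simp [h]
    have a3 : colSign (parity m n) j k l *
        (if k = j then sg (parity m n k) (parity m n k) / 2 else 0) =
        if j = k then 1 / 2 else 0 := by
      by_cases h : j = k
      · subst h
        simp only [if_true, colSign]
        generalize parity m n j = uj
        generalize parity m n l = ul
        fin_cases uj <;> fin_cases ul <;> norm_num [sg]
      · simp [h, Ne.symm h]
    have a4 : colSign (parity m n) j k l *
        (if i = j then sg (parity m n i + parity m n l) (parity m n k + parity m n j) / 2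
          else 0) =
        if i = j then sg (parity m n i) (parity m n i) / 2 else 0 := by
      by_cases h : i = j
      · subst h
        simp only [if_true, colSign, sg_add_left, sg_add_right]
        generalize parity m n i = ui
        generalize parity m n k = uk
        generalize parity m n l = ul
        fin_cases ui <;> fin_cases uk <;> fin_cases ul <;> norm_num [sg]
      · simp [h]
    have a5 : colSign (parity m n) j k l * ((if i = l ∧ k = j then
          sg (parity m n i) (parity m n i) * sg (parity m n k) (parity m n k) else 0) +
        (if l = k ∧ i = j then sg (parity m n i) (parity m n i) else 0)) =
        (if i = j ∧ k = l then sg (parity m n i) (parity m n i) * sg (parity m n k) (parity m n k)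
          else 0) +
        (if j = k ∧ i = l then sg (parity m n i) (parity m n i) else 0) := by
      have b1 : colSign (parity m n) j k l * (if i = l ∧ k = j then
          sg (parity m n i) (parity m n i) * sg (parity m n k) (parity m n k) else 0) =
          if j = k ∧ i = l then sg (parity m n i) (parity m n i) else 0 := by
        by_cases h : j = k ∧ i = l
        · obtain ⟨rfl, rfl⟩ := h
          simp only [and_self, if_true, colSign]
          generalize parity m n i = x
          generalize parity m n j = y
          fin_cases x <;> fin_cases y <;> norm_num [sg]
        · rw [if_neg h, if_neg fun h' => h ⟨h'.2.symm, h'.1⟩, mul_zero]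
      have b2 : colSign (parity m n) j k l * (if l = k ∧ i = j then
          sg (parity m n i) (parity m n i) else 0) = if i = j ∧ k = l then
          sg (parity m n i) (parity m n i) * sg (parity m n k) (parity m n k) else 0 := by
        by_cases h : i = j ∧ k = l
        · obtain ⟨rfl, rfl⟩ := h
          simp only [and_self, if_true, colSign]
          generalize parity m n i = x
          generalize parity m n k = y
          fin_cases x <;> fin_cases y <;> norm_num [sg]
        · rw [if_neg h, if_neg fun h' => h ⟨h'.2, h'.1.symm⟩, mul_zero]
      rw [mul_add, b1, b2, add_comm]
    linear_combination (norm := module) -(a1 • r i j) - a2 • r k j - a3 • r i l - a4 • r k l -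
      (c * a5) • (1 : A)

end Hom

/-! ### A Weyl superalgebra acting on functions -/

section Weyl

/-- The relations of a Weyl superalgebra: `a i` and `b i` have the parity `p i`, the `a i`
supercommute, so do the `b i`, and the supercommutator of `b i` and `a k` is `δ i k`. -/
structure IsSuperWeyl {I A : Type*} [DecidableEq I] [Ring A] [Algebra ℂ A] (p : I → Fin 2)
    (a b : I → A) : Prop where
  raise_comm : ∀ i k, a i * a k = sg (p i) (p k) • (a k * a i)
  lower_comm : ∀ i k, b i * b k = sg (p i) (p k) • (b k * b i)
  lower_raise : ∀ i k, b i * a k = sg (p i) (p k) • (a k * b i) + if i = k then 1 else 0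

variable {I A : Type*} [Fintype I] [DecidableEq I] [Ring A] [Algebra ℂ A] {p : I → Fin 2}
  {a b : I → A}

theorem IsSuperWeyl.normalProd_eq (h : IsSuperWeyl p a b) (i j k l : I) :
    normalProd (fun i j => a i * b j) i j k l = sg (p j) (p k) • (a i * a k * (b j * b l)) := by
  have e : a i * b j * (a k * b l) = a i * (b j * a k) * b l := by noncomm_ring
  rw [normalProd, e, h.lower_raise j k]
  split_ifs
  · rw [mul_add, add_mul, mul_one, mul_smul_comm, smul_mul_assoc, add_sub_cancel_right]
    simp only [mul_assoc]
  · rw [add_zero, sub_zero, mul_smul_comm, smul_mul_assoc]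
    simp only [mul_assoc]

theorem IsSuperWeyl.isOscillator (h : IsSuperWeyl p a b) :
    IsOscillator p fun i j => a i * b j := by
  refine ⟨fun i j k l => ?_, fun i j k l => ?_⟩
  · rw [h.normalProd_eq, h.normalProd_eq, h.raise_comm i k, smul_mul_assoc, smul_smul, smul_smul,
      rowSign]
    congr 1
    generalize p i = x
    generalize p j = y
    generalize p k = z
    fin_cases x <;> fin_cases y <;> fin_cases z <;> simp [sg]
  · rw [h.normalProd_eq, h.normalProd_eq, h.lower_comm j l, mul_smul_comm, smul_smul, smul_smul,
      colSign]
    congr 1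
    generalize p j = x
    generalize p k = y
    generalize p l = z
    fin_cases x <;> fin_cases y <;> fin_cases z <;> simp [sg]

/-- The Euler operator commutes with the products `a k * b l`. -/
theorem IsSuperWeyl.commute_euler (h : IsSuperWeyl p a b) (k l : I) :
    Commute (∑ i, a i * b i) (a k * b l) := by
  have h1 : (∑ i, a i * b i) * a k = a k + a k * ∑ i, a i * b i := by
    rw [Finset.sum_mul, Finset.mul_sum]
    have e : ∀ i, a i * b i * a k = (if i = k then a k else 0) + a k * (a i * b i) := by
      intro i
      rw [mul_assoc, h.lower_raise, mul_add, mul_smul_comm, ← mul_assoc, h.raise_comm i k,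
        smul_mul_assoc, smul_smul, sg_mul_self, one_smul, mul_assoc, add_comm]
      congr 1
      split_ifs with hik
      · rw [hik, mul_one]
      · rw [mul_zero]
    rw [Finset.sum_congr rfl fun i _ => e i, Finset.sum_add_distrib]
    simp
  have h2 : (∑ i, a i * b i) * b l = b l * (∑ i, a i * b i) - b l := by
    rw [Finset.sum_mul, Finset.mul_sum]
    have e : ∀ i, a i * b i * b l = b l * (a i * b i) - if i = l then b l else 0 := by
      intro i
      rw [mul_assoc, h.lower_comm i l, mul_smul_comm, ← mul_assoc (b l), h.lower_raise l i,
        sg_comm (p l), add_mul, smul_mul_assoc, ← mul_assoc]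
      by_cases hil : i = l
      · rw [if_pos hil, if_pos hil.symm, one_mul, hil, add_sub_cancel_right]
      · rw [if_neg hil, if_neg (Ne.symm hil), zero_mul, add_zero, sub_zero]
    rw [Finset.sum_congr rfl fun i _ => e i, Finset.sum_sub_distrib]
    simp
  rw [commute_iff_eq, ← mul_assoc, h1, add_mul, mul_assoc, h2, mul_sub, ← mul_assoc, mul_assoc]
  abel

end Weyl

section Restrict

variable {I V : Type*} [Fintype I] [DecidableEq I] [AddCommGroup V] [Module ℂ V] {p : I → Fin 2}
  {a b : I → Module.End ℂ V}

/-- An eigenspace of the Euler operator. -/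
def eulerSpace (a b : I → Module.End ℂ V) (c : ℂ) : Submodule ℂ V :=
  LinearMap.ker ((∑ i, a i * b i) - c • 1)

theorem mem_eulerSpace {c : ℂ} {v : V} :
    v ∈ eulerSpace a b c ↔ (∑ i, a i * b i) v = c • v := by
  rw [eulerSpace, LinearMap.mem_ker, LinearMap.sub_apply, sub_eq_zero]
  rfl

theorem IsSuperWeyl.mem_eulerSpace (h : IsSuperWeyl p a b) (k l : I) (c : ℂ) :
    ∀ v ∈ eulerSpace a b c, (a k * b l) v ∈ eulerSpace a b c := by
  intro v hv
  rw [SuperJoseph.mem_eulerSpace] at hv ⊢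
  have := LinearMap.congr_fun (h.commute_euler k l).eq v
  rw [Module.End.mul_apply] at this
  rw [this, Module.End.mul_apply (a k * b l), hv, map_smul]

/-- The action of `a k * b l` on an eigenspace of the Euler operator. -/
def eulerRestrict (h : IsSuperWeyl p a b) (c : ℂ) (k l : I) : Module.End ℂ (eulerSpace a b c) :=
  (a k * b l).restrict (h.mem_eulerSpace k l c)

theorem eulerRestrict_val (h : IsSuperWeyl p a b) (c : ℂ) (k l : I) (v : eulerSpace a b c) :
    (eulerRestrict h c k l v).val = (a k * b l) v.val := rfl

theorem normalProd_eulerRestrict_val (h : IsSuperWeyl p a b) (c : ℂ) (i j k l : I)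
    (v : eulerSpace a b c) : (normalProd (eulerRestrict h c) i j k l v).val =
      normalProd (fun i j => a i * b j) i j k l v.val := by
  rw [normalProd, normalProd]
  split_ifs <;> rfl

theorem isOscillator_eulerRestrict (h : IsSuperWeyl p a b) (c : ℂ) :
    IsOscillator p (eulerRestrict h c) := by
  refine ⟨fun i j k l => LinearMap.ext fun v => Subtype.ext ?_,
    fun i j k l => LinearMap.ext fun v => Subtype.ext ?_⟩
  · rw [LinearMap.smul_apply, Submodule.coe_smul, normalProd_eulerRestrict_val,
      normalProd_eulerRestrict_val, h.isOscillator.row]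
    rfl
  · rw [LinearMap.smul_apply, Submodule.coe_smul, normalProd_eulerRestrict_val,
      normalProd_eulerRestrict_val, h.isOscillator.col]
    rfl

theorem sum_eulerRestrict (h : IsSuperWeyl p a b) (c : ℂ) :
    ∑ i, eulerRestrict h c i i = c • 1 := by
  refine LinearMap.ext fun v => Subtype.ext ?_
  have := SuperJoseph.mem_eulerSpace.1 v.2
  rw [LinearMap.sum_apply] at this ⊢
  rw [Submodule.coe_sum]
  exact this

end Restrict

section Model

variable {I : Type*} [Fintype I] [LinearOrder I] (p : I → Fin 2)

/-- The sign which an odd operator at the place `i` picks up from the places before `i`. -/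
def orderSign (i : I) (α : I → ℤ) : ℂ := ∏ j, if j < i then sg (p i) (p j) ^ α j else 1

theorem orderSign_mul_self (i : I) (α : I → ℤ) : orderSign p i α * orderSign p i α = 1 := by
  rw [orderSign, ← Finset.prod_mul_distrib]
  refine Finset.prod_eq_one fun j _ => ?_
  split_ifs
  · rw [← mul_zpow, sg_mul_self, one_zpow]
  · rw [mul_one]

theorem orderSign_add_single (i k : I) (α : I → ℤ) {c : ℤ} (hc : c = 1 ∨ c = -1) :
    orderSign p i (α + Pi.single k c) =
      (if k < i then sg (p i) (p k) else 1) * orderSign p i α := by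
  have e : ∀ j, (if j < i then sg (p i) (p j) ^ (α + Pi.single k c : I → ℤ) j else 1) =
      (if j = k then (if k < i then sg (p i) (p k) else 1) else 1) *
        if j < i then sg (p i) (p j) ^ α j else 1 := by
    intro j
    by_cases hj : j = k
    · subst hj
      by_cases hi : j < i
      · have hs : sg (p i) (p j) ^ c = sg (p i) (p j) := by
          rcases hc with rfl | rfl
          · rw [zpow_one]
          · rw [zpow_neg_one, inv_eq_of_mul_eq_one_left (sg_mul_self _ _)]
        rw [if_pos hi, if_pos rfl, if_pos hi, if_pos hi, Pi.add_apply, Pi.single_eq_same,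
          zpow_add₀ (sg_ne_zero _ _), hs, mul_comm]
      · simp [hi]
    · simp [hj]
  rw [orderSign, Finset.prod_congr rfl fun j _ => e j, Finset.prod_mul_distrib,
    Finset.prod_ite_eq' , if_pos (Finset.mem_univ _), orderSign]

/-- The operator which shifts the coordinate `α i` by `c`, with a weight `w (α i)`, and with the
sign that makes the operators at odd places anticommute. -/
def shiftOp (i : I) (w : ℤ → ℂ) (c : ℤ) : Module.End ℂ ((I → ℤ) → ℂ) where
  toFun f α := orderSign p i α * w (α i) * f (α + Pi.single i c)
  map_add' f g := by ext α; simp [mul_add]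
  map_smul' x f := by ext α; simp [mul_left_comm]

theorem shiftOp_apply (i : I) (w : ℤ → ℂ) (c : ℤ) (f : (I → ℤ) → ℂ) (α : I → ℤ) :
    shiftOp p i w c f α = orderSign p i α * w (α i) * f (α + Pi.single i c) := rfl

theorem shiftOp_mul_same (i : I) (w w' : ℤ → ℂ) {c : ℤ} (hc : c = 1 ∨ c = -1) (c' : ℤ)
    (f : (I → ℤ) → ℂ) (α : I → ℤ) : (shiftOp p i w c * shiftOp p i w' c') f α =
      w (α i) * w' (α i + c) * f (α + Pi.single i (c + c')) := by
  rw [Module.End.mul_apply, shiftOp_apply, shiftOp_apply, orderSign_add_single p i i α hc,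
    if_neg (lt_irrefl i), one_mul, Pi.add_apply, Pi.single_eq_same, add_assoc α, ← Pi.single_add]
  linear_combination w (α i) * w' (α i + c) * f (α + Pi.single i (c + c')) *
    orderSign_mul_self p i α

theorem shiftOp_comm {i k : I} (hik : i ≠ k) (w w' : ℤ → ℂ) {c c' : ℤ} (hc : c = 1 ∨ c = -1)
    (hc' : c' = 1 ∨ c' = -1) : shiftOp p i w c * shiftOp p k w' c' =
      sg (p i) (p k) • (shiftOp p k w' c' * shiftOp p i w c) := by
  refine LinearMap.ext fun f => funext fun α => ?_
  rw [LinearMap.smul_apply, Pi.smul_apply, smul_eq_mul, Module.End.mul_apply,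
    Module.End.mul_apply, shiftOp_apply, shiftOp_apply, shiftOp_apply, shiftOp_apply,
    orderSign_add_single p k i α hc, orderSign_add_single p i k α hc', Pi.add_apply, Pi.add_apply,
    Pi.single_eq_of_ne hik, Pi.single_eq_of_ne hik.symm, add_zero, add_zero,
    add_right_comm α (Pi.single k c')]
  rcases lt_or_gt_of_ne hik with h | h
  · rw [if_pos h, if_neg h.not_gt, sg_comm (p k)]
    ring
  · rw [if_pos h, if_neg h.not_gt]
    linear_combination -(orderSign p i α * w (α i) * (orderSign p k α * w' (α k)) *
      f (α + Pi.single i c + Pi.single k c')) * sg_mul_self (p i) (p k)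

variable (s : I → ℂ)

/-- The weight of the raising operator at a place: multiplication by an even variable, or by an
odd variable. The exponent of an odd variable matters only modulo two. -/
def raiseWeight (x : Fin 2) (α : ℤ) : ℂ := if x = 0 then 1 else if Odd α then 1 else 0

/-- The weight of the lowering operator: the derivative by an even variable, whose exponent is
shifted by `c`, or by an odd variable. -/
def lowerWeight (x : Fin 2) (c : ℂ) (α : ℤ) : ℂ :=
  if x = 0 then α + 1 + c else if Even α then 1 else 0

/-- Multiplication by the variable at the place `i`. A function `f` on `I → ℤ` stands for the
formal sum `∑ f α x ^ (α + s)`. -/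
def raise (i : I) : Module.End ℂ ((I → ℤ) → ℂ) := shiftOp p i (raiseWeight (p i)) (-1)

/-- The derivative by the variable at the place `i`. -/
def lower (i : I) : Module.End ℂ ((I → ℤ) → ℂ) := shiftOp p i (lowerWeight (p i) (s i)) 1

theorem isSuperWeyl_raise_lower : IsSuperWeyl p (raise p) (lower p s) := by
  have hpar : ∀ x : ℤ, Odd (x + -1) ↔ ¬Odd x := fun x => by
    rw [Int.odd_iff, Int.odd_iff]
    omega
  have hpar' : ∀ x : ℤ, Even (x + 1) ↔ ¬Even x := fun x => Int.even_add_one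
  refine ⟨fun i k => ?_, fun i k => ?_, fun i k => ?_⟩
  · by_cases h : i = k
    · subst h
      refine LinearMap.ext fun f => funext fun α => ?_
      rw [LinearMap.smul_apply, Pi.smul_apply, raise, shiftOp_mul_same p i _ _ (Or.inr rfl)]
      by_cases hp : p i = 0
      · simp [hp]
      · have h0 : raiseWeight (p i) (α i) * raiseWeight (p i) (α i + -1) = 0 := by
          simp only [raiseWeight, if_neg hp, hpar]
          split_ifs <;> simp
        rw [h0, zero_mul, smul_zero]
    · exact shiftOp_comm p h _ _ (Or.inr rfl) (Or.inr rfl)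
  · by_cases h : i = k
    · subst h
      refine LinearMap.ext fun f => funext fun α => ?_
      rw [LinearMap.smul_apply, Pi.smul_apply, lower, shiftOp_mul_same p i _ _ (Or.inl rfl)]
      by_cases hp : p i = 0
      · simp [hp]
      · have h0 : lowerWeight (p i) (s i) (α i) * lowerWeight (p i) (s i) (α i + 1) = 0 := by
          simp only [lowerWeight, if_neg hp, hpar']
          split_ifs <;> simp
        rw [h0, zero_mul, smul_zero]
    · exact shiftOp_comm p h _ _ (Or.inl rfl) (Or.inl rfl)
  · by_cases h : i = k
    · subst h
      refine LinearMap.ext fun f => funext fun α => ?_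
      rw [LinearMap.add_apply, LinearMap.smul_apply, Pi.add_apply, Pi.smul_apply, raise, lower,
        shiftOp_mul_same p i _ _ (Or.inl rfl), shiftOp_mul_same p i _ _ (Or.inr rfl)]
      by_cases hp : p i = 0
      · simp [hp, raiseWeight, lowerWeight]
        ring
      · have hp1 : p i = 1 := by
          revert hp
          generalize p i = x
          revert x
          decide
        have e1 : ∀ x : ℤ, Odd (x + 1) ↔ Even x := fun x => by
          rw [Int.odd_iff, Int.even_iff]
          omega
        have e2 : ∀ x : ℤ, Even (x + -1) ↔ ¬Even x := fun x => by
          rw [Int.even_iff, Int.even_iff]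
          omega
        have e3 : ∀ x : ℤ, Odd x ↔ ¬Even x := fun x => Int.not_even_iff_odd.symm
        simp only [raiseWeight, lowerWeight, if_neg hp, e1, e2, e3]
        by_cases h : Even (α i) <;> simp [h, hp1, sg]
    · rw [if_neg h, add_zero]
      exact shiftOp_comm p h _ _ (Or.inl rfl) (Or.inr rfl)

/-- Monomials are eigenvectors of the operators `raise i * lower i`. -/
theorem raise_mul_lower_apply (i : I) (f : (I → ℤ) → ℂ) (α : I → ℤ) :
    (raise p i * lower p s i) f α =
      (if p i = 0 then α i + s i else if Odd (α i) then 1 else 0) * f α := by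
  rw [raise, lower, shiftOp_mul_same p i _ _ (Or.inr rfl)]
  by_cases hi : p i = 0
  · simp [raiseWeight, lowerWeight, hi]
  · have e2 : ∀ x : ℤ, Even (x + -1) ↔ Odd x := fun x => by
      rw [Int.even_iff, Int.odd_iff]
      omega
    simp only [raiseWeight, lowerWeight, if_neg hi, e2]
    by_cases h : Odd (α i) <;> simp [h]

end Model

/-! ### Infinite codimension at the critical value -/

section Infinite

/-- An element of an algebra that has infinitely many eigenvalues in a representation does not
become algebraic modulo an ideal that acts by zero. -/
theorem not_finite_quotient_of_eigenvalues {A V : Type*} [Ring A] [Algebra ℂ A] [AddCommGroup V]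
    [Module ℂ V] {I : TwoSidedIdeal A} (Φ : A →ₐ[ℂ] Module.End ℂ V)
    (hI : I ≤ TwoSidedIdeal.ker Φ) (x : A) {μ : ℕ → ℂ} (hμ : Function.Injective μ) (v : ℕ → V)
    (hv : ∀ k, v k ≠ 0) (hx : ∀ k, Φ x (v k) = μ k • v k) :
    ¬Module.Finite ℂ I.ringCon.Quotient := by
  intro hfin
  obtain ⟨q, hq, hq0⟩ := IsIntegral.of_finite ℂ (I.ringCon.mkₐ ℂ x)
  rw [← Polynomial.aeval_def, Polynomial.aeval_algHom_apply] at hq0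
  have h1 : Polynomial.aeval x q ∈ I := by
    rw [← TwoSidedIdeal.ker_ringCon_mk' I]
    exact (TwoSidedIdeal.mem_ker _).2 hq0
  have h2 := (TwoSidedIdeal.mem_ker Φ).1 (hI h1)
  rw [← Polynomial.aeval_algHom_apply] at h2
  refine hq.ne_zero (Polynomial.eq_zero_of_infinite_isRoot q
    (Set.infinite_of_injective_forall_mem hμ fun k => ?_))
  have h3 := Module.End.aeval_apply_of_hasEigenvector (p := q)
    (Module.End.hasEigenvector_iff.2 ⟨Module.End.mem_eigenspace_iff.2 (hx k), hv k⟩)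
  rw [h2, LinearMap.zero_apply] at h3
  exact (smul_eq_zero.1 h3.symm).resolve_right (hv k)

variable {m n : ℕ}

/-- The exponents of the monomial `x_i ^ (-k) * x_j ^ k`. -/
def expVec {I : Type*} [DecidableEq I] (i j : I) (k : ℕ) : I → ℤ :=
  Pi.single i (-(k : ℤ)) + Pi.single j (k : ℤ)

/-- On the monomials `x ^ (-(m - n) / 2 - k) * y ^ k` in two even variables, the difference of the
first two diagonal units has the eigenvalues `-2 k - (m - n) / 2`. -/
theorem not_finiteCodim_J_criticalValue (hmn : 2 < |(m : ℤ) - (n : ℤ)|) (hm : 2 ≤ m) :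
    ¬FiniteCodim m n (J m n (criticalValue m n)) := by
  have h0 := sdim_ne_zero hmn
  set x : Fin (m + n) := ⟨0, by omega⟩ with hx
  set y : Fin (m + n) := ⟨1, by omega⟩ with hy
  have hxy : x ≠ y := by simp [hx, hy]
  have hpx : parity m n x = 0 := by
    have : 0 < m := by omega
    simp [parity, hx, this]
  have hpy : parity m n y = 0 := by
    have : 1 < m := by omega
    simp [parity, hy, this]
  -- the shift of the exponent puts the chosen monomials into the required Euler eigenspace
  set s : Fin (m + n) → ℂ := Pi.single x (-((m : ℂ) - n) / 2) with hs
  have hW := isSuperWeyl_raise_lower (parity m n) s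
  have hr := isOscillator_eulerRestrict hW (-((m : ℂ) - n) / 2)
  have hsum := sum_eulerRestrict hW (-((m : ℂ) - n) / 2)
  have hα : ∀ k i, (if parity m n i = 0 then (expVec x y k i : ℂ) + s i
      else if Odd (expVec x y k i) then 1 else 0) = expVec x y k i + s i := by
    intro k i
    split_ifs with h1 h2
    · rfl
    all_goals
      have hix : i ≠ x := by
        rintro rfl
        exact h1 hpx
      have hiy : i ≠ y := by
        rintro rfl
        exact h1 hpy
      simp [expVec, hix, hiy, hs] at *
  have happ : ∀ k i, (raise (parity m n) i * lower (parity m n) s i)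
      (Pi.single (expVec x y k) 1) =
      ((expVec x y k i : ℂ) + s i) • Pi.single (expVec x y k) 1 := by
    intro k i
    funext β
    rw [raise_mul_lower_apply, Pi.smul_apply, smul_eq_mul]
    by_cases hβ : β = expVec x y k
    · rw [hβ, hα]
    · rw [Pi.single_eq_of_ne hβ, mul_zero, mul_zero]
  have hmem : ∀ k, (Pi.single (expVec x y k) 1 : (Fin (m + n) → ℤ) → ℂ) ∈
      eulerSpace (raise (parity m n)) (lower (parity m n) s) (-((m : ℂ) - n) / 2) := by
    intro k
    rw [mem_eulerSpace, LinearMap.sum_apply, Finset.sum_congr rfl fun i _ => happ k i,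
      ← Finset.sum_smul]
    congr 1
    simp [expVec, hs, Finset.sum_add_distrib, Pi.single_apply]
  refine not_finite_quotient_of_eigenvalues (oscillatorHom hr)
    (J_le_ker_oscillatorHom (by omega) hmn hr hsum)
    (ιU m n (slUnit h0 x x) - ιU m n (slUnit h0 y y))
    (μ := fun k => -2 * (k : ℂ) - ((m : ℂ) - n) / 2) (fun k l hkl => ?_)
    (fun k => ⟨_, hmem k⟩) (fun k hk => ?_) fun k => ?_
  · have : (k : ℂ) = l := by linear_combination -hkl / 2
    exact_mod_cast this
  · have := congr_fun (congrArg Subtype.val hk) (expVec x y k)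
    simp at this
  · rw [map_sub, oscillatorHom_ιU, oscillatorHom_ιU, matSum_slUnit hmn hsum,
      matSum_slUnit hmn hsum, hpx, hpy, if_pos rfl, if_pos rfl]
    apply Subtype.ext
    rw [LinearMap.sub_apply, LinearMap.add_apply, LinearMap.add_apply, add_sub_add_right_eq_sub,
      Submodule.coe_sub, eulerRestrict_val, eulerRestrict_val,
      Submodule.coe_smul, happ, happ, ← sub_smul]
    congr 1
    simp [expVec, hs, hxy, hxy.symm]
    ring

end Infinite

end SuperJoseph

end

theorem theorem3 (m n : ℕ) (hm : 1 ≤ m) (hmn : 2 < |(m : ℤ) - (n : ℤ)|) :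
    (∀ lam : ℂ, lam ≠ SuperJoseph.criticalValue m n →
      SuperJoseph.FiniteCodim m n (SuperJoseph.J m n lam) ∧
      (lam ≠ 0 → SuperJoseph.J m n lam = ⊤) ∧
      (lam = 0 →
        (SuperJoseph.J m n lam : Set (SuperJoseph.U m n)) =
          (SuperJoseph.gU m n : Set (SuperJoseph.U m n)))) ∧
    (2 ≤ m →
      ¬ SuperJoseph.FiniteCodim m n
        (SuperJoseph.J m n (SuperJoseph.criticalValue m n))) := by
  refine ⟨fun lam hlam => ⟨SuperJoseph.finiteCodim_J hm hmn hlam,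
    SuperJoseph.J_eq_top hm hmn hlam, ?_⟩, fun hm2 => ?_⟩
  · rintro rfl
    exact SuperJoseph.J_zero_eq_gU hm hmn
  · exact SuperJoseph.not_finiteCodim_J_criticalValue hmn hm2
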